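/- **Theorem 3.2.** Let $d\ge 2$, $L>0$, $\nu>0$, $T>0$, and let $\Omega=\mathbb{T}^d=[0,L]^d$ with periodic boundary conditions. Let $v:\Omega\to\mathbb{R}^d$ be an infinitely smooth vector field with $\nabla\cdot v=0$, and let $f(u)=u^3-u$. Consider the convected Allen–Cahn equation $\partial_t u+v\cdot\nabla u=\nu\Delta u-f(u)$ on $\Omega$, and let $S_1(t)$, $S_2(t)=e^{\nu t\Delta}$, $S_3(t)$ be the solution operators of the three subproblems $\partial_t w=-v\cdot\nabla w$, $\partial_t w=\nu\Delta w$, $\partial_t w=-f(w)$, respectively; explicitly, $S_1(t)[w_0](x)=w_0(X_{-t}(x))$ with $X_t$ the flow of $v$, $S_2(t)$ is the heat semigroup, and $S_3(t)[w_0]=w_0/\sqrt{w_0^2+(1-w_0^2)e^{-2t}}$. For a time step $\tau>0$, initial data $u_0$ and a sequence $\boldsymbol\xi=(\xi^n)_{n\ge 0}$ of permutations of $\{1,2,3\}$, the numerical solution of the random splitting method is $$u_{n+1}=S_{\xi^n_3}(\tau)S_{\xi^n_2}(\tau)S_{\xi^n_1}(\tau)[u_n],\qquad n\ge 0 .$$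 Let $\|u\|_{k,p}=\big(\sum_{|\alpha|\le k}\|D^\alpha u\|_{L^p(\Omega)}^p\big)^{1/p}$ for $p<\infty$ and $\|u\|_{k,\infty}=\max_{|\alpha|\le k}\|D^\alpha u\|_{L^\infty(\Omega)}$, with weak derivatives $D^\alpha$ (the norm being $\infty$ if $u\notin W^{k,p}(\Omega)$). Let $k\in\mathbb{N}=\{0,1,2,\dots\}$ and let $u_0$ be a function on $\Omega$. Then there are constants $M_{k,p}\in[0,\infty)$, $p\in[2,\infty]$, such that the following hold. 1. For every $p\in[2,\infty]$ such that $\|u_0\|_{k,p}<\infty$ and, if $k\ge1$, also $\|u_0\|_{k-1,\infty}<\infty$, one has $$\sup_{n:\,(n+1)\tau\le T}\Big(\|S_{\xi^n_1}(\tau)u_n\|_{k,p}+\|S_{\xi^n_2}(\tau)S_{\xi^n_1}(\tau)u_n\|_{k,p}+\|u_{n+1}\|_{k,p}\Big)\le M_{k,p}$$ for every time step $\tau>0$ and every sequence of permutations $\boldsymbol\xi$; in particular, $M_{k,p}$ does not depend on $n$, $\tau$ or $\boldsymbol\xi$. 2. If $\|u_0\|_{k,\infty}<\infty$ (so that part 1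 applies for all $p\in[2,\infty]$), then the constants in part 1 are bounded uniformly in $p\in[2,\infty]$; in particular, they stay bounded as $p\to\infty$. -/

import Mathlib

open MeasureTheory Set
open scoped ENNReal NNReal ContDiff

namespace RandomSplitting

/-! ### Functions on the torus of side length `L`, as `L`-periodic functions on `ℝ^d` -/

/-- `f` is periodic with period `L` in each coordinate direction, that is, `f` is a function on the
torus `𝕋^d = [0, L]^d` with periodic boundary conditions. -/
def IsTorusPeriodic {d : ℕ} {F : Type*} (L : ℝ) (f : EuclideanSpace ℝ (Fin d) → F) : Prop :=
  ∀ (i : Fin d) (x : EuclideanSpace ℝ (Fin d)), f (x + EuclideanSpace.single i L) = f x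

/-- The fundamental cell `[0, L)^d`. -/
def cell (d : ℕ) (L : ℝ) : Set (EuclideanSpace ℝ (Fin d)) :=
  {x | ∀ i, x i ∈ Ico 0 L}

/-- Lebesgue measure on the torus: integrals over the torus are integrals over one cell. -/
noncomputable def torusVolume (d : ℕ) (L : ℝ) : Measure (EuclideanSpace ℝ (Fin d)) :=
  volume.restrict (cell d L)

/-- The class `L¹(𝕋^d)`. -/
def MemTorusL1 {d : ℕ} (L : ℝ) (u : EuclideanSpace ℝ (Fin d) → ℝ) : Prop :=
  IsTorusPeriodic L u ∧ Integrable u (torusVolume d L)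

/-! ### Derivatives and Sobolev norms -/

/-- The classical partial derivative `∂φ/∂x_i`. -/
noncomputable def partialDeriv {d : ℕ} (i : Fin d) (φ : EuclideanSpace ℝ (Fin d) → ℝ) :
    EuclideanSpace ℝ (Fin d) → ℝ :=
  fun x => fderiv ℝ φ x (EuclideanSpace.single i 1)

/-- The classical derivative `D^α φ = ∏ i, (∂/∂x_i)^(α i) φ` for a multi-index `α`. -/
noncomputable def multiDeriv {d : ℕ} (α : Fin d → ℕ) (φ : EuclideanSpace ℝ (Fin d) → ℝ) :
    EuclideanSpace ℝ (Fin d) → ℝ :=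
  (List.finRange d).foldr (fun i g => (partialDeriv i)^[α i] g) φ

/-- `g` is the weak derivative `D^α u` on the torus: both are integrable functions on the torus and
`∫ u D^α φ = (-1)^|α| ∫ g φ` for all smooth test functions `φ` on the torus. -/
def IsWeakDeriv {d : ℕ} (L : ℝ) (α : Fin d → ℕ) (u g : EuclideanSpace ℝ (Fin d) → ℝ) : Prop :=
  MemTorusL1 L u ∧ MemTorusL1 L g ∧
    ∀ φ : EuclideanSpace ℝ (Fin d) → ℝ, ContDiff ℝ ∞ φ → IsTorusPeriodic L φ →
      ∫ x, u x * multiDeriv α φ x ∂(torusVolume d L) =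
        (-1) ^ (∑ i, α i) * ∫ x, g x * φ x ∂(torusVolume d L)

/-- `‖D^α u‖_p`, where `D^α u` is the weak derivative. The weak derivative is unique up to null
sets, so the infimum runs over a single value; it is `∞` if there is no weak derivative. -/
noncomputable def weakDerivNorm {d : ℕ} (L : ℝ) (α : Fin d → ℕ) (p : ℝ≥0∞)
    (u : EuclideanSpace ℝ (Fin d) → ℝ) : ℝ≥0∞ :=
  ⨅ (g : EuclideanSpace ℝ (Fin d) → ℝ) (_ : IsWeakDeriv L α u g), eLpNorm g p (torusVolume d L)

/-- The multi-indices `α` with `|α| ≤ k`. -/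
def multiIndices (d k : ℕ) : Finset (Fin d → ℕ) :=
  (Fintype.piFinset fun _ => Finset.range (k + 1)).filter fun α => ∑ i, α i ≤ k

theorem mem_multiIndices {d k : ℕ} {α : Fin d → ℕ} : α ∈ multiIndices d k ↔ ∑ i, α i ≤ k := by
  simp only [multiIndices, Finset.mem_filter, Fintype.mem_piFinset, Finset.mem_range,
    and_iff_right_iff_imp]
  intro h i
  have := Finset.single_le_sum (f := α) (fun j _ => Nat.zero_le _) (Finset.mem_univ i)
  omega

/-- The `W^{k,p}` norm: `(∑_{|α| ≤ k} ‖D^α u‖_p^p)^{1/p}` for `p < ∞`, and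
`max_{|α| ≤ k} ‖D^α u‖_∞` for `p = ∞`. It is `∞` exactly when `u ∉ W^{k,p}`. -/
noncomputable def sobolevNorm {d : ℕ} (L : ℝ) (k : ℕ) (p : ℝ≥0∞)
    (u : EuclideanSpace ℝ (Fin d) → ℝ) : ℝ≥0∞ :=
  if p = ⊤ then (multiIndices d k).sup fun α => weakDerivNorm L α ⊤ u
  else (∑ α ∈ multiIndices d k, weakDerivNorm L α p u ^ p.toReal) ^ (1 / p.toReal)

/-! ### The velocity field and its flow -/

/-- The divergence of a vector field. -/
noncomputable def divergence {d : ℕ}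
    (v : EuclideanSpace ℝ (Fin d) → EuclideanSpace ℝ (Fin d)) (x : EuclideanSpace ℝ (Fin d)) : ℝ :=
  ∑ i, partialDeriv i (fun y => v y i) x

open Classical in
/-- The flow of `v`: `t ↦ flow v t x` is the solution of `X' = v(X)`, `X(0) = x`. -/
noncomputable def flow {d : ℕ} (v : EuclideanSpace ℝ (Fin d) → EuclideanSpace ℝ (Fin d)) (t : ℝ)
    (x : EuclideanSpace ℝ (Fin d)) : EuclideanSpace ℝ (Fin d) :=
  if h : ∃ X : ℝ → EuclideanSpace ℝ (Fin d), X 0 = x ∧ ∀ s, HasDerivAt X (v (X s)) s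
  then h.choose t else x

/-! ### The three solution semigroups -/

/-- `S₁(t)`, the solution operator of the advection equation `∂_t w = -v · ∇w`: the solution is
constant along the trajectories of `v`. -/
noncomputable def advectionSemigroup {d : ℕ}
    (v : EuclideanSpace ℝ (Fin d) → EuclideanSpace ℝ (Fin d)) (t : ℝ)
    (w₀ : EuclideanSpace ℝ (Fin d) → ℝ) : EuclideanSpace ℝ (Fin d) → ℝ :=
  fun x => w₀ (flow v (-t) x)

/-- `S₂(t) = exp(ν t Δ)` for `t > 0`, the solution operator of the heat equation `∂_t w = ν Δ w`:
convolution of the periodic function `w₀` with the heat kernel of `ℝ^d`. -/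
noncomputable def heatSemigroup {d : ℕ} (ν t : ℝ)
    (w₀ : EuclideanSpace ℝ (Fin d) → ℝ) : EuclideanSpace ℝ (Fin d) → ℝ :=
  fun x => ∫ y, (4 * Real.pi * ν * t) ^ (-(d : ℝ) / 2) * Real.exp (-‖y‖ ^ 2 / (4 * ν * t)) *
    w₀ (x - y)

/-- `S₃(t)`, the solution operator of the reaction equation `∂_t w = -f(w) = w - w³`. -/
noncomputable def reactionSemigroup {d : ℕ} (t : ℝ)
    (w₀ : EuclideanSpace ℝ (Fin d) → ℝ) : EuclideanSpace ℝ (Fin d) → ℝ :=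
  fun x => w₀ x / Real.sqrt (w₀ x ^ 2 + (1 - w₀ x ^ 2) * Real.exp (-2 * t))

/-- The semigroups `S₁, S₂, S₃`, indexed by `0, 1, 2`. -/
noncomputable def semigroup {d : ℕ} (ν : ℝ)
    (v : EuclideanSpace ℝ (Fin d) → EuclideanSpace ℝ (Fin d)) (i : Fin 3) (t : ℝ) :
    (EuclideanSpace ℝ (Fin d) → ℝ) → EuclideanSpace ℝ (Fin d) → ℝ :=
  ![advectionSemigroup v t, heatSemigroup ν t, reactionSemigroup t] i

/-! ### The random splitting method -/

/-- The result of the first `j` stages of one step with the order `σ` of the three semigroups,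
starting from `u`: `stage 1 = S_{σ₁}(τ) u`, `stage 2 = S_{σ₂}(τ) S_{σ₁}(τ) u` and
`stage 3 = S_{σ₃}(τ) S_{σ₂}(τ) S_{σ₁}(τ) u`. -/
noncomputable def stage {d : ℕ} (ν : ℝ)
    (v : EuclideanSpace ℝ (Fin d) → EuclideanSpace ℝ (Fin d)) (τ : ℝ) (σ : Equiv.Perm (Fin 3))
    (u : EuclideanSpace ℝ (Fin d) → ℝ) (j : Fin 4) : EuclideanSpace ℝ (Fin d) → ℝ :=
  ![u,
    semigroup ν v (σ 0) τ u,
    semigroup ν v (σ 1) τ (semigroup ν v (σ 0) τ u),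
    semigroup ν v (σ 2) τ (semigroup ν v (σ 1) τ (semigroup ν v (σ 0) τ u))] j

/-- The numerical solution `u_n` of the random splitting method with time step `τ`, sequence of
permutations `ξ` and initial value `u₀`. -/
noncomputable def numericalSolution {d : ℕ} (ν : ℝ)
    (v : EuclideanSpace ℝ (Fin d) → EuclideanSpace ℝ (Fin d)) (τ : ℝ) (ξ : ℕ → Equiv.Perm (Fin 3))
    (u₀ : EuclideanSpace ℝ (Fin d) → ℝ) : ℕ → EuclideanSpace ℝ (Fin d) → ℝ
  | 0 => u₀
  | n + 1 => stage ν v τ (ξ n) (numericalSolution ν v τ ξ u₀ n) 3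

/-! ### The semigroups solve the three subproblems -/

/-- The reaction semigroup solves `∂_t w = -(w³ - w)`, `w(0) = w₀`. -/
theorem reactionSemigroup_solves {d : ℕ} (w₀ : EuclideanSpace ℝ (Fin d) → ℝ)
    (x : EuclideanSpace ℝ (Fin d)) :
    reactionSemigroup 0 w₀ x = w₀ x ∧
    ∀ t, 0 ≤ t → HasDerivAt (fun s => reactionSemigroup s w₀ x)
      (-(reactionSemigroup t w₀ x ^ 3 - reactionSemigroup t w₀ x)) t := by
  refine ⟨by simp [reactionSemigroup], fun t ht => ?_⟩
  simp only [reactionSemigroup]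
  generalize w₀ x = a
  have hE : Real.exp (-2 * t) ≤ 1 := Real.exp_le_one_iff.2 (by linarith)
  have hE0 := Real.exp_pos (-2 * t)
  have hD : 0 < a ^ 2 + (1 - a ^ 2) * Real.exp (-2 * t) := by nlinarith [sq_nonneg a]
  have h1 : HasDerivAt (fun s => a ^ 2 + (1 - a ^ 2) * Real.exp (-2 * s))
      ((1 - a ^ 2) * (Real.exp (-2 * t) * (-2))) t := by
    have : HasDerivAt (fun s : ℝ => -2 * s) (-2) t := by simpa using (hasDerivAt_id t).const_mul (-2)
    exact (this.exp.const_mul _).const_add _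
  have h2 := (hasDerivAt_const t a).div (h1.sqrt hD.ne') (Real.sqrt_pos.2 hD).ne'
  refine h2.congr_deriv ?_
  have hs := Real.sq_sqrt hD.le
  have hp := Real.sqrt_pos.2 hD
  set r := Real.sqrt (a ^ 2 + (1 - a ^ 2) * Real.exp (-2 * t))
  field_simp
  rw [hs]
  ring_nf

/-- Every value of a periodic function is attained on the closed cell. -/
theorem IsTorusPeriodic.exists_mem_cell {d : ℕ} {F : Type*} {L : ℝ} (hL : 0 < L)
    {f : EuclideanSpace ℝ (Fin d) → F} (hf : IsTorusPeriodic L f)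
    (x : EuclideanSpace ℝ (Fin d)) : ∃ y, f y = f x ∧ ∀ i, y i ∈ Icc 0 L := by
  have key : ∀ S : Finset (Fin d), ∃ y, f y = f x ∧ ∀ i ∈ S, y i ∈ Icc 0 L := by
    intro S
    induction S using Finset.induction_on with
    | empty => exact ⟨x, rfl, by simp⟩
    | insert i S hi ih =>
      obtain ⟨y, hy, hyS⟩ := ih
      have hp : Function.Periodic (fun s : ℝ => f (y + EuclideanSpace.single i s)) L := by
        intro s
        have h := hf i (y + EuclideanSpace.single i s)
        rw [add_assoc] at h
        simp only
        rw [← h]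
        congr 2
        ext j
        by_cases hj : j = i <;> simp [hj]
      have h1 := hp.int_mul (-⌊y i / L⌋) 0
      refine ⟨y + EuclideanSpace.single i (((-⌊y i / L⌋ : ℤ) : ℝ) * L), ?_, ?_⟩
      · rw [← hy]
        have h0 : EuclideanSpace.single i (0 : ℝ) = 0 := by ext j; simp
        simpa [h0] using h1
      · intro j hj
        by_cases hji : j = i
        · subst hji
          have h2 := Int.floor_le (y j / L)
          have h3 := Int.lt_floor_add_one (y j / L)
          rw [le_div_iff₀ hL] at h2
          rw [div_lt_iff₀ hL] at h3
          simp only [PiLp.add_apply, PiLp.single_apply, mem_Icc]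
          simp
          constructor <;> nlinarith
        · have := hyS j ((Finset.mem_insert.1 hj).resolve_left hji)
          simpa [hji] using this
  obtain ⟨y, hy, hyS⟩ := key Finset.univ
  exact ⟨y, hy, fun i => hyS i (Finset.mem_univ i)⟩

/-- A continuous periodic function is bounded. -/
theorem IsTorusPeriodic.exists_bound {d : ℕ} {F : Type*} [NormedAddCommGroup F] {L : ℝ}
    (hL : 0 < L) {f : EuclideanSpace ℝ (Fin d) → F} (hf : IsTorusPeriodic L f)
    (hc : Continuous f) : ∃ C : ℝ≥0, ∀ x, ‖f x‖ ≤ C := by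
  have hcpt : IsCompact {y : EuclideanSpace ℝ (Fin d) | ∀ i, y i ∈ Icc 0 L} := by
    have h := (isCompact_univ_pi (fun _ : Fin d => isCompact_Icc (a := (0 : ℝ)) (b := L))).image
      (PiLp.continuous_toLp 2 (fun _ : Fin d => ℝ))
    convert h using 1
    ext y
    constructor
    · intro hy
      exact ⟨fun i => y i, fun i _ => hy i, rfl⟩
    · rintro ⟨z, hz, rfl⟩ i
      exact hz i (mem_univ i)
  obtain ⟨C, hC⟩ := hcpt.exists_bound_of_continuousOn hc.continuousOn
  refine ⟨C.toNNReal, fun x => ?_⟩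
  obtain ⟨y, hy, hyc⟩ := hf.exists_mem_cell hL x
  rw [← hy]
  exact (hC y hyc).trans (Real.le_coe_toNNReal C)

/-- A smooth periodic velocity field is bounded and Lipschitz. -/
theorem exists_bound_lipschitz {d : ℕ} {L : ℝ} (hL : 0 < L)
    {v : EuclideanSpace ℝ (Fin d) → EuclideanSpace ℝ (Fin d)}
    (hv : ContDiff ℝ ∞ v) (hper : IsTorusPeriodic L v) :
    (∃ C : ℝ≥0, ∀ x, ‖v x‖ ≤ C) ∧ ∃ K : ℝ≥0, LipschitzWith K v := by
  refine ⟨hper.exists_bound hL hv.continuous, ?_⟩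
  have hper' : IsTorusPeriodic L (fderiv ℝ v) := by
    intro i x
    rw [← fderiv_comp_add_right]
    congr 1
    ext1 y
    exact hper i y
  obtain ⟨K, hK⟩ := hper'.exists_bound hL (hv.continuous_fderiv (by simp))
  exact ⟨K, lipschitzWith_of_nnnorm_fderiv_le (hv.differentiable (by simp)) hK⟩

/-- The flow of a smooth periodic velocity field exists for all times. -/
theorem flow_spec {d : ℕ} {L : ℝ} (hL : 0 < L)
    {v : EuclideanSpace ℝ (Fin d) → EuclideanSpace ℝ (Fin d)}
    (hv : ContDiff ℝ ∞ v) (hper : IsTorusPeriodic L v) (x : EuclideanSpace ℝ (Fin d)) :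
    flow v 0 x = x ∧ ∀ t, HasDerivAt (fun s => flow v s x) (v (flow v t x)) t := by
  obtain ⟨⟨C, hC⟩, K, hK⟩ := exists_bound_lipschitz hL hv hper
  have key : ∃ X : ℝ → EuclideanSpace ℝ (Fin d), X 0 = x ∧ ∀ s, HasDerivAt X (v (X s)) s := by
    have hloc : ∀ n : ℕ, ∃ X : ℝ → EuclideanSpace ℝ (Fin d), X 0 = x ∧
        ∀ s ∈ Icc (-(n : ℝ)) n, HasDerivWithinAt X (v (X s)) (Icc (-(n : ℝ)) n) s := by
      intro n
      have h0 : (0 : ℝ) ∈ Icc (-(n : ℝ)) n := by simp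
      have hpl : IsPicardLindelof (fun _ => v) (⟨0, h0⟩ : Icc (-(n : ℝ)) n) x (C * n) 0 C K :=
        IsPicardLindelof.of_time_independent (fun y _ => hC y) hK.lipschitzOnWith (by simp)
      exact hpl.exists_eq_forall_mem_Icc_hasDerivWithinAt₀
    choose X hX0 hX using hloc
    have hX' : ∀ n : ℕ, ∀ s ∈ Ioo (-(n : ℝ)) n, HasDerivAt (X n) (v (X n s)) s := fun n s hs =>
      (hX n s (Ioo_subset_Icc_self hs)).hasDerivAt (Icc_mem_nhds hs.1 hs.2)
    have huniq : ∀ m n : ℕ, m ≤ n → ∀ s ∈ Ioo (-(m : ℝ)) m, X m s = X n s := by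
      intro m n hmn s hs
      have hm : (m : ℝ) ≤ n := by exact_mod_cast hmn
      have h0 : (0 : ℝ) ∈ Ioo (-(m : ℝ)) m := ⟨by linarith [hs.1, hs.2], by linarith [hs.1, hs.2]⟩
      exact ODE_solution_unique_of_mem_Ioo (v := fun _ => v) (s := fun _ => univ) (K := K)
        (fun _ _ => hK.lipschitzOnWith) h0
        (fun t ht => ⟨hX' m t ht, mem_univ _⟩)
        (fun t ht => ⟨hX' n t ⟨by linarith [ht.1], by linarith [ht.2]⟩, mem_univ _⟩)
        ((hX0 m).trans (hX0 n).symm) hs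
    refine ⟨fun s => X (⌈|s|⌉₊ + 1) s, hX0 _, fun s => ?_⟩
    set N := ⌈|s|⌉₊ + 2 with hN
    have hsN : |s| < (⌈|s|⌉₊ : ℝ) + 1 := by linarith [Nat.le_ceil |s|]
    refine (show HasDerivAt (X N) (v (X (⌈|s|⌉₊ + 1) s)) s from ?_).congr_of_eventuallyEq ?_
    · rw [huniq (⌈|s|⌉₊ + 1) N (by omega) s (by push_cast; exact abs_lt.1 hsN)]
      exact hX' N s (by rw [hN]; push_cast; exact abs_lt.1 (by linarith))
    · have : ∀ᶠ y in nhds s, |y| < (⌈|s|⌉₊ : ℝ) + 1 :=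
        continuous_abs.continuousAt.eventually (gt_mem_nhds hsN)
      filter_upwards [this] with y hy
      refine huniq _ _ ?_ y ?_
      · have : ⌈|y|⌉₊ ≤ ⌈|s|⌉₊ + 1 := Nat.ceil_le.2 (by push_cast; exact hy.le)
        omega
      · push_cast
        exact abs_lt.1 (by linarith [Nat.le_ceil |y|])
  have hflow : ∀ t, flow v t x = key.choose t := fun t => by simp only [flow, dif_pos key]
  refine ⟨(hflow 0).trans key.choose_spec.1, fun t => ?_⟩
  simp only [hflow]
  exact key.choose_spec.2 t

/-- The advection semigroup solves `∂_t w = -v · ∇w`, `w(0) = w₀`, wherever `w` is differentiable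
in space. -/
theorem advectionSemigroup_solves {d : ℕ} {L : ℝ} (hL : 0 < L)
    {v : EuclideanSpace ℝ (Fin d) → EuclideanSpace ℝ (Fin d)}
    (hv : ContDiff ℝ ∞ v) (hper : IsTorusPeriodic L v) (w₀ : EuclideanSpace ℝ (Fin d) → ℝ) :
    advectionSemigroup v 0 w₀ = w₀ ∧
    ∀ t x, DifferentiableAt ℝ (advectionSemigroup v t w₀) x →
      HasDerivAt (fun s => advectionSemigroup v s w₀ x)
        (-∑ i, v x i * partialDeriv i (advectionSemigroup v t w₀) x) t := by
  have hspec := flow_spec hL hv hper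
  obtain ⟨-, K, hK⟩ := exists_bound_lipschitz hL hv hper
  refine ⟨by ext x; simp [advectionSemigroup, (hspec x).1], fun t x hdiff => ?_⟩
  have hgroup : ∀ s, flow v (-s) x = flow v (-t) (flow v (t - s) x) := by
    intro s
    have : (fun r => flow v (r + (t - s)) x) = fun r => flow v r (flow v (t - s) x) := by
      refine ODE_solution_unique_univ (v := fun _ => v) (s := fun _ => univ) (K := K) (t₀ := 0)
        (fun _ => hK.lipschitzOnWith) (fun r => ⟨?_, mem_univ _⟩)
        (fun r => ⟨(hspec _).2 r, mem_univ _⟩) (by simp [(hspec _).1])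
      exact ((hspec x).2 (r + (t - s))).comp_add_const r (t - s)
    have h : flow v (-t + (t - s)) x = flow v (-t) (flow v (t - s) x) := congrFun this (-t)
    rw [← h]
    congr 1
    ring
  have heq : (fun s => advectionSemigroup v s w₀ x) =
      fun s => advectionSemigroup v t w₀ (flow v (t - s) x) := by
    ext s
    simp only [advectionSemigroup]
    rw [hgroup s]
  rw [heq]
  have h1 : HasDerivAt (fun s => flow v (t - s) x) (-v x) t := by
    have := ((hspec x).2 (t - t)).comp_const_sub t t
    simpa [(hspec x).1] using this
  have h0 : flow v (t - t) x = x := by rw [sub_self, (hspec x).1]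
  have h2 : HasFDerivAt (advectionSemigroup v t w₀)
      (fderiv ℝ (advectionSemigroup v t w₀) x) (flow v (t - t) x) := by
    rw [h0]; exact hdiff.hasFDerivAt
  refine (h2.comp_hasDerivAt t h1).congr_deriv ?_
  rw [map_neg]
  congr 1
  conv_lhs => rw [show v x = ∑ i, v x i • EuclideanSpace.single i (1 : ℝ) by
    ext j; simp [Finset.sum_apply, Pi.single_apply]]
  simp [map_sum, partialDeriv]

/-- The heat semigroup multiplies the Fourier mode of frequency `m` by `exp(-ν t |m|²)`, that is,
it is `exp(ν t Δ)`. -/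
theorem heatSemigroup_fourierMode {d : ℕ} {ν t : ℝ} (hν : 0 < ν) (ht : 0 < t)
    (m x : EuclideanSpace ℝ (Fin d)) (θ : ℝ) :
    heatSemigroup ν t (fun y => Real.cos (inner ℝ m y + θ)) x =
      Real.exp (-ν * t * ‖m‖ ^ 2) * Real.cos (inner ℝ m x + θ) := by
  have hA : 0 < 4 * Real.pi * ν * t := by positivity
  have hb : 0 < ((1 / (4 * ν * t) : ℝ) : ℂ).re := by rw [Complex.ofReal_re]; positivity
  have h := GaussianFourier.integral_cexp_neg_mul_sq_norm_add_of_euclideanSpace hb (-Complex.I) m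
  have hR : ((Real.pi : ℂ) / ((1 / (4 * ν * t) : ℝ) : ℂ)) ^ ((Fintype.card (Fin d) : ℂ) / 2) *
      Complex.exp ((-Complex.I) ^ 2 * (‖m‖ : ℂ) ^ 2 / (4 * ((1 / (4 * ν * t) : ℝ) : ℂ))) =
      (((4 * Real.pi * ν * t) ^ ((d : ℝ) / 2) * Real.exp (-ν * t * ‖m‖ ^ 2) : ℝ) : ℂ) := by
    rw [Complex.ofReal_mul, Complex.ofReal_cpow hA.le, Complex.ofReal_exp, Fintype.card_fin]
    congr 2
    · push_cast
      field_simp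
    · push_cast
      ring
    · have : (ν : ℂ) ≠ 0 := by exact_mod_cast hν.ne'
      have : (t : ℂ) ≠ 0 := by exact_mod_cast ht.ne'
      push_cast
      rw [neg_sq, Complex.I_sq]
      field_simp
  rw [hR] at h
  set R : ℝ := (4 * Real.pi * ν * t) ^ ((d : ℝ) / 2) * Real.exp (-ν * t * ‖m‖ ^ 2) with hRdef
  have hRpos : 0 < R := by positivity
  have hint : Integrable (fun y : EuclideanSpace ℝ (Fin d) =>
      Complex.exp (-((1 / (4 * ν * t) : ℝ) : ℂ) * (‖y‖ : ℂ) ^ 2 +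
        -Complex.I * ((inner ℝ m y : ℝ) : ℂ))) := by
    by_contra hn
    rw [integral_undef hn] at h
    exact hRpos.ne (by exact_mod_cast h)
  have h2 := congrArg (fun z : ℂ =>
    (Complex.exp (((inner ℝ m x + θ : ℝ) : ℂ) * Complex.I) * z).re) h
  beta_reduce at h2
  rw [← integral_const_mul, ← Complex.reCLM_apply,
    ← Complex.reCLM.integral_comp_comm (hint.const_mul _)] at h2
  have hpt : ∀ y : EuclideanSpace ℝ (Fin d),
      Complex.reCLM (Complex.exp (((inner ℝ m x + θ : ℝ) : ℂ) * Complex.I) *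
        Complex.exp (-((1 / (4 * ν * t) : ℝ) : ℂ) * (‖y‖ : ℂ) ^ 2 +
        -Complex.I * ((inner ℝ m y : ℝ) : ℂ))) =
      Real.exp (-‖y‖ ^ 2 / (4 * ν * t)) * Real.cos (inner ℝ m (x - y) + θ) := by
    intro y
    rw [← Complex.exp_add, Complex.reCLM_apply,
      show ((inner ℝ m x + θ : ℝ) : ℂ) * Complex.I + (-((1 / (4 * ν * t) : ℝ) : ℂ) *
        (‖y‖ : ℂ) ^ 2 + -Complex.I * ((inner ℝ m y : ℝ) : ℂ)) =
        ((-‖y‖ ^ 2 / (4 * ν * t) : ℝ) : ℂ) +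
          ((inner ℝ m (x - y) + θ : ℝ) : ℂ) * Complex.I by
        rw [inner_sub_right]; push_cast; ring]
    generalize -‖y‖ ^ 2 / (4 * ν * t) = r
    rw [Complex.exp_re]
    simp
  simp only [hpt] at h2
  have h3 : Complex.re (Complex.exp (((inner ℝ m x + θ : ℝ) : ℂ) * Complex.I) * (R : ℂ)) =
      Real.cos (inner ℝ m x + θ) * R := by
    rw [Complex.re_mul_ofReal, Complex.exp_ofReal_mul_I_re]
  rw [h3] at h2
  have h4 : heatSemigroup ν t (fun y => Real.cos (inner ℝ m y + θ)) x =
      ∫ y, (4 * Real.pi * ν * t) ^ (-(d : ℝ) / 2) *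
        (Real.exp (-‖y‖ ^ 2 / (4 * ν * t)) * Real.cos (inner ℝ m (x - y) + θ)) :=
    integral_congr_ae (ae_of_all _ fun y => mul_assoc _ _ _)
  rw [h4, integral_const_mul, h2, hRdef, neg_div, Real.rpow_neg hA.le]
  have : (4 * Real.pi * ν * t) ^ ((d : ℝ) / 2) ≠ 0 := by positivity
  field_simp

end RandomSplitting

namespace RandomSplitting

/-! ### The torus as a quotient: lattice, fundamental cell, change of variables -/

/-! On smooth data, a time increment h of each subproblem multiplies the norm of the derivatives of
order at most j by at most exp (c_j h), with the same c_j in every `L^q`. The heat semigroup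
averages translates, so it is a contraction. The transport step x ↦ x - h v(x) differs from the
identity by O(h), both in its effect on derivatives and in its effect on volumes. The reaction step
z + h (z - z³) grows at rate at most 1 in order zero. In order j + 1, the Leibniz rule for w³ leaves
at most one factor of order j + 1 in each term, so the estimate is linear in the top order, with a
coefficient controlled by the `L^∞` norms of the orders up to j. The rates are therefore chosen
recursively (`growthRate`), and this is where the bound in W^{k-1,∞} enters.

The exact flows are never differentiated. For smooth w, the advection and reaction semigroups are
uniform limits of m explicit Euler steps of size τ / m, and m factors exp (c τ / m) multiply to exp
(c τ). The class `Approximable` is the `L¹` closure of the smooth functions that obey the bounds at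
time t. Each semigroup is Lipschitz in `L¹`, so it suffices to treat smooth members of the class,
and the class at time t is sent into the class at time t + τ (`Approximable.map`). Neither m nor the
`L¹` Lipschitz constant enters the bounds. One splitting step advances the time of the class by 3τ
in any order of the stages, so everything happens on [0, 3T], uniformly in n, τ and the permutations
(`exists_rates_approximable`).

Initial data enter the class by mollification (`exists_mollifier`). Sobolev bounds come back out by
lower semicontinuity under `L¹` convergence (`weakDerivNorm_le_of_approx`), a weak-limit argument in
the Hilbert space `L²`; it needs p ≥ 2 and covers p = ∞ as well. The result is a factor independent
of p times the initial W^{k,p} norm, so part 2 reduces to a bound on that norm that is uniform in p.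
-/

/-- The Euclidean space `ℝ^d`. -/
abbrev Pt (d : ℕ) := EuclideanSpace ℝ (Fin d)

/-- The basis `L e_i` of the period lattice. -/
noncomputable def torusBasis (d : ℕ) {L : ℝ} (hL : 0 < L) : Module.Basis (Fin d) ℝ (Pt d) :=
  (EuclideanSpace.basisFun (Fin d) ℝ).toBasis.isUnitSMul (fun _ => (isUnit_iff_ne_zero.2 hL.ne'))

/-- The period lattice `L ℤ^d`. -/
noncomputable def torusLattice (d : ℕ) {L : ℝ} (hL : 0 < L) : AddSubgroup (Pt d) :=
  (Submodule.span ℤ (range (torusBasis d hL))).toAddSubgroup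

theorem torusBasis_apply {d : ℕ} {L : ℝ} (hL : 0 < L) (i : Fin d) :
    torusBasis d hL i = EuclideanSpace.single i L := by
  ext j
  simp [torusBasis, Module.Basis.isUnitSMul_apply]

/-- Opens the theory of lattice fundamental domains: measurability, finite volume, and equality of
integrals of periodic functions over different domains. -/
theorem cell_eq_fundamentalDomain {d : ℕ} {L : ℝ} (hL : 0 < L) :
    cell d L = ZSpan.fundamentalDomain (torusBasis d hL) := by
  ext x
  have h : ∀ i, (torusBasis d hL).repr x i = L⁻¹ * x i := by
    intro i
    simp [torusBasis, Module.Basis.repr_isUnitSMul, Units.smul_def]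
  simp only [cell, mem_ofPred_eq, ZSpan.mem_fundamentalDomain, h, mem_Ico]
  refine forall_congr' fun i => and_congr ?_ ?_
  · rw [mul_nonneg_iff_of_pos_left (by positivity)]
  · rw [inv_mul_lt_iff₀ hL, mul_one]

instance {d : ℕ} {L : ℝ} (hL : 0 < L) : Countable (torusLattice d hL) :=
  inferInstanceAs (Countable (Submodule.span ℤ (range (torusBasis d hL))))

theorem isAddFundamentalDomain_cell {d : ℕ} {L : ℝ} (hL : 0 < L) :
    IsAddFundamentalDomain (torusLattice d hL) (cell d L) (volume : Measure (Pt d)) := by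
  rw [cell_eq_fundamentalDomain hL]
  exact ZSpan.isAddFundamentalDomain' _ _

theorem measurableSet_cell {d : ℕ} {L : ℝ} (hL : 0 < L) : MeasurableSet (cell d L) := by
  rw [cell_eq_fundamentalDomain hL]
  exact ZSpan.fundamentalDomain_measurableSet _

theorem isFiniteMeasure_torusVolume {d : ℕ} {L : ℝ} (hL : 0 < L) :
    IsFiniteMeasure (torusVolume d L) := by
  refine ⟨?_⟩
  rw [torusVolume, Measure.restrict_apply_univ, cell_eq_fundamentalDomain hL]
  exact (ZSpan.fundamentalDomain_isBounded _).measure_lt_top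

theorem torusVolume_absolutelyContinuous (d : ℕ) (L : ℝ) :
    torusVolume d L ≪ (volume : Measure (Pt d)) :=
  Measure.restrict_le_self.absolutelyContinuous

/-- A property of lattice vectors that holds for the generators and is closed under the group
operations holds for all of them. -/
theorem torusLattice_induction {d : ℕ} {L : ℝ} (hL : 0 < L) {p : Pt d → Prop}
    (hgen : ∀ i, p (EuclideanSpace.single i L)) (h0 : p 0) (hadd : ∀ x y, p x → p y → p (x + y))
    (hneg : ∀ x, p x → p (-x)) (g : torusLattice d hL) : p g := by
  obtain ⟨g, hg⟩ := g
  change p g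
  change g ∈ Submodule.span ℤ (range (torusBasis d hL)) at hg
  rw [← Submodule.mem_toAddSubgroup, Submodule.span_int_eq_addSubgroupClosure] at hg
  induction hg using AddSubgroup.closure_induction with
  | mem x hx =>
    obtain ⟨i, rfl⟩ := hx
    rw [torusBasis_apply]
    exact hgen i
  | zero => exact h0
  | add x y _ _ hx hy => exact hadd x y hx hy
  | neg x _ hx => exact hneg x hx

/-- `Y` commutes with the translations by lattice vectors, that is, it is the lift of a map of the
torus homotopic to the identity. -/
def IsTorusMap {d : ℕ} (L : ℝ) (Y : Pt d → Pt d) : Prop :=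
  ∀ (i : Fin d) (x : Pt d), Y (x + EuclideanSpace.single i L) = Y x + EuclideanSpace.single i L

theorem IsTorusPeriodic.vadd {d : ℕ} {L : ℝ} {F : Type*} {f : Pt d → F}
    (hf : IsTorusPeriodic L f) (hL : 0 < L) (g : torusLattice d hL) (x : Pt d) :
    f (g +ᵥ x) = f x := by
  suffices h : ∀ x, f (g + x) = f x from h x
  refine torusLattice_induction hL (p := fun g => ∀ x, f (g + x) = f x) ?_ ?_ ?_ ?_ g
  · intro i x; rw [add_comm]; exact hf i x
  · simp
  · intro a b ha hb x; rw [add_assoc, ha, hb]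
  · intro a ha x
    have := ha (-a + x)
    rwa [add_neg_cancel_left, eq_comm] at this

/-- Equivariance is what makes the preimage of the cell under `Y` another fundamental domain. -/
theorem IsTorusMap.vadd {d : ℕ} {L : ℝ} {Y : Pt d → Pt d}
    (hY : IsTorusMap L Y) (hL : 0 < L) (g : torusLattice d hL) (x : Pt d) :
    Y (g +ᵥ x) = g +ᵥ Y x := by
  suffices h : ∀ x, Y (g + x) = g + Y x from h x
  refine torusLattice_induction hL (p := fun g => ∀ x, Y (g + x) = g + Y x) ?_ ?_ ?_ ?_ g
  · intro i x; rw [add_comm, hY i x, add_comm]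
  · simp
  · intro a b ha hb x; rw [add_assoc, ha, hb, add_assoc]
  · intro a ha x
    have := ha (-a + x)
    rw [add_neg_cancel_left] at this
    rw [this, neg_add_cancel_left]

theorem IsTorusPeriodic.comp_torusMap {d : ℕ} {L : ℝ} {F : Type*} {f : Pt d → F} {Y : Pt d → Pt d}
    (hf : IsTorusPeriodic L f) (hY : IsTorusMap L Y) : IsTorusPeriodic L (fun x => f (Y x)) :=
  fun i x => by simp only [hY i x, hf i]

theorem IsTorusPeriodic.comp {d : ℕ} {L : ℝ} {F G : Type*} {f : Pt d → F}
    (hf : IsTorusPeriodic L f) (φ : F → G) : IsTorusPeriodic L (fun x => φ (f x)) :=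
  fun i x => by simp only [hf i x]

theorem IsTorusPeriodic.comp₂ {d : ℕ} {L : ℝ} {F G H : Type*} {f : Pt d → F} {g : Pt d → G}
    (hf : IsTorusPeriodic L f) (hg : IsTorusPeriodic L g) (φ : F → G → H) :
    IsTorusPeriodic L (fun x => φ (f x) (g x)) :=
  fun i x => by simp only [hf i x, hg i x]

theorem isTorusMap_add_const {d : ℕ} (L : ℝ) (y : Pt d) : IsTorusMap L (fun x => x + y) :=
  fun i x => by simp only; abel

theorem isTorusMap_sub_const {d : ℕ} (L : ℝ) (y : Pt d) : IsTorusMap L (fun x => x - y) :=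
  fun i x => by simp only; abel

/-- Change of variables on the torus for a map that increases volumes of preimages at most by the
factor `c`. -/
theorem lintegral_torus_comp_le {d : ℕ} {L : ℝ} (hL : 0 < L) {Y : Pt d → Pt d} {c : ℝ≥0∞}
    (hYm : Measurable Y) (hY : IsTorusMap L Y) (hc : (volume : Measure (Pt d)).map Y ≤ c • volume)
    {g : Pt d → ℝ≥0∞} (hg : IsTorusPeriodic L g) (hgm : AEMeasurable g volume) :
    ∫⁻ x, g (Y x) ∂torusVolume d L ≤ c * ∫⁻ x, g x ∂torusVolume d L := by
  have hac : (volume : Measure (Pt d)).map Y ≪ volume :=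
    hc.absolutelyContinuous.trans Measure.smul_absolutelyContinuous
  have hq : Measure.QuasiMeasurePreserving Y (volume : Measure (Pt d)) volume := ⟨hYm, hac⟩
  have hD := isAddFundamentalDomain_cell (d := d) hL
  -- The integrand is periodic, so the cell may be exchanged for its preimage under `Y`, where the
  -- substitution is a plain push-forward of Lebesgue measure.
  have hD' : IsAddFundamentalDomain (torusLattice d hL) (Y ⁻¹' cell d L)
      (volume : Measure (Pt d)) :=
    hD.preimage_of_equiv hq (e := id) Function.bijective_id fun g x => hY.vadd hL g x
  calc ∫⁻ x, g (Y x) ∂torusVolume d L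
      = ∫⁻ x in Y ⁻¹' cell d L, g (Y x) :=
        hD.setLIntegral_eq hD' _ fun γ x => (hg.comp_torusMap hY).vadd hL γ x
    _ = ∫⁻ x, g x ∂((volume.restrict (Y ⁻¹' cell d L)).map Y) := by
        rw [lintegral_map' _ hYm.aemeasurable]
        rw [← Measure.restrict_map hYm (measurableSet_cell hL)]
        exact (hgm.mono_ac hac).restrict
    _ ≤ ∫⁻ x, g x ∂(c • torusVolume d L) := by
        rw [← Measure.restrict_map hYm (measurableSet_cell hL), torusVolume,
          ← Measure.restrict_smul]
        exact lintegral_mono' (Measure.restrict_mono le_rfl hc) le_rfl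
    _ = _ := lintegral_smul_measure _ _

theorem map_sub_const_volume {d : ℕ} (y : Pt d) :
    (volume : Measure (Pt d)).map (fun x => x - y) ≤ (1 : ℝ≥0∞) • volume := by
  rw [one_smul, (measurePreserving_sub_right volume y).map_eq]

theorem lintegral_torus_sub {d : ℕ} {L : ℝ} (hL : 0 < L) (y : Pt d)
    {g : Pt d → ℝ≥0∞} (hg : IsTorusPeriodic L g) (hgm : AEMeasurable g volume) :
    ∫⁻ x, g (x - y) ∂torusVolume d L ≤ ∫⁻ x, g x ∂torusVolume d L := by
  simpa using lintegral_torus_comp_le hL (by fun_prop) (isTorusMap_sub_const L y)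
    (map_sub_const_volume y) hg hgm

theorem integral_torus_add {d : ℕ} {L : ℝ} (hL : 0 < L) (y : Pt d) {g : Pt d → ℝ}
    (hg : IsTorusPeriodic L g) :
    ∫ x, g (x + y) ∂torusVolume d L = ∫ x, g x ∂torusVolume d L := by
  have hq := measurePreserving_add_right (volume : Measure (Pt d)) y
  have hD := isAddFundamentalDomain_cell (d := d) hL
  have hD' : IsAddFundamentalDomain (torusLattice d hL) ((fun x => x + y) ⁻¹' cell d L)
      (volume : Measure (Pt d)) :=
    hD.preimage_of_equiv hq.quasiMeasurePreserving (e := id) Function.bijective_id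
      fun g x => (isTorusMap_add_const L y).vadd hL g x
  have h1 := hD.setIntegral_eq hD' (f := fun x => g (x + y))
    (fun γ x => (hg.comp_torusMap (isTorusMap_add_const L y)).vadd hL γ x)
  rw [torusVolume, h1]
  exact hq.setIntegral_preimage_emb (measurableEmbedding_addRight y) _ _

/-- A periodic property that holds almost everywhere on the cell holds almost everywhere. -/
theorem ae_volume_of_ae_torus {d : ℕ} {L : ℝ} (hL : 0 < L) {p : Pt d → Prop}
    (hp : IsTorusPeriodic L p) (h : ∀ᵐ x ∂torusVolume d L, p x) :
    ∀ᵐ x ∂(volume : Measure (Pt d)), p x := by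
  refine (isAddFundamentalDomain_cell (d := d) hL).measure_zero_of_invariant {x | ¬ p x} ?_ ?_
  · intro g
    ext x
    rw [mem_vadd_set_iff_neg_vadd_mem]
    simp only [mem_ofPred_eq]
    rw [hp.vadd hL (-g) x]
  · rw [← Measure.restrict_apply' (measurableSet_cell hL)]
    exact h

-- Lebesgue measure is the sum of its restrictions to the lattice translates of the cell, and each
-- of these is carried to the torus measure by a translation. Compositions such as f(x - y) leave
-- the cell, hence the need for measurability on the whole space.
open scoped Pointwise in
theorem IsTorusPeriodic.aestronglyMeasurable {d : ℕ} {L : ℝ} (hL : 0 < L) {F : Type*}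
    [TopologicalSpace F] [TopologicalSpace.PseudoMetrizableSpace F] {f : Pt d → F}
    (hf : IsTorusPeriodic L f) (h : AEStronglyMeasurable f (torusVolume d L)) :
    AEStronglyMeasurable f volume := by
  have hD := isAddFundamentalDomain_cell (d := d) hL
  rw [← hD.sum_restrict, aestronglyMeasurable_sum_measure_iff]
  intro g
  have hmp : MeasurePreserving (fun x : Pt d => -g +ᵥ x)
      (volume.restrict (g +ᵥ (cell d L : Set (Pt d)))) (torusVolume d L) := by
    have := (measurePreserving_vadd (-g) (volume : Measure (Pt d))).restrict_preimage
      (measurableSet_cell (d := d) hL)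
    rwa [Set.preimage_vadd, neg_neg] at this
  have h2 := h.comp_measurePreserving hmp
  refine h2.congr (Filter.Eventually.of_forall fun x => ?_)
  exact hf.vadd hL (-g) x

/-- Elements of `Lp` over the cell have arbitrary values outside it, while weak derivatives have to
be periodic; reduction modulo the lattice supplies the representative. -/
theorem exists_periodic_congr {d : ℕ} {L : ℝ} (hL : 0 < L) {F : Type*} (f : Pt d → F) :
    ∃ g : Pt d → F, IsTorusPeriodic L g ∧ ∀ x ∈ cell d L, g x = f x := by
  refine ⟨fun x => f (ZSpan.fract (torusBasis d hL) x), fun i x => ?_, fun x hx => ?_⟩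
  · simp only
    rw [add_comm, ZSpan.fract_zSpan_add _ _ (v := EuclideanSpace.single i L)]
    exact Submodule.subset_span ⟨i, torusBasis_apply hL i⟩
  · rw [cell_eq_fundamentalDomain hL] at hx
    simp only
    rw [ZSpan.fract_eq_self.2 hx]

/-- The `L^p` norm of a composition on the torus. -/
theorem eLpNorm_torus_comp_le {d : ℕ} {L : ℝ} (hL : 0 < L) {Y : Pt d → Pt d} {c : ℝ≥0∞}
    (hc1 : 1 ≤ c) (hYm : Measurable Y) (hY : IsTorusMap L Y)
    (hc : (volume : Measure (Pt d)).map Y ≤ c • volume) {q : ℝ≥0∞} (hq : 1 ≤ q)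
    {F : Type*} [NormedAddCommGroup F] {f : Pt d → F}
    (hf : IsTorusPeriodic L f) (hfm : AEStronglyMeasurable f (torusVolume d L)) :
    eLpNorm (fun x => f (Y x)) q (torusVolume d L) ≤ c * eLpNorm f q (torusVolume d L) := by
  have hfv := hf.aestronglyMeasurable hL hfm
  rcases eq_or_ne q ⊤ with rfl | hqt
  · refine le_trans ?_ (le_mul_of_one_le_left' hc1)
    rw [eLpNorm_exponent_top, eLpNorm_exponent_top]
    refine essSup_le_of_ae_le _ ?_
    have h1 : ∀ᵐ x ∂torusVolume d L, ‖f x‖ₑ ≤ eLpNormEssSup f (torusVolume d L) :=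
      ae_le_eLpNormEssSup
    have h2 := ae_volume_of_ae_torus hL (p := fun x => ‖f x‖ₑ ≤ eLpNormEssSup f (torusVolume d L))
      (fun i x => by simp only [hf i x]) h1
    have hac : (volume : Measure (Pt d)).map Y ≪ volume :=
      hc.absolutelyContinuous.trans Measure.smul_absolutelyContinuous
    exact (torusVolume_absolutelyContinuous d L).ae_le
      (Measure.QuasiMeasurePreserving.ae ⟨hYm, hac⟩ h2)
  · have hq0 : q ≠ 0 := (zero_lt_one.trans_le hq).ne'
    have hqr : 1 ≤ q.toReal := by
      rw [← ENNReal.toReal_one]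
      exact ENNReal.toReal_mono hqt hq
    rw [eLpNorm_eq_lintegral_rpow_enorm_toReal hq0 hqt,
      eLpNorm_eq_lintegral_rpow_enorm_toReal hq0 hqt]
    have h := lintegral_torus_comp_le hL hYm hY hc (g := fun x => ‖f x‖ₑ ^ q.toReal)
      (hf.comp fun z => ‖z‖ₑ ^ q.toReal) (hfv.enorm.pow_const _)
    refine (ENNReal.rpow_le_rpow h (by positivity)).trans ?_
    rw [ENNReal.mul_rpow_of_nonneg _ _ (by positivity)]
    gcongr
    -- Giving up the root, which is harmless for c ≥ 1, makes the constant independent of q.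
    calc c ^ (1 / q.toReal) ≤ c ^ (1 : ℝ) :=
          ENNReal.rpow_le_rpow_of_exponent_le hc1 (by rw [div_le_one (by linarith)]; exact hqr)
      _ = c := ENNReal.rpow_one c

/-- An expansion bound from below controls the volume of preimages. -/
theorem map_volume_le_of_antilipschitz {d : ℕ} {K : ℝ≥0} {Y : Pt d → Pt d}
    (hY : AntilipschitzWith K Y) (hYm : Measurable Y) :
    (volume : Measure (Pt d)).map Y ≤ ((K : ℝ≥0∞) ^ d) • volume := by
  -- Lebesgue measure is a multiple of the d-dimensional Hausdorff measure, whose behaviour under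
  -- antilipschitz maps is immediate from coverings.
  have hh : (volume : Measure (Pt d)) =
      (volume : Measure (Pt d)).addHaarScalarFactor (Measure.hausdorffMeasure (d : ℝ)) •
        Measure.hausdorffMeasure (d : ℝ) := by
    have : Measure.IsAddHaarMeasure (Measure.hausdorffMeasure (d : ℝ) : Measure (Pt d)) := by
      simpa using MeasureTheory.isAddHaarMeasure_hausdorffMeasure (E := Pt d)
    exact Measure.isAddLeftInvariant_eq_smul _ _
  refine Measure.le_iff.2 fun s hs => ?_
  rw [Measure.map_apply hYm hs, Measure.smul_apply, hh, Measure.smul_apply, Measure.smul_apply,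
    smul_eq_mul, ENNReal.smul_def, ENNReal.smul_def, smul_eq_mul, smul_eq_mul,
    ← mul_left_comm]
  gcongr
  simpa using hY.hausdorffMeasure_preimage_le (d := (d : ℝ)) (by positivity) s

end RandomSplitting

namespace RandomSplitting

/-! ### Averages of translates -/

/-- The convolution of `f` with the measure `ρ`. -/
noncomputable def average {d : ℕ} {F : Type*} [NormedAddCommGroup F] [NormedSpace ℝ F]
    (ρ : Measure (Pt d)) (f : Pt d → F) : Pt d → F :=
  fun x => ∫ y, f (x - y) ∂ρ

section

variable {d : ℕ} {L : ℝ} {ρ : Measure (Pt d)} [IsProbabilityMeasure ρ]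

theorem IsTorusPeriodic.average {F : Type*} [NormedAddCommGroup F] [NormedSpace ℝ F]
    (ρ : Measure (Pt d)) {f : Pt d → F} (hf : IsTorusPeriodic L f) :
    IsTorusPeriodic L (average ρ f) := by
  intro i x
  refine integral_congr_ae (ae_of_all _ fun y => ?_)
  have : x + EuclideanSpace.single i L - y = x - y + EuclideanSpace.single i L := by abel
  simp only [this, hf i]

/-- For each fixed y the translation x ↦ x - y preserves Lebesgue null sets, so ρ may be singular.
Measurability and almost everywhere bounds thus pass from f to (x, y) ↦ f(x - y). -/
theorem quasiMeasurePreserving_torus_sub (ρ : Measure (Pt d)) [SFinite ρ] (L : ℝ) :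
    Measure.QuasiMeasurePreserving (fun p : Pt d × Pt d => p.1 - p.2)
      ((torusVolume d L).prod ρ) volume :=
  (quasiMeasurePreserving_sub_of_right_invariant volume ρ).mono_left
    ((torusVolume_absolutelyContinuous d L).prod Measure.AbsolutelyContinuous.rfl)

theorem IsTorusPeriodic.aestronglyMeasurable_sub (ρ : Measure (Pt d)) [SFinite ρ] (hL : 0 < L)
    {F : Type*} [NormedAddCommGroup F] {f : Pt d → F} (hf : IsTorusPeriodic L f)
    (hfm : AEStronglyMeasurable f (torusVolume d L)) :
    AEStronglyMeasurable (fun p : Pt d × Pt d => f (p.1 - p.2)) ((torusVolume d L).prod ρ) :=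
  (hf.aestronglyMeasurable hL hfm).comp_quasiMeasurePreserving
    (quasiMeasurePreserving_torus_sub ρ L)

theorem lintegral_lintegral_torus_sub_le (hL : 0 < L) {g : Pt d → ℝ≥0∞}
    (hg : IsTorusPeriodic L g) (hgm : AEMeasurable g volume) :
    ∫⁻ x, ∫⁻ y, g (x - y) ∂ρ ∂torusVolume d L ≤ ∫⁻ x, g x ∂torusVolume d L := by
  have := isFiniteMeasure_torusVolume (d := d) hL
  rw [lintegral_lintegral_swap (f := fun x y => g (x - y))
    (hgm.comp_quasiMeasurePreserving (quasiMeasurePreserving_torus_sub ρ L))]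
  calc ∫⁻ y, ∫⁻ x, g (x - y) ∂torusVolume d L ∂ρ
      ≤ ∫⁻ _, ∫⁻ x, g x ∂torusVolume d L ∂ρ :=
        lintegral_mono fun y => lintegral_torus_sub hL y hg hgm
    _ = _ := by simp

/-- Averages of translates do not increase the `L^q` norm. -/
theorem eLpNorm_average_le (hL : 0 < L) {F : Type*} [NormedAddCommGroup F] [NormedSpace ℝ F]
    {f : Pt d → F} (hf : IsTorusPeriodic L f) (hfm : AEStronglyMeasurable f (torusVolume d L))
    {q : ℝ≥0∞} (hq : 1 ≤ q) :
    eLpNorm (average ρ f) q (torusVolume d L) ≤ eLpNorm f q (torusVolume d L) := by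
  have := isFiniteMeasure_torusVolume (d := d) hL
  have hfv := hf.aestronglyMeasurable hL hfm
  have hsub := hf.aestronglyMeasurable_sub ρ hL hfm
  -- Jensen: for the probability measure ρ the `L¹` norm is at most the `L^q` norm. Tonelli and
  -- translation invariance then finish the case q < ∞.
  have hpt : ∀ᵐ x ∂torusVolume d L,
      ‖average ρ f x‖ₑ ≤ eLpNorm (fun y => f (x - y)) q ρ := by
    filter_upwards [hsub.prodMk_left] with x hx
    calc ‖average ρ f x‖ₑ ≤ ∫⁻ y, ‖f (x - y)‖ₑ ∂ρ := enorm_integral_le_lintegral_enorm _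
      _ = eLpNorm (fun y => f (x - y)) 1 ρ := eLpNorm_one_eq_lintegral_enorm.symm
      _ ≤ _ := eLpNorm_le_eLpNorm_of_exponent_le hq hx
  rcases eq_or_ne q ⊤ with rfl | hqt
  · rw [eLpNorm_exponent_top, eLpNorm_exponent_top]
    refine essSup_le_of_ae_le _ ?_
    have h1 : ∀ᵐ x ∂torusVolume d L, ‖f x‖ₑ ≤ eLpNormEssSup f (torusVolume d L) :=
      ae_le_eLpNormEssSup
    have h2 := ae_volume_of_ae_torus hL (p := fun x => ‖f x‖ₑ ≤ eLpNormEssSup f (torusVolume d L))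
      (fun i x => by simp only [hf i x]) h1
    have h3 := Measure.ae_ae_of_ae_prod ((quasiMeasurePreserving_torus_sub ρ L).ae h2)
    filter_upwards [hpt, h3] with x hx hx3
    exact hx.trans (essSup_le_of_ae_le _ hx3)
  · have hq0 : q ≠ 0 := (zero_lt_one.trans_le hq).ne'
    have hqr : 0 < q.toReal := ENNReal.toReal_pos hq0 hqt
    rw [eLpNorm_eq_lintegral_rpow_enorm_toReal hq0 hqt,
      eLpNorm_eq_lintegral_rpow_enorm_toReal hq0 hqt]
    refine ENNReal.rpow_le_rpow ?_ (by positivity)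
    refine le_trans (lintegral_mono_ae ?_) (lintegral_lintegral_torus_sub_le (ρ := ρ) hL
      (g := fun x => ‖f x‖ₑ ^ q.toReal) (hf.comp fun z => ‖z‖ₑ ^ q.toReal)
      (hfv.enorm.pow_const _))
    filter_upwards [hpt] with x hx
    calc ‖average ρ f x‖ₑ ^ q.toReal ≤ (eLpNorm (fun y => f (x - y)) q ρ) ^ q.toReal :=
          ENNReal.rpow_le_rpow hx hqr.le
      _ = _ := by
        rw [eLpNorm_eq_lintegral_rpow_enorm_toReal hq0 hqt, ← ENNReal.rpow_mul,
          one_div_mul_cancel hqr.ne', ENNReal.rpow_one]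

theorem MemTorusL1.integrable_sub (ρ : Measure (Pt d)) [IsProbabilityMeasure ρ] (hL : 0 < L)
    {u : Pt d → ℝ} (hu : MemTorusL1 L u) :
    Integrable (fun p : Pt d × Pt d => u (p.1 - p.2)) ((torusVolume d L).prod ρ) := by
  have := isFiniteMeasure_torusVolume (d := d) hL
  have hm := hu.1.aestronglyMeasurable_sub ρ hL hu.2.1
  refine ⟨hm, ?_⟩
  have hv := hu.1.aestronglyMeasurable hL hu.2.1
  rw [HasFiniteIntegral, lintegral_prod _ hm.enorm]
  exact (lintegral_lintegral_torus_sub_le hL (g := fun x => ‖u x‖ₑ) (hu.1.comp fun z => ‖z‖ₑ)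
    hv.enorm).trans_lt hu.2.2

theorem MemTorusL1.average (ρ : Measure (Pt d)) [IsProbabilityMeasure ρ] (hL : 0 < L)
    {u : Pt d → ℝ} (hu : MemTorusL1 L u) : MemTorusL1 L (average ρ u) := by
  have := isFiniteMeasure_torusVolume (d := d) hL
  exact ⟨hu.1.average ρ, (hu.integrable_sub ρ hL).integral_prod_left⟩

/-- Averaging is linear only where both integrals converge, which is the case for almost every x by
Fubini. -/
theorem eLpNorm_average_sub_le (hL : 0 < L) {u w : Pt d → ℝ} (hu : MemTorusL1 L u)
    (hw : MemTorusL1 L w) :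
    eLpNorm (fun x => average ρ u x - average ρ w x) 1 (torusVolume d L) ≤
      eLpNorm (fun x => u x - w x) 1 (torusVolume d L) := by
  have := isFiniteMeasure_torusVolume (d := d) hL
  have h : (fun x => average ρ u x - average ρ w x) =ᵐ[torusVolume d L]
      average ρ (fun x => u x - w x) := by
    filter_upwards [(hu.integrable_sub ρ hL).prod_right_ae,
      (hw.integrable_sub ρ hL).prod_right_ae] with x hx1 hx2
    exact (integral_sub hx1 hx2).symm
  rw [eLpNorm_congr_ae h]
  exact eLpNorm_average_le hL (hu.1.comp₂ hw.1 fun a b => a - b) (hu.2.sub hw.2).1 le_rfl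

theorem isProbabilityMeasure_map_neg : IsProbabilityMeasure (ρ.map fun y => -y) :=
  Measure.isProbabilityMeasure_map (by fun_prop)

/-- The adjoint of averaging is averaging with the reflected measure. -/
theorem integral_average_mul (hL : 0 < L) {g φ : Pt d → ℝ} (hg : MemTorusL1 L g)
    (hφ : Continuous φ) (hφp : IsTorusPeriodic L φ) :
    ∫ x, average ρ g x * φ x ∂torusVolume d L =
      ∫ x, g x * average (ρ.map fun y => -y) φ x ∂torusVolume d L := by
  have := isFiniteMeasure_torusVolume (d := d) hL
  obtain ⟨C, hC⟩ := hφp.exists_bound hL hφ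
  have h1 : Integrable (fun p : Pt d × Pt d => g (p.1 - p.2) * φ p.1)
      ((torusVolume d L).prod ρ) :=
    (hg.integrable_sub ρ hL).mul_bdd (c := C) (hφ.comp continuous_fst).aestronglyMeasurable
      (ae_of_all _ fun p => hC _)
  have h2 : Integrable (fun p : Pt d × Pt d => g p.1 * φ (p.1 + p.2))
      ((torusVolume d L).prod ρ) := by
    have : Integrable (fun p : Pt d × Pt d => g p.1) ((torusVolume d L).prod ρ) :=
      hg.2.comp_fst ρ
    exact this.mul_bdd (c := C)
      (hφ.comp (continuous_fst.add continuous_snd)).aestronglyMeasurable (ae_of_all _ fun p => hC _)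
  calc ∫ x, average ρ g x * φ x ∂torusVolume d L
      = ∫ x, ∫ y, g (x - y) * φ x ∂ρ ∂torusVolume d L := by
        simp only [average, integral_mul_const]
    _ = ∫ y, ∫ x, g (x - y) * φ x ∂torusVolume d L ∂ρ := integral_integral_swap h1
    _ = ∫ y, ∫ x, g x * φ (x + y) ∂torusVolume d L ∂ρ := by
        refine integral_congr_ae (ae_of_all _ fun y => ?_)
        simp only
        rw [← integral_torus_add hL y (g := fun x => g (x - y) * φ x)]
        · simp only [add_sub_cancel_right]
        · exact (hg.1.comp_torusMap (isTorusMap_sub_const L y)).comp₂ hφp fun a b => a * b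
    _ = ∫ x, ∫ y, g x * φ (x + y) ∂ρ ∂torusVolume d L := (integral_integral_swap h2).symm
    _ = _ := by
        refine integral_congr_ae (ae_of_all _ fun x => ?_)
        simp only [average]
        rw [integral_const_mul, integral_map (f := fun y => φ (x - y)) (by fun_prop)
          (hφ.comp (continuous_const.sub continuous_id)).aestronglyMeasurable]
        simp only [sub_neg_eq_add]

end

/-! ### Smooth periodic functions -/

theorem IsTorusPeriodic.fderiv {d : ℕ} {L : ℝ} {F : Type*} [NormedAddCommGroup F]
    [NormedSpace ℝ F] {f : Pt d → F} (hf : IsTorusPeriodic L f) :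
    IsTorusPeriodic L (fderiv ℝ f) := by
  intro i x
  rw [← fderiv_comp_add_right]
  congr 1
  ext1 y
  exact hf i y

theorem IsTorusPeriodic.iteratedFDeriv {d : ℕ} {L : ℝ} {F : Type*} [NormedAddCommGroup F]
    [NormedSpace ℝ F] {f : Pt d → F} (hf : IsTorusPeriodic L f) (n : ℕ) :
    IsTorusPeriodic L (iteratedFDeriv ℝ n f) := by
  intro i x
  rw [← iteratedFDeriv_comp_add_right]
  congr 1
  ext1 y
  exact hf i y

theorem integrable_sub_of_continuous {d : ℕ} {L : ℝ} {F : Type*}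
    [NormedAddCommGroup F] {ρ : Measure (Pt d)} [IsFiniteMeasure ρ] (hL : 0 < L) {f : Pt d → F} (hf : Continuous f)
    (hfp : IsTorusPeriodic L f) (x : Pt d) : Integrable (fun y => f (x - y)) ρ := by
  obtain ⟨C, hC⟩ := hfp.exists_bound hL hf
  exact Integrable.of_bound (hf.comp (continuous_const.sub continuous_id)).aestronglyMeasurable C
    (ae_of_all _ fun y => hC _)

/-- The sum of the norms of the derivatives up to order `j` at a point. -/
noncomputable def derivSum {d : ℕ} {F : Type*} [NormedAddCommGroup F] [NormedSpace ℝ F] (j : ℕ)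
    (f : Pt d → F) (x : Pt d) : ℝ :=
  ∑ i ∈ Finset.range (j + 1), ‖iteratedFDeriv ℝ i f x‖

section

variable {d : ℕ} {L : ℝ} {F : Type} [NormedAddCommGroup F] [NormedSpace ℝ F]

theorem derivSum_nonneg (j : ℕ) (f : Pt d → F) (x : Pt d) : 0 ≤ derivSum j f x :=
  Finset.sum_nonneg fun _ _ => norm_nonneg _

theorem norm_iteratedFDeriv_le_derivSum {i j : ℕ} (h : i ≤ j) (f : Pt d → F) (x : Pt d) :
    ‖iteratedFDeriv ℝ i f x‖ ≤ derivSum j f x :=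
  Finset.single_le_sum (f := fun i => ‖iteratedFDeriv ℝ i f x‖) (fun _ _ => norm_nonneg _)
    (Finset.mem_range.2 (by omega))

theorem derivSum_mono {i j : ℕ} (h : i ≤ j) (f : Pt d → F) (x : Pt d) :
    derivSum i f x ≤ derivSum j f x :=
  Finset.sum_le_sum_of_subset_of_nonneg (Finset.range_mono (by omega)) fun _ _ _ => norm_nonneg _

theorem derivSum_zero (f : Pt d → F) (x : Pt d) : derivSum 0 f x = ‖f x‖ := by
  simp [derivSum]

theorem IsTorusPeriodic.derivSum {f : Pt d → F} (hf : IsTorusPeriodic L f) (j : ℕ) :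
    IsTorusPeriodic L (derivSum j f) := by
  intro i x
  simp only [RandomSplitting.derivSum]
  exact Finset.sum_congr rfl fun n _ => by rw [hf.iteratedFDeriv n i x]

theorem continuous_derivSum {f : Pt d → F} (hf : ContDiff ℝ ∞ f) (j : ℕ) :
    Continuous (derivSum j f) :=
  continuous_finsetSum _ fun i _ =>
    (hf.continuous_iteratedFDeriv (by exact_mod_cast le_top)).norm

variable {ρ : Measure (Pt d)} [IsProbabilityMeasure ρ]

theorem hasFDerivAt_average [CompleteSpace F] (hL : 0 < L) {f : Pt d → F} (hf : ContDiff ℝ ∞ f)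
    (hfp : IsTorusPeriodic L f) (x : Pt d) :
    HasFDerivAt (average ρ f) (average ρ (fderiv ℝ f) x) x := by
  have hf' : Continuous (fderiv ℝ f) := hf.continuous_fderiv (by simp)
  obtain ⟨C, hC⟩ := hfp.fderiv.exists_bound hL hf'
  refine hasFDerivAt_integral_of_dominated_of_fderiv_le (F := fun x y => f (x - y))
    (F' := fun x y => fderiv ℝ f (x - y)) (bound := fun _ => C) Filter.univ_mem
    (Filter.Eventually.of_forall fun z => (integrable_sub_of_continuous hL hf.continuous hfp z).1)
    (integrable_sub_of_continuous hL hf.continuous hfp x)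
    (integrable_sub_of_continuous hL hf' hfp.fderiv x).1 (ae_of_all _ fun y z _ => hC _)
    (integrable_const _) (ae_of_all _ fun y z _ => ?_)
  have h1 : HasFDerivAt f (fderiv ℝ f (z - y)) (z - y) :=
    (hf.differentiable (by simp) _).hasFDerivAt
  have h2 := h1.comp z (hasFDerivAt_sub_const (𝕜 := ℝ) (x := z) y)
  rwa [ContinuousLinearMap.comp_id] at h2

theorem fderiv_average [CompleteSpace F] (hL : 0 < L) {f : Pt d → F} (hf : ContDiff ℝ ∞ f)
    (hfp : IsTorusPeriodic L f) : fderiv ℝ (average ρ f) = average ρ (fderiv ℝ f) :=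
  funext fun x => (hasFDerivAt_average hL hf hfp x).fderiv

/-- The induction runs over all target spaces at once, since its step replaces f by `fderiv ℝ f`,
which takes values in another space. -/
theorem contDiff_average_nat (hL : 0 < L) (n : ℕ) : ∀ {F : Type} [NormedAddCommGroup F]
    [NormedSpace ℝ F] [CompleteSpace F] {f : Pt d → F}, ContDiff ℝ ∞ f → IsTorusPeriodic L f →
    ContDiff ℝ n (average ρ f) := by
  induction n with
  | zero =>
    intro F _ _ _ f hf hfp
    exact contDiff_zero.2 (continuous_iff_continuousAt.2 fun x =>
      (hasFDerivAt_average hL hf hfp x).continuousAt)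
  | succ n ih =>
    intro F _ _ _ f hf hfp
    rw [show ((n + 1 : ℕ) : WithTop ℕ∞) = n + 1 by push_cast; rfl, contDiff_succ_iff_fderiv]
    refine ⟨fun x => (hasFDerivAt_average hL hf hfp x).differentiableAt, by simp, ?_⟩
    rw [fderiv_average hL hf hfp]
    exact ih (hf.fderiv_right (by simp)) hfp.fderiv

theorem contDiff_average [CompleteSpace F] (hL : 0 < L) {f : Pt d → F} (hf : ContDiff ℝ ∞ f)
    (hfp : IsTorusPeriodic L f) : ContDiff ℝ ∞ (average ρ f) :=
  contDiff_infty.2 fun n => contDiff_average_nat hL n hf hfp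

theorem norm_iteratedFDeriv_average_le (hL : 0 < L) (n : ℕ) : ∀ {F : Type} [NormedAddCommGroup F]
    [NormedSpace ℝ F] [CompleteSpace F] {f : Pt d → F}, ContDiff ℝ ∞ f → IsTorusPeriodic L f →
    ∀ x, ‖iteratedFDeriv ℝ n (average ρ f) x‖ ≤ ∫ y, ‖iteratedFDeriv ℝ n f (x - y)‖ ∂ρ := by
  induction n with
  | zero =>
    intro F _ _ _ f hf hfp x
    simp only [norm_iteratedFDeriv_zero]
    exact norm_integral_le_integral_norm _
  | succ n ih =>
    intro F _ _ _ f hf hfp x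
    simp only [← norm_iteratedFDeriv_fderiv]
    rw [fderiv_average hL hf hfp]
    exact ih (hf.fderiv_right (by simp)) hfp.fderiv x

theorem derivSum_average_le [CompleteSpace F] (hL : 0 < L) {f : Pt d → F} (hf : ContDiff ℝ ∞ f)
    (hfp : IsTorusPeriodic L f) (j : ℕ) (x : Pt d) :
    derivSum j (average ρ f) x ≤ average ρ (derivSum j f) x := by
  simp only [average, derivSum]
  rw [integral_finsetSum _ fun i _ => ?_]
  · exact Finset.sum_le_sum fun i _ => norm_iteratedFDeriv_average_le hL i hf hfp x
  · exact (integrable_sub_of_continuous hL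
      (hf.continuous_iteratedFDeriv (by exact_mod_cast le_top)) (hfp.iteratedFDeriv i) x).norm

theorem eLpNorm_derivSum_average_le [CompleteSpace F] (hL : 0 < L) {f : Pt d → F}
    (hf : ContDiff ℝ ∞ f) (hfp : IsTorusPeriodic L f) (j : ℕ) {q : ℝ≥0∞} (hq : 1 ≤ q) :
    eLpNorm (derivSum j (average ρ f)) q (torusVolume d L) ≤
      eLpNorm (derivSum j f) q (torusVolume d L) := by
  refine le_trans (eLpNorm_mono_real fun x => ?_) (eLpNorm_average_le (ρ := ρ) hL
    (hfp.derivSum j) (continuous_derivSum hf j).aestronglyMeasurable hq)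
  rw [Real.norm_of_nonneg (derivSum_nonneg _ _ _)]
  exact derivSum_average_le hL hf hfp j x

end

end RandomSplitting

namespace RandomSplitting

/-! ### One explicit Euler step of the advection equation -/

/-- One explicit Euler step backwards along the velocity field. -/
noncomputable def advectionStep {d : ℕ} (v : Pt d → Pt d) (h : ℝ) (x : Pt d) : Pt d := x - h • v x

theorem isTorusMap_advectionStep {d : ℕ} {L : ℝ} {v : Pt d → Pt d} (hv : IsTorusPeriodic L v)
    (h : ℝ) : IsTorusMap L (advectionStep v h) := by
  intro i x
  simp only [advectionStep, hv i x]
  abel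

theorem contDiff_advectionStep {d : ℕ} {v : Pt d → Pt d} (hv : ContDiff ℝ ∞ v) (h : ℝ) :
    ContDiff ℝ ∞ (advectionStep v h) :=
  contDiff_id.sub (hv.const_smul h)

/-- With s = hK ≤ 1/2, the reverse triangle inequality gives expansion by at least 1 - s, and 1 / (1
- s) ≤ 1 + 2s ≤ exp (2s). -/
theorem antilipschitz_advectionStep {d : ℕ} {v : Pt d → Pt d} {K : ℝ≥0} (hK : LipschitzWith K v)
    {h : ℝ} (h0 : 0 ≤ h) (hh : h * K ≤ 1 / 2) :
    AntilipschitzWith (Real.exp (2 * K * h)).toNNReal (advectionStep v h) := by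
  refine AntilipschitzWith.of_le_mul_dist fun x y => ?_
  rw [Real.coe_toNNReal _ (Real.exp_pos _).le]
  have h1 := hK.dist_le_mul x y
  rw [dist_eq_norm, dist_eq_norm] at h1 ⊢
  have h2 : ‖x - y‖ ≤ ‖advectionStep v h x - advectionStep v h y‖ + h * ‖v x - v y‖ := by
    calc ‖x - y‖ = ‖(advectionStep v h x - advectionStep v h y) + h • (v x - v y)‖ := by
          congr 1
          simp only [advectionStep, smul_sub]
          abel
      _ ≤ _ := (norm_add_le _ _).trans_eq (by rw [norm_smul, Real.norm_of_nonneg h0])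
  have h3 : 1 + 2 * K * h ≤ Real.exp (2 * K * h) := by
    linarith [Real.add_one_le_exp (2 * K * h)]
  have h4 : h * ‖v x - v y‖ ≤ h * K * ‖x - y‖ := by
    rw [mul_assoc]; gcongr
  have hKh : 0 ≤ h * K := by positivity
  have h5 : ‖x - y‖ ≤ (1 + 2 * K * h) * ‖advectionStep v h x - advectionStep v h y‖ := by
    have h6 : 0 ≤ ‖x - y‖ * ((h * K) * (1 - 2 * (h * K))) :=
      mul_nonneg (norm_nonneg _) (mul_nonneg hKh (by linarith))
    have h7 : (1 + 2 * (h * K)) * (‖x - y‖ * (1 - h * K)) ≤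
        (1 + 2 * (h * K)) * ‖advectionStep v h x - advectionStep v h y‖ := by
      gcongr
      linarith
    linarith
  exact h5.trans (by gcongr)

theorem fderiv_comp_advectionStep {d : ℕ} {F : Type*} [NormedAddCommGroup F] [NormedSpace ℝ F]
    {v : Pt d → Pt d} (hv : ContDiff ℝ ∞ v) {f : Pt d → F} (hf : ContDiff ℝ ∞ f) (h : ℝ) :
    fderiv ℝ (fun x => f (advectionStep v h x)) = fun x =>
      fderiv ℝ f (advectionStep v h x) -
        h • ContinuousLinearMap.compL ℝ (Pt d) (Pt d) F (fderiv ℝ f (advectionStep v h x))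
          (fderiv ℝ v x) := by
  ext1 x
  have h1 : HasFDerivAt f (fderiv ℝ f (advectionStep v h x)) (advectionStep v h x) :=
    (hf.differentiable (by simp) _).hasFDerivAt
  have h2 : HasFDerivAt (advectionStep v h)
      (ContinuousLinearMap.id ℝ (Pt d) - h • fderiv ℝ v x) x :=
    (hasFDerivAt_id x).sub ((hv.differentiable (by simp) x).hasFDerivAt.const_smul h)
  rw [(h1.comp x h2).fderiv (f := fun x => f (advectionStep v h x))]
  ext y
  simp

theorem derivSum_fderiv_le {d : ℕ} {F : Type} [NormedAddCommGroup F] [NormedSpace ℝ F]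
    (j : ℕ) (f : Pt d → F) (x : Pt d) : derivSum j (fderiv ℝ f) x ≤ derivSum (j + 1) f x := by
  simp only [derivSum, norm_iteratedFDeriv_fderiv]
  rw [Finset.sum_range_succ' _ (j + 1)]
  simp

/-- With Y the Euler step, D(f ∘ Y) = (Df) ∘ Y - h ((Df) ∘ Y) · Dv. The first term falls under the
induction hypothesis for Df; the second already carries a factor h, so a crude Leibniz bound is
enough. The coefficient of the leading term must be exactly 1: otherwise m steps would cost C^m
instead of an exponential in the elapsed time. -/
theorem exists_norm_iteratedFDeriv_comp_advectionStep_le {d : ℕ} {L : ℝ} (hL : 0 < L)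
    {v : Pt d → Pt d} (hv : ContDiff ℝ ∞ v) (hvp : IsTorusPeriodic L v) (n : ℕ) :
    ∃ C : ℝ, 0 ≤ C ∧ ∀ i ≤ n, ∀ {F : Type} [NormedAddCommGroup F] [NormedSpace ℝ F]
      {f : Pt d → F}, ContDiff ℝ ∞ f → ∀ h, 0 ≤ h → h ≤ 1 → ∀ x,
        ‖iteratedFDeriv ℝ i (fun x => f (advectionStep v h x)) x‖ ≤
          ‖iteratedFDeriv ℝ i f (advectionStep v h x)‖ +
            C * h * derivSum i f (advectionStep v h x) := by
  induction n with
  | zero =>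
    refine ⟨0, le_rfl, fun i hi F _ _ f hf h _ _ x => ?_⟩
    obtain rfl : i = 0 := by omega
    simp
  | succ n ih =>
    obtain ⟨C, hC0, hC⟩ := ih
    have hv' : ContDiff ℝ ∞ (fderiv ℝ v) := hv.fderiv_right (by simp)
    obtain ⟨B, hB⟩ := (hvp.fderiv.derivSum n).exists_bound hL (continuous_derivSum hv' n)
    -- C comes from (Df) ∘ Y. In the product term, 2^n is the sum of the binomial coefficients, 1 +
    -- C bounds the derivatives of (Df) ∘ Y for h ≤ 1, and B those of Dv.
    refine ⟨C + 2 ^ n * (1 + C) * B, by positivity, fun i hi F _ _ f hf h h0 h1 x => ?_⟩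
    rcases i with - | i
    · have : 0 ≤ (C + 2 ^ n * (1 + C) * B) * h * derivSum 0 f (advectionStep v h x) :=
        mul_nonneg (by positivity) (derivSum_nonneg _ _ _)
      simpa using this
    have hin : i ≤ n := by omega
    have hf' : ContDiff ℝ ∞ (fderiv ℝ f) := hf.fderiv_right (by simp)
    set y := advectionStep v h x with hy
    have hcomp : ContDiff ℝ ∞ fun x => fderiv ℝ f (advectionStep v h x) :=
      hf'.comp (contDiff_advectionStep hv h)
    have hS := derivSum_nonneg i (fderiv ℝ f) y
    have hbil := (ContinuousLinearMap.compL ℝ (Pt d) (Pt d)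
      F).norm_iteratedFDeriv_le_of_bilinear_of_le_one hcomp hv' x (n := i)
      (by exact_mod_cast le_top) (ContinuousLinearMap.norm_compL_le ℝ _ _ _)
    have hbil2 : ∑ l ∈ Finset.range (i + 1), (i.choose l : ℝ) *
        ‖iteratedFDeriv ℝ l (fun x => fderiv ℝ f (advectionStep v h x)) x‖ *
          ‖iteratedFDeriv ℝ (i - l) (fderiv ℝ v) x‖ ≤
        2 ^ n * (1 + C) * B * derivSum i (fderiv ℝ f) y := by
      have hterm : ∀ l ∈ Finset.range (i + 1), (i.choose l : ℝ) *
          ‖iteratedFDeriv ℝ l (fun x => fderiv ℝ f (advectionStep v h x)) x‖ *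
            ‖iteratedFDeriv ℝ (i - l) (fderiv ℝ v) x‖ ≤
          (i.choose l : ℝ) * ((1 + C) * derivSum i (fderiv ℝ f) y) * B := by
        intro l hl
        have hl : l ≤ i := by simpa [Nat.lt_succ_iff] using hl
        have h2 := hC l (hl.trans hin) hf' h h0 h1 x
        have h3 : ‖iteratedFDeriv ℝ (i - l) (fderiv ℝ v) x‖ ≤ B :=
          (norm_iteratedFDeriv_le_derivSum (by omega) _ x).trans
            ((Real.norm_of_nonneg (derivSum_nonneg n (fderiv ℝ v) x)).symm.le.trans (hB x))
        have h4 := norm_iteratedFDeriv_le_derivSum hl (fderiv ℝ f) y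
        have h5 := derivSum_mono hl (fderiv ℝ f) y
        have h6 : C * h * derivSum l (fderiv ℝ f) y ≤ C * 1 * derivSum i (fderiv ℝ f) y := by
          gcongr
          exact derivSum_nonneg _ _ _
        gcongr
        linarith
      refine (Finset.sum_le_sum hterm).trans ?_
      rw [← Finset.sum_mul, ← Finset.sum_mul]
      have : ∑ l ∈ Finset.range (i + 1), (i.choose l : ℝ) = 2 ^ i := by
        exact_mod_cast Nat.sum_range_choose i
      rw [this]
      have h7 : (2 : ℝ) ^ i ≤ 2 ^ n := pow_le_pow_right₀ (by norm_num) hin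
      calc (2 : ℝ) ^ i * ((1 + C) * derivSum i (fderiv ℝ f) y) * B
          ≤ 2 ^ n * ((1 + C) * derivSum i (fderiv ℝ f) y) * B := by gcongr
        _ = _ := by ring
    have h8 := hC i hin hf' h h0 h1 x
    rw [← norm_iteratedFDeriv_fderiv, ← norm_iteratedFDeriv_fderiv,
      fderiv_comp_advectionStep hv hf h]
    have hcb : ContDiff ℝ ∞ fun x => ContinuousLinearMap.compL ℝ (Pt d) (Pt d) F
        (fderiv ℝ f (advectionStep v h x)) (fderiv ℝ v x) :=
      hcomp.clm_comp hv'
    have hle : ∀ m : ℕ, ((m : ℕ∞) : WithTop ℕ∞) ≤ ((⊤ : ℕ∞) : WithTop ℕ∞) := fun m => by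
      exact_mod_cast le_top
    rw [fun_iteratedFDeriv_sub_apply (hcomp.of_le (hle i)).contDiffAt
        ((hcb.of_le (hle i)).const_smul h).contDiffAt,
      iteratedFDeriv_const_smul_apply' (hcb.of_le (hle i)).contDiffAt]
    refine (norm_sub_le _ _).trans ?_
    rw [norm_smul, Real.norm_of_nonneg h0]
    have h9 := derivSum_fderiv_le i f y
    have h10 : h * ‖iteratedFDeriv ℝ i (fun x => ContinuousLinearMap.compL ℝ (Pt d) (Pt d) F
        (fderiv ℝ f (advectionStep v h x)) (fderiv ℝ v x)) x‖ ≤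
        h * (2 ^ n * (1 + C) * B * derivSum i (fderiv ℝ f) y) := by
      gcongr
      exact hbil.trans hbil2
    have h11 : (C + 2 ^ n * (1 + C) * B) * h * derivSum i (fderiv ℝ f) y ≤
        (C + 2 ^ n * (1 + C) * B) * h * derivSum (i + 1) f y := by gcongr
    linarith

/-- An Euler step of the advection equation with step size `h` increases the Sobolev norms at most
by a factor `exp (c h)`. -/
theorem exists_eLpNorm_derivSum_comp_advectionStep_le {d : ℕ} {L : ℝ} (hL : 0 < L)
    {v : Pt d → Pt d} (hv : ContDiff ℝ ∞ v) (hvp : IsTorusPeriodic L v) :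
    ∃ h₀ : ℝ, 0 < h₀ ∧ ∀ j : ℕ, ∃ c : ℝ, 0 ≤ c ∧ ∀ h, 0 ≤ h → h ≤ h₀ → ∀ w : Pt d → ℝ,
      ContDiff ℝ ∞ w → IsTorusPeriodic L w → ∀ q : ℝ≥0∞, 1 ≤ q →
        eLpNorm (derivSum j fun x => w (advectionStep v h x)) q (torusVolume d L) ≤
          ENNReal.ofReal (Real.exp (c * h)) * eLpNorm (derivSum j w) q (torusVolume d L) := by
  obtain ⟨-, K, hK⟩ := exists_bound_lipschitz hL hv hvp
  -- This threshold guarantees both h ≤ 1 and hK ≤ 1/2.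
  refine ⟨1 / (2 * (K + 1)), by positivity, fun j => ?_⟩
  obtain ⟨C, hC0, hC⟩ := exists_norm_iteratedFDeriv_comp_advectionStep_le hL hv hvp j
  -- The first summand collects the pointwise errors of the orders 0, ..., j; the second is the
  -- growth of preimage volumes, exp (2Kh) per dimension.
  refine ⟨(j + 1) * C + 2 * K * d, by positivity, fun h h0 hh w hw hwp q hq => ?_⟩
  have hK0 : (0 : ℝ) ≤ K := K.2
  rw [le_div_iff₀ (by positivity)] at hh
  have hh1 : h ≤ 1 := by nlinarith
  have hhK : h * K ≤ 1 / 2 := by nlinarith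
  have hpt : ∀ x, ‖derivSum j (fun x => w (advectionStep v h x)) x‖ ≤
      Real.exp ((j + 1) * C * h) * ‖derivSum j w (advectionStep v h x)‖ := by
    intro x
    rw [Real.norm_of_nonneg (derivSum_nonneg _ _ _), Real.norm_of_nonneg (derivSum_nonneg _ _ _)]
    have hD := derivSum_nonneg j w (advectionStep v h x)
    calc derivSum j (fun x => w (advectionStep v h x)) x
        ≤ ∑ i ∈ Finset.range (j + 1), (‖iteratedFDeriv ℝ i w (advectionStep v h x)‖ +
            C * h * derivSum j w (advectionStep v h x)) := by
          refine Finset.sum_le_sum fun i hi => ?_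
          have hi : i ≤ j := by simpa [Nat.lt_succ_iff] using hi
          refine (hC i hi hw h h0 hh1 x).trans ?_
          gcongr
          exact derivSum_mono hi _ _
      _ = (1 + (j + 1) * C * h) * derivSum j w (advectionStep v h x) := by
          rw [Finset.sum_add_distrib, Finset.sum_const, Finset.card_range, nsmul_eq_mul, derivSum]
          push_cast
          ring
      _ ≤ _ := by
          gcongr
          linarith [Real.add_one_le_exp ((j + 1) * C * h)]
  have hYc : Continuous (advectionStep v h) := (contDiff_advectionStep hv h).continuous
  have h1 := eLpNorm_le_mul_eLpNorm_of_ae_le_mul (μ := torusVolume d L)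
    (g := fun x => derivSum j w (advectionStep v h x)) (ae_of_all _ hpt) q
  refine h1.trans ?_
  have hanti := antilipschitz_advectionStep hK h0 hhK
  have h1c : (1 : ℝ≥0∞) ≤ ((Real.exp (2 * K * h)).toNNReal : ℝ≥0∞) ^ d := by
    refine one_le_pow₀ ?_
    rw [← ENNReal.ofReal, ENNReal.one_le_ofReal, Real.one_le_exp_iff]
    positivity
  have h2 := eLpNorm_torus_comp_le hL h1c hYc.measurable (isTorusMap_advectionStep hvp h)
    (map_volume_le_of_antilipschitz hanti hYc.measurable) hq (hwp.derivSum j)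
    (continuous_derivSum hw j).aestronglyMeasurable
  refine (mul_le_mul_right h2 _).trans_eq ?_
  rw [← mul_assoc, ← ENNReal.ofReal, ← ENNReal.ofReal_pow (Real.exp_pos _).le,
    ← ENNReal.ofReal_mul (Real.exp_pos _).le, ← Real.exp_nat_mul, ← Real.exp_add]
  congr 3
  ring

/-! ### One explicit Euler step of the reaction equation -/

/-- One explicit Euler step of `z' = z - z³`. -/
def reactionStep (h z : ℝ) : ℝ := z + h * (z - z ^ 3)

theorem contDiff_reactionStep_comp {d : ℕ} {w : Pt d → ℝ} (hw : ContDiff ℝ ∞ w) (h : ℝ) :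
    ContDiff ℝ ∞ fun x => reactionStep h (w x) :=
  hw.add (contDiff_const.mul (hw.sub (hw.pow 3)))

/-- The cubic term is damping: for h z² ≤ 1 the factor 1 + h - h z² lies in [0, 1 + h], so the rate
is 1 however large z is. -/
theorem abs_reactionStep_le {h z : ℝ} (h0 : 0 ≤ h) (hz : h * z ^ 2 ≤ 1) :
    |reactionStep h z| ≤ (1 + h) * |z| := by
  have : reactionStep h z = (1 + h - h * z ^ 2) * z := by simp only [reactionStep]; ring
  rw [this, abs_mul]
  gcongr
  rw [abs_le]
  constructor <;> nlinarith [mul_nonneg h0 (sq_nonneg z)]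

theorem eLpNorm_derivSum_zero_reactionStep_le {d : ℕ} {L : ℝ} {w : Pt d → ℝ} {h : ℝ}
    (h0 : 0 ≤ h) (hw : ∀ x, h * w x ^ 2 ≤ 1) (q : ℝ≥0∞) :
    eLpNorm (derivSum 0 fun x => reactionStep h (w x)) q (torusVolume d L) ≤
      ENNReal.ofReal (Real.exp h) * eLpNorm (derivSum 0 w) q (torusVolume d L) := by
  refine eLpNorm_le_mul_eLpNorm_of_ae_le_mul (ae_of_all _ fun x => ?_) q
  rw [derivSum_zero, derivSum_zero, norm_norm, norm_norm, Real.norm_eq_abs, Real.norm_eq_abs]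
  refine (abs_reactionStep_le h0 (hw x)).trans ?_
  gcongr
  linarith [Real.add_one_le_exp h]

theorem norm_iteratedFDeriv_sq_le {d : ℕ} {w : Pt d → ℝ} (hw : ContDiff ℝ ∞ w) {i m : ℕ}
    {S T : ℝ} (x : Pt d) (h : ∀ l ≤ i, ‖iteratedFDeriv ℝ l w x‖ * ‖iteratedFDeriv ℝ (i - l) w x‖ ≤
      S * T) (hST : 0 ≤ S * T) (him : i ≤ m) :
    ‖iteratedFDeriv ℝ i (fun y => w y * w y) x‖ ≤ 2 ^ m * (S * T) := by
  refine (norm_iteratedFDeriv_mul_le hw hw x (n := i) (by exact_mod_cast le_top)).trans ?_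
  calc ∑ l ∈ Finset.range (i + 1), (i.choose l : ℝ) * ‖iteratedFDeriv ℝ l w x‖ *
        ‖iteratedFDeriv ℝ (i - l) w x‖
      ≤ ∑ l ∈ Finset.range (i + 1), (i.choose l : ℝ) * (S * T) := by
        refine Finset.sum_le_sum fun l hl => ?_
        rw [mul_assoc]
        refine mul_le_mul_of_nonneg_left ?_ (Nat.cast_nonneg _)
        exact h l (by simpa [Nat.lt_succ_iff] using hl)
    _ = 2 ^ i * (S * T) := by
        rw [← Finset.sum_mul]
        congr 1
        exact_mod_cast Nat.sum_range_choose i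
    _ ≤ _ := by
        gcongr
        norm_num

/-- In the derivatives of `w³` of order at most `j + 1` at most one factor has order `j + 1`. -/
theorem norm_iteratedFDeriv_cube_le {d : ℕ} {w : Pt d → ℝ} (hw : ContDiff ℝ ∞ w) {i j : ℕ}
    (hi : i ≤ j + 1) (x : Pt d) :
    ‖iteratedFDeriv ℝ i (fun y => w y ^ 3) x‖ ≤
      4 ^ (j + 1) * derivSum j w x ^ 2 * derivSum (j + 1) w x := by
  set S := derivSum j w x
  set T := derivSum (j + 1) w x
  have hS : 0 ≤ S := derivSum_nonneg _ _ _
  have hT : 0 ≤ T := derivSum_nonneg _ _ _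
  have hSl : ∀ l ≤ j, ‖iteratedFDeriv ℝ l w x‖ ≤ S :=
    fun l hl => norm_iteratedFDeriv_le_derivSum hl w x
  have hTl : ∀ l ≤ j + 1, ‖iteratedFDeriv ℝ l w x‖ ≤ T :=
    fun l hl => norm_iteratedFDeriv_le_derivSum hl w x
  have hsq : ∀ l ≤ j + 1, ‖iteratedFDeriv ℝ l (fun y => w y * w y) x‖ ≤ 2 ^ (j + 1) * (S * T) := by
    intro l hl
    refine norm_iteratedFDeriv_sq_le hw x (fun r hr => ?_) (by positivity) hl
    -- If r exceeds j then r = l = j + 1, and the other factor has order zero.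
    by_cases hrj : r ≤ j
    · exact mul_le_mul (hSl r hrj) (hTl _ (by omega)) (norm_nonneg _) hS
    · rw [mul_comm]
      exact mul_le_mul (hSl _ (by omega)) (hTl _ (by omega)) (norm_nonneg _) hS
  -- In order zero the square is bounded without T, because it will be paired with a top-order
  -- derivative of the third factor.
  have hsq0 : ‖iteratedFDeriv ℝ 0 (fun y => w y * w y) x‖ ≤ 2 ^ (j + 1) * (S * S) := by
    refine norm_iteratedFDeriv_sq_le hw x (fun r hr => ?_) (by positivity) (by omega)
    exact mul_le_mul (hSl r (by omega)) (hSl _ (by omega)) (norm_nonneg _) hS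
  have hfun : (fun y => w y ^ 3) = fun y => w y * (w y * w y) := by ext y; ring
  rw [hfun]
  refine (norm_iteratedFDeriv_mul_le hw (hw.mul hw) x (n := i) (by exact_mod_cast le_top)).trans ?_
  calc ∑ l ∈ Finset.range (i + 1), (i.choose l : ℝ) * ‖iteratedFDeriv ℝ l w x‖ *
        ‖iteratedFDeriv ℝ (i - l) (fun y => w y * w y) x‖
      ≤ ∑ l ∈ Finset.range (i + 1), (i.choose l : ℝ) * (2 ^ (j + 1) * (S * (S * T))) := by
        refine Finset.sum_le_sum fun l hl => ?_
        rw [mul_assoc]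
        refine mul_le_mul_of_nonneg_left ?_ (Nat.cast_nonneg _)
        have hl : l ≤ i := by simpa [Nat.lt_succ_iff] using hl
        by_cases hlj : l ≤ j
        · calc _ ≤ S * (2 ^ (j + 1) * (S * T)) :=
              mul_le_mul (hSl l hlj) (hsq _ (by omega)) (norm_nonneg _) hS
            _ = _ := by ring
        · rw [show i - l = 0 by omega]
          calc _ ≤ T * (2 ^ (j + 1) * (S * S)) :=
              mul_le_mul (hTl l (by omega)) hsq0 (norm_nonneg _) hT
            _ = _ := by ring
    _ = 2 ^ i * (2 ^ (j + 1) * (S * (S * T))) := by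
        rw [← Finset.sum_mul]
        congr 1
        exact_mod_cast Nat.sum_range_choose i
    _ ≤ 2 ^ (j + 1) * (2 ^ (j + 1) * (S * (S * T))) := by
        gcongr
        norm_num
    _ = _ := by
        rw [show (4 : ℝ) = 2 * 2 by norm_num, mul_pow]
        ring

/-- Linear in the top order, with lower orders only in the coefficient; j + 2 counts the orders 0,
..., j + 1. -/
theorem derivSum_succ_reactionStep_le {d : ℕ} {w : Pt d → ℝ} (hw : ContDiff ℝ ∞ w) {h : ℝ}
    (h0 : 0 ≤ h) (j : ℕ) (x : Pt d) :
    derivSum (j + 1) (fun y => reactionStep h (w y)) x ≤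
      (1 + h * (1 + (j + 2) * 4 ^ (j + 1) * derivSum j w x ^ 2)) * derivSum (j + 1) w x := by
  have hle : ∀ m : ℕ, ((m : ℕ∞) : WithTop ℕ∞) ≤ ((⊤ : ℕ∞) : WithTop ℕ∞) := fun m => by
      exact_mod_cast le_top
  have hpt : ∀ i ∈ Finset.range (j + 1 + 1),
      ‖iteratedFDeriv ℝ i (fun y => reactionStep h (w y)) x‖ ≤
        (1 + h) * ‖iteratedFDeriv ℝ i w x‖ +
          h * (4 ^ (j + 1) * derivSum j w x ^ 2 * derivSum (j + 1) w x) := by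
    intro i hi
    have hi : i ≤ j + 1 := by simpa [Nat.lt_succ_iff] using hi
    have hfun : (fun y => reactionStep h (w y)) = fun y => (1 + h) • w y - h • w y ^ 3 := by
      ext y
      simp only [reactionStep, smul_eq_mul]
      ring
    have hwi := hw.of_le (hle i)
    rw [hfun, fun_iteratedFDeriv_sub_apply (hwi.const_smul _).contDiffAt
        ((hwi.pow 3).const_smul h).contDiffAt,
      iteratedFDeriv_const_smul_apply' hwi.contDiffAt,
      iteratedFDeriv_const_smul_apply' (hwi.pow 3).contDiffAt]
    refine (norm_sub_le _ _).trans ?_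
    rw [norm_smul, norm_smul, Real.norm_of_nonneg h0, Real.norm_of_nonneg (by linarith)]
    gcongr
    exact norm_iteratedFDeriv_cube_le hw hi x
  refine (Finset.sum_le_sum hpt).trans_eq ?_
  rw [Finset.sum_add_distrib, ← Finset.mul_sum, Finset.sum_const, Finset.card_range, nsmul_eq_mul]
  rw [show ∑ i ∈ Finset.range (j + 1 + 1), ‖iteratedFDeriv ℝ i w x‖ = derivSum (j + 1) w x from rfl]
  push_cast
  ring

theorem eLpNorm_derivSum_succ_reactionStep_le {d : ℕ} {L : ℝ} {w : Pt d → ℝ}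
    (hw : ContDiff ℝ ∞ w) {h : ℝ} (h0 : 0 ≤ h) (j : ℕ) {A : ℝ} (hA0 : 0 ≤ A)
    (hA : eLpNorm (derivSum j w) ⊤ (torusVolume d L) ≤ ENNReal.ofReal A) (q : ℝ≥0∞) :
    eLpNorm (derivSum (j + 1) fun x => reactionStep h (w x)) q (torusVolume d L) ≤
      ENNReal.ofReal (Real.exp ((1 + (j + 2) * 4 ^ (j + 1) * A ^ 2) * h)) *
        eLpNorm (derivSum (j + 1) w) q (torusVolume d L) := by
  refine eLpNorm_le_mul_eLpNorm_of_ae_le_mul ?_ q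
  have h1 : ∀ᵐ x ∂torusVolume d L, ‖derivSum j w x‖ₑ ≤ eLpNormEssSup (derivSum j w)
      (torusVolume d L) := ae_le_eLpNormEssSup
  filter_upwards [h1] with x hx
  rw [← eLpNorm_exponent_top] at hx
  have hx := hx.trans hA
  have hS := derivSum_nonneg j w x
  rw [Real.enorm_eq_ofReal hS, ENNReal.ofReal_le_ofReal_iff hA0] at hx
  rw [Real.norm_of_nonneg (derivSum_nonneg _ _ _), Real.norm_of_nonneg (derivSum_nonneg _ _ _)]
  refine (derivSum_succ_reactionStep_le hw h0 j x).trans ?_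
  have := derivSum_nonneg (j + 1) w x
  gcongr
  calc 1 + h * (1 + (j + 2) * 4 ^ (j + 1) * derivSum j w x ^ 2)
      ≤ 1 + h * (1 + (j + 2) * 4 ^ (j + 1) * A ^ 2) := by gcongr
    _ ≤ _ := by
      rw [mul_comm h]
      linarith [Real.add_one_le_exp ((1 + (j + 2) * 4 ^ (j + 1) * A ^ 2) * h)]

end RandomSplitting

namespace RandomSplitting

/-! ### Convergence of the explicit Euler method -/

section

variable {E : Type*} [NormedAddCommGroup E] [NormedSpace ℝ E]

/-- Local truncation error: on the step, y moves by at most Mh, so y(s) - s V(y(t)) has derivative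
at most K M h. The Lipschitz bound is needed only on a set `S` containing the trajectory, since z -
z³ is not globally Lipschitz. -/
theorem norm_taylor_one_le {V : E → E} {S : Set E} {y : ℝ → E} {τ K M : ℝ}
    (hy : ∀ t ∈ Icc 0 τ, HasDerivAt y (V (y t)) t) (hyS : ∀ t ∈ Icc 0 τ, y t ∈ S)
    (hM : ∀ t ∈ Icc 0 τ, ‖V (y t)‖ ≤ M) (hK0 : 0 ≤ K)
    (hK : ∀ a ∈ S, ∀ b ∈ S, ‖V a - V b‖ ≤ K * ‖a - b‖) {t h : ℝ} (ht : 0 ≤ t) (h0 : 0 ≤ h)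
    (hth : t + h ≤ τ) : ‖y (t + h) - (y t + h • V (y t))‖ ≤ K * M * h * h := by
  have htt : t ∈ Icc 0 τ := ⟨ht, by linarith⟩
  have hM0 : 0 ≤ M := (norm_nonneg _).trans (hM t htt)
  have hsub : Icc t (t + h) ⊆ Icc 0 τ := Icc_subset_Icc ht hth
  have h1 : ∀ s ∈ Icc t (t + h), ‖y s - y t‖ ≤ M * h := by
    intro s hs
    have := norm_image_sub_le_of_norm_deriv_le_segment' (f := y) (f' := fun s => V (y s)) (C := M)
      (a := t) (b := t + h) (fun r hr => (hy r (hsub hr)).hasDerivWithinAt)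
      (fun r hr => hM r (hsub (Ico_subset_Icc_self hr))) s hs
    exact this.trans (by gcongr; linarith [hs.2])
  have h2 := norm_image_sub_le_of_norm_deriv_le_segment' (f := fun s => y s - s • V (y t))
    (f' := fun s => V (y s) - (1 : ℝ) • V (y t)) (C := K * (M * h)) (a := t) (b := t + h)
    (fun r hr => ((hy r (hsub hr)).sub ((hasDerivAt_id r).smul_const _)).hasDerivWithinAt)
    (fun r hr => by
      have hr' := Ico_subset_Icc_self hr
      rw [one_smul]
      exact (hK _ (hyS r (hsub hr')) _ (hyS t htt)).trans (by gcongr; exact h1 r hr'))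
    (t + h) ⟨by linarith, le_rfl⟩
  have h3 : y (t + h) - (t + h) • V (y t) - (y t - t • V (y t)) =
      y (t + h) - (y t + h • V (y t)) := by
    rw [add_smul]; abel
  simp only [h3, add_sub_cancel_left] at h2
  linarith

/-- The explicit Euler method converges with order one. -/
theorem norm_euler_sub_le {V : E → E} {S : Set E} {y : ℝ → E} {τ K M : ℝ}
    (hy : ∀ t ∈ Icc 0 τ, HasDerivAt y (V (y t)) t) (hyS : ∀ t ∈ Icc 0 τ, y t ∈ S)
    (hM : ∀ t ∈ Icc 0 τ, ‖V (y t)‖ ≤ M) (hK0 : 0 ≤ K)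
    (hK : ∀ a ∈ S, ∀ b ∈ S, ‖V a - V b‖ ≤ K * ‖a - b‖) {z : ℕ → E} (hz0 : z 0 = y 0) {h : ℝ}
    (h0 : 0 ≤ h) (hz : ∀ n, z (n + 1) = z n + h • V (z n)) (hzS : ∀ n, z n ∈ S) (n : ℕ)
    (hn : n * h ≤ τ) : ‖z n - y (n * h)‖ ≤ n * h * (K * M * h) * Real.exp (K * (n * h)) := by
  induction n with
  | zero => simp [hz0]
  | succ n ih =>
    push_cast at hn ⊢
    have hnh : 0 ≤ n * h := by positivity
    have hn' : n * h + h ≤ τ := by linarith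
    have htt : (n : ℝ) * h ∈ Icc 0 τ := ⟨hnh, by linarith⟩
    have ih := ih (by linarith)
    have h1 := norm_taylor_one_le hy hyS hM hK0 hK hnh h0 hn'
    have h2 := hK _ (hzS n) _ (hyS _ htt)
    have hM0 : 0 ≤ M := (norm_nonneg _).trans (hM _ htt)
    have h3 : ‖z (n + 1) - y (n * h + h)‖ ≤ ‖z n - y (n * h)‖ + h * ‖V (z n) - V (y (n * h))‖ +
        ‖y (n * h + h) - (y (n * h) + h • V (y (n * h)))‖ := by
      calc ‖z (n + 1) - y (n * h + h)‖ = ‖(z n - y (n * h)) + h • (V (z n) - V (y (n * h))) -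
            (y (n * h + h) - (y (n * h) + h • V (y (n * h))))‖ := by
            rw [hz n, smul_sub]
            congr 1
            abel
        _ ≤ _ := by
            refine (norm_sub_le _ _).trans ?_
            gcongr
            refine (norm_add_le _ _).trans_eq ?_
            rw [norm_smul, Real.norm_of_nonneg h0]
    -- Discrete Grönwall: one step amplifies the old error by 1 + Kh, which the exponential absorbs.
    have h4 : (1 + K * h) * Real.exp (K * (n * h)) ≤ Real.exp (K * ((n + 1) * h)) := by
      rw [show K * ((n + 1) * h) = K * h + K * (n * h) by ring, Real.exp_add]
      gcongr
      linarith [Real.add_one_le_exp (K * h)]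
    have h5 : (1 : ℝ) ≤ Real.exp (K * ((n + 1) * h)) := by
      rw [Real.one_le_exp_iff]; positivity
    rw [show ((n : ℝ) + 1) * h = n * h + h by ring] at h4 h5 ⊢
    have hA : 0 ≤ K * M * h := by positivity
    calc ‖z (n + 1) - y (n * h + h)‖
        ≤ (1 + K * h) * ‖z n - y (n * h)‖ + K * M * h * h := by
          have : h * ‖V (z n) - V (y (n * h))‖ ≤ h * (K * ‖z n - y (n * h)‖) := by gcongr
          linarith
      _ ≤ (1 + K * h) * (n * h * (K * M * h) * Real.exp (K * (n * h))) + K * M * h * h := by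
          gcongr
      _ = n * h * (K * M * h) * ((1 + K * h) * Real.exp (K * (n * h))) +
            h * (K * M * h) * 1 := by ring
      _ ≤ n * h * (K * M * h) * Real.exp (K * (n * h + h)) +
            h * (K * M * h) * Real.exp (K * (n * h + h)) := by gcongr
      _ = _ := by ring

end

/-! ### The flow of the velocity field -/

section

variable {d : ℕ} {L : ℝ} {v : Pt d → Pt d}

theorem hasDerivAt_flow_neg (hL : 0 < L) (hv : ContDiff ℝ ∞ v) (hvp : IsTorusPeriodic L v)
    (x : Pt d) (t : ℝ) :
    HasDerivAt (fun s => flow v (-s) x) (-v (flow v (-t) x)) t := by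
  have := HasDerivAt.scomp t ((flow_spec hL hv hvp x).2 (-t)) (hasDerivAt_neg t)
  simpa [Function.comp_def] using this

theorem dist_trajectories_le {V : Pt d → Pt d} {K : ℝ≥0} (hK : LipschitzWith K V)
    {X Y : ℝ → Pt d} (hX : ∀ t, HasDerivAt X (V (X t)) t) (hY : ∀ t, HasDerivAt Y (V (Y t)) t)
    {a b : ℝ} (hab : a ≤ b) : dist (X b) (Y b) ≤ dist (X a) (Y a) * Real.exp (K * (b - a)) :=
  dist_le_of_trajectories_ODE (v := fun _ => V) (fun _ => hK)
    (fun t _ => (hX t).continuousAt.continuousWithinAt) (fun t _ => (hX t).hasDerivWithinAt)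
    (fun t _ => (hY t).continuousAt.continuousWithinAt) (fun t _ => (hY t).hasDerivWithinAt)
    le_rfl b ⟨hab, le_rfl⟩

/-- Follow the two trajectories forward from time -t to 0: their distance grows by at most exp (Kt).
-/
theorem antilipschitz_flow_neg (hL : 0 < L) (hv : ContDiff ℝ ∞ v) (hvp : IsTorusPeriodic L v)
    {K : ℝ≥0} (hK : LipschitzWith K v) {t : ℝ} (ht : 0 ≤ t) :
    AntilipschitzWith (Real.exp (K * t)).toNNReal (flow v (-t)) := by
  refine AntilipschitzWith.of_le_mul_dist fun x y => ?_
  have h := dist_trajectories_le hK (flow_spec hL hv hvp x).2 (flow_spec hL hv hvp y).2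
    (neg_nonpos.2 ht)
  rw [(flow_spec hL hv hvp x).1, (flow_spec hL hv hvp y).1] at h
  rw [Real.coe_toNNReal _ (Real.exp_pos _).le, mul_comm]
  simpa using h

theorem dist_flow_neg_le (hL : 0 < L) (hv : ContDiff ℝ ∞ v) (hvp : IsTorusPeriodic L v)
    {K : ℝ≥0} (hK : LipschitzWith K v) {t : ℝ} (ht : 0 ≤ t) (x y : Pt d) :
    dist (flow v (-t) x) (flow v (-t) y) ≤ dist x y * Real.exp (K * t) := by
  have h := dist_trajectories_le hK.neg (hasDerivAt_flow_neg hL hv hvp x)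
    (hasDerivAt_flow_neg hL hv hvp y) ht
  simpa [(flow_spec hL hv hvp x).1, (flow_spec hL hv hvp y).1] using h

theorem continuous_flow_neg (hL : 0 < L) (hv : ContDiff ℝ ∞ v) (hvp : IsTorusPeriodic L v)
    {t : ℝ} (ht : 0 ≤ t) : Continuous (flow v (-t)) := by
  obtain ⟨-, K, hK⟩ := exists_bound_lipschitz hL hv hvp
  refine (LipschitzWith.of_dist_le_mul (K := (Real.exp (K * t)).toNNReal) fun x y => ?_).continuous
  rw [Real.coe_toNNReal _ (Real.exp_pos _).le, mul_comm]
  exact dist_flow_neg_le hL hv hvp hK ht x y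

/-- A lattice translate of a trajectory is a trajectory, and two trajectories that start at distance
zero coincide. -/
theorem isTorusMap_flow_neg (hL : 0 < L) (hv : ContDiff ℝ ∞ v) (hvp : IsTorusPeriodic L v)
    {t : ℝ} (ht : 0 ≤ t) : IsTorusMap L (flow v (-t)) := by
  obtain ⟨-, K, hK⟩ := exists_bound_lipschitz hL hv hvp
  intro i x
  have h := dist_trajectories_le hK.neg
    (hasDerivAt_flow_neg hL hv hvp (x + EuclideanSpace.single i L))
    (Y := fun s => flow v (-s) x + EuclideanSpace.single i L) (fun s => ?_) ht
  · simp only [neg_zero, (flow_spec hL hv hvp _).1, dist_self, zero_mul] at h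
    exact dist_le_zero.1 h
  · simp only [Pi.neg_apply, hvp i]
    exact (hasDerivAt_flow_neg hL hv hvp x s).add_const _

/-- For a smooth periodic function, backward transport along `m` Euler steps converges uniformly to
the advection semigroup. -/
theorem exists_advectionStep_iterate_sub_le (hL : 0 < L) (hv : ContDiff ℝ ∞ v)
    (hvp : IsTorusPeriodic L v) {w : Pt d → ℝ} (hw : ContDiff ℝ ∞ w) (hwp : IsTorusPeriodic L w)
    {τ : ℝ} (hτ : 0 ≤ τ) : ∃ C : ℝ, 0 ≤ C ∧ ∀ m : ℕ, 0 < m → ∀ x,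
      |w ((advectionStep v (τ / m))^[m] x) - advectionSemigroup v τ w x| ≤ C / m := by
  obtain ⟨⟨M, hM⟩, K, hK⟩ := exists_bound_lipschitz hL hv hvp
  obtain ⟨B, hB⟩ := hwp.fderiv.exists_bound hL (hw.continuous_fderiv (by simp))
  have hlip : LipschitzWith B w :=
    lipschitzWith_of_nnnorm_fderiv_le (hw.differentiable (by simp)) hB
  -- The Lipschitz constant of w times the Euler error at nh = τ; the missing 1 / m is the step size
  -- h = τ / m.
  refine ⟨B * (τ * (K * M * τ) * Real.exp (K * τ)), by positivity, fun m hm x => ?_⟩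
  have hm' : (0 : ℝ) < m := by exact_mod_cast hm
  have h := norm_euler_sub_le (V := fun y => -v y) (S := univ) (y := fun t => flow v (-t) x)
    (τ := τ) (K := K) (M := M) (h := τ / m) (z := fun n => (advectionStep v (τ / m))^[n] x)
    (fun t _ => hasDerivAt_flow_neg hL hv hvp x t) (fun _ _ => mem_univ _)
    (fun t _ => by rw [norm_neg]; exact hM _) K.2
    (fun a _ b _ => by
      rw [neg_sub_neg, norm_sub_rev, ← dist_eq_norm, ← dist_eq_norm]; exact hK.dist_le_mul a b)
    (by simp [(flow_spec hL hv hvp x).1]) (by positivity)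
    (fun n => by
      rw [Function.iterate_succ_apply', smul_neg, ← sub_eq_add_neg]; rfl) (fun _ => mem_univ _) m
    (by rw [mul_div_cancel₀ _ hm'.ne'])
  rw [mul_div_cancel₀ _ hm'.ne'] at h
  have h1 := hlip.dist_le_mul ((advectionStep v (τ / m))^[m] x) (flow v (-τ) x)
  rw [Real.dist_eq, dist_eq_norm] at h1
  refine h1.trans ((mul_le_mul_of_nonneg_left h B.coe_nonneg).trans_eq ?_)
  ring

end

/-! ### The reaction semigroup -/

theorem reaction_denominator_pos {s e z : ℝ} (he : e = Real.exp (-2 * s)) (hs : 0 ≤ s) :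
    0 < e ∧ e ≤ 1 ∧ e ≤ z ^ 2 + (1 - z ^ 2) * e := by
  have hE : e ≤ 1 := by rw [he]; exact Real.exp_le_one_iff.2 (by linarith)
  have hE0 : 0 < e := by rw [he]; exact Real.exp_pos _
  exact ⟨hE0, hE, by nlinarith [sq_nonneg z]⟩

/-- If z² ≤ 1, the squared denominator is at least z² and the value at most 1 ≤ R; if z² ≥ 1, it is
at least 1 and the modulus does not grow. -/
theorem abs_reactionSemigroup_le {d : ℕ} {w : Pt d → ℝ} {x : Pt d} {R t : ℝ} (hR : 1 ≤ R)
    (hw : |w x| ≤ R) (ht : 0 ≤ t) : |reactionSemigroup t w x| ≤ R := by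
  simp only [reactionSemigroup]
  obtain ⟨he0, he1, hD⟩ := reaction_denominator_pos (z := w x) rfl ht
  generalize w x = z at *
  generalize Real.exp (-2 * t) = e at *
  have hDp : 0 < z ^ 2 + (1 - z ^ 2) * e := he0.trans_le hD
  rw [abs_div, abs_of_nonneg (Real.sqrt_nonneg _), div_le_iff₀ (Real.sqrt_pos.2 hDp)]
  refine abs_le_of_sq_le_sq ?_ (by positivity)
  rw [mul_pow, Real.sq_sqrt hDp.le]
  have hz2 : z ^ 2 ≤ R ^ 2 := sq_le_sq' (by linarith [(abs_le.1 hw).1]) (abs_le.1 hw).2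
  have hR2 : 1 ≤ R ^ 2 := one_le_pow₀ hR
  rcases le_total (z ^ 2) 1 with h | h
  · have : z ^ 2 ≤ z ^ 2 + (1 - z ^ 2) * e := by nlinarith
    nlinarith
  · have : 1 ≤ z ^ 2 + (1 - z ^ 2) * e := by nlinarith
    nlinarith

/-- R minus the step at z is (R - z) (1 + h - h (R² + Rz + z²)) + h (R³ - R). The step restriction
makes the middle factor nonnegative, and R ≥ 1 the last term. The lower bound is symmetric. -/
theorem abs_reactionStep_le_of_le {h z R : ℝ} (hR : 1 ≤ R) (h0 : 0 ≤ h) (hh : 3 * h * R ^ 2 ≤ 1)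
    (hz : |z| ≤ R) : |reactionStep h z| ≤ R := by
  obtain ⟨h1, h2⟩ := abs_le.1 hz
  have hR3 : 0 ≤ h * (R ^ 3 - R) := by
    refine mul_nonneg h0 ?_
    nlinarith [mul_nonneg (by linarith : 0 ≤ R) (by linarith : 0 ≤ R - 1)]
  have hz2 : z ^ 2 ≤ R ^ 2 := sq_le_sq' h1 h2
  rw [abs_le, reactionStep]
  constructor
  · have h3 : 0 ≤ 1 + h - h * (R ^ 2 - R * z + z ^ 2) := by
      have : h * (R ^ 2 - R * z + z ^ 2) ≤ h * (3 * R ^ 2) := by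
        refine mul_le_mul_of_nonneg_left ?_ h0
        nlinarith
      nlinarith
    nlinarith [mul_nonneg (by linarith : 0 ≤ R + z) h3]
  · have h3 : 0 ≤ 1 + h - h * (R ^ 2 + R * z + z ^ 2) := by
      have : h * (R ^ 2 + R * z + z ^ 2) ≤ h * (3 * R ^ 2) := by
        refine mul_le_mul_of_nonneg_left ?_ h0
        nlinarith
      nlinarith
    nlinarith [mul_nonneg (by linarith : 0 ≤ R - z) h3]

theorem abs_reaction_rhs_sub_le {R a b : ℝ} (ha : |a| ≤ R) (hb : |b| ≤ R) :
    |(a - a ^ 3) - (b - b ^ 3)| ≤ (1 + 3 * R ^ 2) * |a - b| := by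
  have : (a - a ^ 3) - (b - b ^ 3) = (1 - (a ^ 2 + a * b + b ^ 2)) * (a - b) := by ring
  rw [this, abs_mul]
  gcongr
  obtain ⟨h1, h2⟩ := abs_le.1 ha
  obtain ⟨h3, h4⟩ := abs_le.1 hb
  have ha2 : a ^ 2 ≤ R ^ 2 := sq_le_sq' h1 h2
  have hb2 : b ^ 2 ≤ R ^ 2 := sq_le_sq' h3 h4
  rw [abs_le]
  constructor <;> nlinarith [sq_nonneg (a + b), sq_nonneg (a - b), sq_nonneg a, sq_nonneg b]

/-- The explicit Euler method for the reaction equation converges uniformly for bounded data. -/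
theorem exists_reactionStep_iterate_sub_le {d : ℕ} {w : Pt d → ℝ} {R τ : ℝ} (hR : 1 ≤ R)
    (hw : ∀ x, |w x| ≤ R) (hτ : 0 ≤ τ) : ∃ C : ℝ, 0 ≤ C ∧ ∀ m : ℕ, 0 < m →
      3 * (τ / m) * R ^ 2 ≤ 1 → ∀ x,
      |(reactionStep (τ / m))^[m] (w x) - reactionSemigroup τ w x| ≤ C / m := by
  refine ⟨τ * ((1 + 3 * R ^ 2) * (R + R ^ 3) * τ) * Real.exp ((1 + 3 * R ^ 2) * τ), by positivity,
    fun m hm hmR x => ?_⟩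
  have hm' : (0 : ℝ) < m := by exact_mod_cast hm
  have hh : 0 ≤ τ / m := by positivity
  have h := norm_euler_sub_le (V := fun z : ℝ => z - z ^ 3) (S := {z | |z| ≤ R})
    (y := fun t => reactionSemigroup t w x) (τ := τ) (K := 1 + 3 * R ^ 2) (M := R + R ^ 3)
    (h := τ / m) (z := fun n => (reactionStep (τ / m))^[n] (w x))
    (fun t ht => by
      have := (reactionSemigroup_solves w x).2 t ht.1
      rwa [neg_sub] at this)
    (fun t ht => abs_reactionSemigroup_le hR (hw x) ht.1)
    (fun t ht => by
      have h1 := abs_reactionSemigroup_le hR (hw x) ht.1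
      refine (norm_sub_le _ _).trans ?_
      rw [norm_pow, Real.norm_eq_abs]
      gcongr)
    (by positivity) (fun a ha b hb => abs_reaction_rhs_sub_le ha hb)
    (by simp [(reactionSemigroup_solves w x).1]) hh
    (fun n => by rw [Function.iterate_succ_apply']; rfl)
    (fun n => by
      induction n with
      | zero => exact hw x
      | succ n ih =>
        rw [Function.iterate_succ_apply']
        exact abs_reactionStep_le_of_le hR hh hmR ih) m
    (by rw [mul_div_cancel₀ _ hm'.ne'])
  rw [mul_div_cancel₀ _ hm'.ne'] at h
  refine h.trans_eq ?_
  ring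

/-- The solution map is globally Lipschitz although the nonlinearity is not: with D the expression
under the root and e = exp (-2t), its derivative is e / D^{3/2}, and D ≥ e. The constant
deteriorates with t, but it only serves to pass to `L¹` limits. -/
theorem exists_lipschitz_reaction {t : ℝ} (ht : 0 ≤ t) : ∃ K : ℝ≥0, LipschitzWith K
    fun z : ℝ => z / Real.sqrt (z ^ 2 + (1 - z ^ 2) * Real.exp (-2 * t)) := by
  obtain ⟨he0, he1, -⟩ := reaction_denominator_pos (z := 0) rfl ht
  have hD : ∀ z : ℝ, Real.exp (-2 * t) ≤ z ^ 2 + (1 - z ^ 2) * Real.exp (-2 * t) :=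
    fun z => (reaction_denominator_pos rfl ht).2.2
  generalize Real.exp (-2 * t) = e at *
  have hder : ∀ z : ℝ, HasDerivAt (fun z : ℝ => z / Real.sqrt (z ^ 2 + (1 - z ^ 2) * e))
      (e / ((z ^ 2 + (1 - z ^ 2) * e) * Real.sqrt (z ^ 2 + (1 - z ^ 2) * e))) z := by
    intro z
    have hDp : 0 < z ^ 2 + (1 - z ^ 2) * e := he0.trans_le (hD z)
    have h1 : HasDerivAt (fun z : ℝ => z ^ 2 + (1 - z ^ 2) * e) (2 * z - 2 * z * e) z := by
      have h := hasDerivAt_pow 2 z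
      have := h.add ((h.const_sub 1).mul_const e)
      refine this.congr_deriv ?_
      push_cast
      ring
    refine ((hasDerivAt_id z).div (h1.sqrt hDp.ne') (Real.sqrt_pos.2 hDp).ne').congr_deriv ?_
    have hs := Real.sq_sqrt hDp.le
    have hp := Real.sqrt_pos.2 hDp
    set r := Real.sqrt (z ^ 2 + (1 - z ^ 2) * e)
    rw [← hs]
    simp only [id]
    field_simp
    rw [hs]
    ring
  refine ⟨(e / (e * Real.sqrt e)).toNNReal, lipschitzWith_of_nnnorm_deriv_le
    (fun z => (hder z).differentiableAt) fun z => ?_⟩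
  rw [(hder z).deriv, ← NNReal.coe_le_coe, coe_nnnorm, Real.coe_toNNReal _ (by positivity)]
  have hDp : 0 < z ^ 2 + (1 - z ^ 2) * e := he0.trans_le (hD z)
  rw [Real.norm_of_nonneg (by positivity)]
  have := Real.sqrt_le_sqrt (hD z)
  have := Real.sqrt_pos.2 he0
  gcongr
  exact hD z

/-! ### The semigroups are Lipschitz continuous in `L¹` -/

/-- `S` maps `L¹(𝕋^d)` to itself and is Lipschitz continuous there. -/
def IsLipschitzTorusL1 {d : ℕ} (L : ℝ) (S : (Pt d → ℝ) → Pt d → ℝ) : Prop :=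
  (∀ u, MemTorusL1 L u → MemTorusL1 L (S u)) ∧
    ∃ C : ℝ≥0, ∀ u w, MemTorusL1 L u → MemTorusL1 L w →
      eLpNorm (fun x => S u x - S w x) 1 (torusVolume d L) ≤
        C * eLpNorm (fun x => u x - w x) 1 (torusVolume d L)

theorem isLipschitzTorusL1_advectionSemigroup {d : ℕ} {L : ℝ} (hL : 0 < L) {v : Pt d → Pt d}
    (hv : ContDiff ℝ ∞ v) (hvp : IsTorusPeriodic L v) {τ : ℝ} (hτ : 0 ≤ τ) :
    IsLipschitzTorusL1 L (advectionSemigroup v τ) := by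
  obtain ⟨-, K, hK⟩ := exists_bound_lipschitz hL hv hvp
  have hanti := antilipschitz_flow_neg hL hv hvp hK hτ
  have hm := (continuous_flow_neg hL hv hvp hτ).measurable
  have hY := isTorusMap_flow_neg hL hv hvp hτ
  have hmap := map_volume_le_of_antilipschitz hanti hm
  set c := (Real.exp (K * τ)).toNNReal
  have hc1 : (1 : ℝ≥0∞) ≤ (c : ℝ≥0∞) ^ d := by
    refine one_le_pow₀ ?_
    rw [← ENNReal.ofReal, ENNReal.one_le_ofReal, Real.one_le_exp_iff]
    positivity
  have hq : Measure.QuasiMeasurePreserving (flow v (-τ)) (volume : Measure (Pt d)) volume :=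
    ⟨hm, hmap.absolutelyContinuous.trans Measure.smul_absolutelyContinuous⟩
  refine ⟨fun u hu => ?_, c ^ d, fun u w hu hw => ?_⟩
  · have h1 : AEStronglyMeasurable (advectionSemigroup v τ u) (volume : Measure (Pt d)) :=
      (hu.1.aestronglyMeasurable hL hu.2.1).comp_quasiMeasurePreserving hq
    refine ⟨hu.1.comp_torusMap hY, memLp_one_iff_integrable.1
      ⟨h1.mono_ac (torusVolume_absolutelyContinuous d L), ?_⟩⟩
    refine (eLpNorm_torus_comp_le hL hc1 hm hY hmap le_rfl hu.1 hu.2.1).trans_lt ?_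
    exact ENNReal.mul_lt_top (by finiteness) (memLp_one_iff_integrable.2 hu.2).2
  · push_cast
    exact eLpNorm_torus_comp_le (f := fun x => u x - w x) hL hc1 hm hY hmap le_rfl
      (hu.1.comp₂ hw.1 fun a b => a - b) (hu.2.sub hw.2).1

theorem isLipschitzTorusL1_reactionSemigroup {d : ℕ} (L : ℝ) {τ : ℝ} (hτ : 0 ≤ τ) :
    IsLipschitzTorusL1 L (reactionSemigroup (d := d) τ) := by
  obtain ⟨K, hK⟩ := exists_lipschitz_reaction hτ
  refine ⟨fun u hu => ⟨fun i x => ?_, ?_⟩, K, fun u w hu hw => ?_⟩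
  · simp only [reactionSemigroup, hu.1 i x]
  · refine Integrable.mono' (hu.2.norm.const_mul K) (hK.continuous.comp_aestronglyMeasurable hu.2.1)
      (ae_of_all _ fun x => ?_)
    have := hK.dist_le_mul (u x) 0
    simpa [reactionSemigroup] using this
  · have := eLpNorm_le_nnreal_smul_eLpNorm_of_ae_le_mul (μ := torusVolume d L)
      (f := fun x => reactionSemigroup τ u x - reactionSemigroup τ w x)
      (g := fun x => u x - w x) (c := K) (ae_of_all _ fun x => ?_) 1
    · simpa [ENNReal.smul_def] using this
    · have := hK.dist_le_mul (u x) (w x)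
      rw [dist_eq_norm, dist_eq_norm] at this
      exact this

/-- The heat semigroup is convolution with a probability measure. -/
theorem exists_heatSemigroup_eq_average (d : ℕ) {ν t : ℝ} (hν : 0 < ν) (ht : 0 < t) :
    ∃ ρ : Measure (Pt d), IsProbabilityMeasure ρ ∧
      ∀ w : Pt d → ℝ, heatSemigroup ν t w = average ρ w := by
  set k : Pt d → ℝ := fun y =>
    (4 * Real.pi * ν * t) ^ (-(d : ℝ) / 2) * Real.exp (-‖y‖ ^ 2 / (4 * ν * t)) with hk
  have hkm : Measurable k := by
    refine Continuous.measurable ?_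
    fun_prop
  have hk0 : ∀ y, 0 ≤ k y := fun y => by positivity
  -- The mass of the heat kernel is its action on the Fourier mode of frequency zero.
  have hk1 : ∫ y, k y = 1 := by
    have := heatSemigroup_fourierMode hν ht (0 : Pt d) 0 0
    simpa [heatSemigroup, hk] using this
  -- A non-integrable function would have integral 0 by convention, not 1.
  have hki : Integrable k := by
    by_contra hn
    rw [integral_undef hn] at hk1
    exact zero_ne_one hk1
  refine ⟨volume.withDensity fun y => ENNReal.ofReal (k y), ⟨?_⟩, fun w => ?_⟩
  · rw [withDensity_apply _ MeasurableSet.univ, Measure.restrict_univ,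
      ← ofReal_integral_eq_lintegral_ofReal hki (ae_of_all _ hk0), hk1, ENNReal.ofReal_one]
  · ext x
    simp only [average]
    rw [integral_withDensity_eq_integral_toReal_smul hkm.ennreal_ofReal
      (ae_of_all _ fun _ => ENNReal.ofReal_lt_top)]
    refine integral_congr_ae (ae_of_all _ fun y => ?_)
    simp only [ENNReal.toReal_ofReal (hk0 y), smul_eq_mul]
    rfl

theorem isLipschitzTorusL1_average {d : ℕ} {L : ℝ} (hL : 0 < L) (ρ : Measure (Pt d))
    [IsProbabilityMeasure ρ] : IsLipschitzTorusL1 L (average (F := ℝ) ρ) :=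
  ⟨fun _ hu => hu.average ρ hL, 1, fun u w hu hw => by
    simpa using eLpNorm_average_sub_le (ρ := ρ) hL hu hw⟩

end RandomSplitting

namespace RandomSplitting

/-! ### Iterated partial derivatives -/

/-- The iterated partial derivative along a list of coordinate directions. -/
noncomputable def listDeriv {d : ℕ} (l : List (Fin d)) (f : Pt d → ℝ) : Pt d → ℝ :=
  l.foldr partialDeriv f

/-- The directions of the multi-index `α`, in increasing order. -/
def multiIndexList {d : ℕ} (α : Fin d → ℕ) : List (Fin d) :=
  (List.finRange d).flatMap fun i => List.replicate (α i) i

section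

variable {d : ℕ} {L : ℝ}

theorem foldr_replicate_partialDeriv (n : ℕ) (i : Fin d) (f : Pt d → ℝ) :
    (List.replicate n i).foldr partialDeriv f = (partialDeriv i)^[n] f := by
  induction n with
  | zero => rfl
  | succ n ih => rw [List.replicate_succ, List.foldr_cons, ih, Function.iterate_succ_apply']

theorem multiDeriv_eq_listDeriv (α : Fin d → ℕ) (f : Pt d → ℝ) :
    multiDeriv α f = listDeriv (multiIndexList α) f := by
  simp only [multiDeriv, listDeriv, multiIndexList, List.foldr_flatMap,
    foldr_replicate_partialDeriv]

theorem count_multiIndexList (α : Fin d → ℕ) (i : Fin d) : (multiIndexList α).count i = α i := by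
  rw [multiIndexList, List.count_flatMap, ← List.ofFn_eq_map, List.sum_ofFn]
  simp [List.count_replicate]

theorem sum_count_eq_length (l : List (Fin d)) : ∑ i, l.count i = l.length := by
  induction l with
  | nil => simp
  | cons a l ih => simp [List.count_cons, Finset.sum_add_distrib, ih]

theorem length_multiIndexList (α : Fin d → ℕ) : (multiIndexList α).length = ∑ i, α i := by
  rw [← sum_count_eq_length]
  simp only [count_multiIndexList]

theorem contDiff_partialDeriv {f : Pt d → ℝ} (hf : ContDiff ℝ ∞ f) (i : Fin d) :
    ContDiff ℝ ∞ (partialDeriv i f) :=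
  (hf.fderiv_right (by simp)).clm_apply contDiff_const

theorem IsTorusPeriodic.partialDeriv {f : Pt d → ℝ} (hf : IsTorusPeriodic L f) (i : Fin d) :
    IsTorusPeriodic L (partialDeriv i f) :=
  hf.fderiv.comp fun A => A (EuclideanSpace.single i 1)

theorem contDiff_listDeriv {f : Pt d → ℝ} (hf : ContDiff ℝ ∞ f) (l : List (Fin d)) :
    ContDiff ℝ ∞ (listDeriv l f) := by
  induction l with
  | nil => exact hf
  | cons i l ih => exact contDiff_partialDeriv ih i

theorem IsTorusPeriodic.listDeriv {f : Pt d → ℝ} (hf : IsTorusPeriodic L f) (l : List (Fin d)) :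
    IsTorusPeriodic L (listDeriv l f) := by
  induction l with
  | nil => exact hf
  | cons i l ih => exact ih.partialDeriv i

theorem contDiff_multiDeriv {f : Pt d → ℝ} (hf : ContDiff ℝ ∞ f) (α : Fin d → ℕ) :
    ContDiff ℝ ∞ (multiDeriv α f) := by
  rw [multiDeriv_eq_listDeriv]
  exact contDiff_listDeriv hf _

theorem IsTorusPeriodic.multiDeriv {f : Pt d → ℝ} (hf : IsTorusPeriodic L f) (α : Fin d → ℕ) :
    IsTorusPeriodic L (multiDeriv α f) := by
  rw [multiDeriv_eq_listDeriv]
  exact hf.listDeriv _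

theorem fderiv_partialDeriv_apply {f : Pt d → ℝ} (hf : ContDiff ℝ ∞ f) (i : Fin d) (x y : Pt d) :
    fderiv ℝ (partialDeriv i f) x y =
      fderiv ℝ (fderiv ℝ f) x y (EuclideanSpace.single i 1) := by
  have hf' : ContDiff ℝ ∞ (fderiv ℝ f) := hf.fderiv_right (by simp)
  have h := fderiv_clm_apply (hf'.differentiable (by simp) x)
    (differentiableAt_const (EuclideanSpace.single i (1 : ℝ)))
  have h2 : partialDeriv i f = fun y => fderiv ℝ f y (EuclideanSpace.single i 1) := rfl
  rw [h2, h]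
  simp

theorem partialDeriv_comm {f : Pt d → ℝ} (hf : ContDiff ℝ ∞ f) (i j : Fin d) :
    partialDeriv i (partialDeriv j f) = partialDeriv j (partialDeriv i f) := by
  ext x
  have hsymm : IsSymmSndFDerivAt ℝ f x :=
    (hf.contDiffAt (x := x)).isSymmSndFDerivAt (by
      rw [minSmoothness_of_isRCLikeNormedField]
      exact WithTop.coe_le_coe.2 le_top)
  change fderiv ℝ (partialDeriv j f) x _ = fderiv ℝ (partialDeriv i f) x _
  rw [fderiv_partialDeriv_apply hf, fderiv_partialDeriv_apply hf]
  exact hsymm _ _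

theorem listDeriv_perm {l₁ l₂ : List (Fin d)} (h : l₁.Perm l₂) {f : Pt d → ℝ}
    (hf : ContDiff ℝ ∞ f) : listDeriv l₁ f = listDeriv l₂ f := by
  induction h with
  | nil => rfl
  | cons i _ ih => exact congrArg (partialDeriv i) ih
  | swap i j l => exact partialDeriv_comm (contDiff_listDeriv hf l) j i
  | trans _ _ ih₁ ih₂ => exact ih₁.trans ih₂

theorem multiDeriv_count (l : List (Fin d)) {f : Pt d → ℝ} (hf : ContDiff ℝ ∞ f) :
    multiDeriv (fun i => l.count i) f = listDeriv l f := by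
  rw [multiDeriv_eq_listDeriv]
  refine listDeriv_perm (List.perm_iff_count.2 fun i => ?_) hf
  rw [count_multiIndexList]

/-- The components of the iterated Fréchet derivative are the iterated partial derivatives. -/
theorem iteratedFDeriv_apply_basis {f : Pt d → ℝ} (hf : ContDiff ℝ ∞ f) (n : ℕ) :
    ∀ (s : Fin n → Fin d) (x : Pt d),
      iteratedFDeriv ℝ n f x (fun i => EuclideanSpace.single (s i) 1) =
        listDeriv (List.ofFn s) f x := by
  induction n with
  | zero => intro s x; simp [listDeriv]
  | succ n ih =>
    intro s x
    rw [iteratedFDeriv_succ_apply_left, List.ofFn_succ]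
    change _ = fderiv ℝ (listDeriv (List.ofFn fun i => s i.succ) f) x _
    have h1 : listDeriv (List.ofFn fun i => s i.succ) f = fun y =>
        iteratedFDeriv ℝ n f y (fun i => EuclideanSpace.single (s i.succ) 1) :=
      funext fun y => (ih _ y).symm
    have hdiff : DifferentiableAt ℝ (iteratedFDeriv ℝ n f) x :=
      (hf.differentiable_iteratedFDeriv (by exact_mod_cast WithTop.coe_lt_top n)) x
    rw [h1, fderiv_continuousMultilinear_apply_const_apply hdiff]
    rfl

theorem abs_listDeriv_le {f : Pt d → ℝ} (hf : ContDiff ℝ ∞ f) (l : List (Fin d)) (x : Pt d) :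
    |listDeriv l f x| ≤ ‖iteratedFDeriv ℝ l.length f x‖ := by
  have h := iteratedFDeriv_apply_basis hf l.length l.get x
  rw [List.ofFn_get] at h
  rw [← h, ← Real.norm_eq_abs]
  refine (ContinuousMultilinearMap.le_opNorm _ _).trans_eq ?_
  simp

theorem abs_multiDeriv_le_derivSum {f : Pt d → ℝ} (hf : ContDiff ℝ ∞ f) {α : Fin d → ℕ} {k : ℕ}
    (hα : ∑ i, α i ≤ k) (x : Pt d) : |multiDeriv α f x| ≤ derivSum k f x := by
  rw [multiDeriv_eq_listDeriv]
  refine (abs_listDeriv_le hf _ x).trans (norm_iteratedFDeriv_le_derivSum ?_ f x)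
  rwa [length_multiIndexList]

/-- Expand every argument in the standard basis; each coordinate is at most the norm. This turns
bounds on partial derivatives into bounds on Fréchet derivatives. -/
theorem norm_multilinear_le_sum {n : ℕ} (A : ContinuousMultilinearMap ℝ (fun _ : Fin n => Pt d) ℝ) :
    ‖A‖ ≤ ∑ s : Fin n → Fin d, |A fun i => EuclideanSpace.single (s i) 1| := by
  refine ContinuousMultilinearMap.opNorm_le_bound (Finset.sum_nonneg fun _ _ => abs_nonneg _)
    fun m => ?_
  have hm : m = fun i => ∑ k, m i k • EuclideanSpace.single k (1 : ℝ) := by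
    ext i j
    simp [Finset.sum_apply, Pi.single_apply]
  have h1 : A m = ∑ s : Fin n → Fin d, (∏ i, m i (s i)) *
      A fun i => EuclideanSpace.single (s i) 1 := by
    conv_lhs => rw [hm]
    have h2 := A.toMultilinearMap.map_sum (fun i k => m i k • EuclideanSpace.single k (1 : ℝ))
    refine h2.trans (Finset.sum_congr rfl fun s _ => ?_)
    exact A.toMultilinearMap.map_smul_univ (fun i => m i (s i)) _
  rw [h1, Finset.sum_mul]
  refine (norm_sum_le _ _).trans (Finset.sum_le_sum fun s _ => ?_)
  rw [norm_mul, mul_comm, Real.norm_eq_abs, norm_prod]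
  gcongr with i
  exact PiLp.norm_apply_le (m i) (s i)

theorem norm_iteratedFDeriv_le_sum {f : Pt d → ℝ} (hf : ContDiff ℝ ∞ f) (n : ℕ) (x : Pt d) :
    ‖iteratedFDeriv ℝ n f x‖ ≤ ∑ s : Fin n → Fin d, |listDeriv (List.ofFn s) f x| := by
  refine (norm_multilinear_le_sum _).trans_eq (Finset.sum_congr rfl fun s _ => ?_)
  rw [iteratedFDeriv_apply_basis hf]

/-! ### Integration by parts on the torus -/

theorem integrable_torus_of_continuous (hL : 0 < L) {f : Pt d → ℝ} (hf : Continuous f)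
    (hfp : IsTorusPeriodic L f) : Integrable f (torusVolume d L) := by
  have := isFiniteMeasure_torusVolume (d := d) hL
  obtain ⟨C, hC⟩ := hfp.exists_bound hL hf
  exact Integrable.of_bound hf.aestronglyMeasurable C (ae_of_all _ hC)

theorem memTorusL1_of_continuous (hL : 0 < L) {f : Pt d → ℝ} (hf : Continuous f)
    (hfp : IsTorusPeriodic L f) : MemTorusL1 L f :=
  ⟨hfp, integrable_torus_of_continuous hL hf hfp⟩

/-- The integral of f(x + s e_i) over the torus does not depend on s; differentiate at s = 0. -/
theorem integral_partialDeriv_eq_zero (hL : 0 < L) {f : Pt d → ℝ} (hf : ContDiff ℝ ∞ f)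
    (hfp : IsTorusPeriodic L f) (i : Fin d) : ∫ x, partialDeriv i f x ∂torusVolume d L = 0 := by
  have := isFiniteMeasure_torusVolume (d := d) hL
  have hp := contDiff_partialDeriv hf i
  obtain ⟨C, hC⟩ := (hfp.partialDeriv i).exists_bound hL hp.continuous
  set e : Pt d := EuclideanSpace.single i 1 with he
  have hderiv : ∀ (x : Pt d) (s : ℝ), HasDerivAt (fun s : ℝ => f (x + s • e))
      (partialDeriv i f (x + s • e)) s := by
    intro x s
    have h1 : HasDerivAt (fun s : ℝ => x + s • e) e s := by
      simpa using ((hasDerivAt_id s).smul_const e).const_add x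
    exact (hf.differentiable (by simp) (x + s • e)).hasFDerivAt.comp_hasDerivAt s h1
  have h := (hasDerivAt_integral_of_dominated_loc_of_deriv_le (μ := torusVolume d L) (x₀ := (0 : ℝ))
    (F := fun s x => f (x + s • e)) (F' := fun s x => partialDeriv i f (x + s • e))
    (bound := fun _ => C) Filter.univ_mem
    (Filter.Eventually.of_forall fun s =>
      (hf.continuous.comp (continuous_add_const (s • e))).aestronglyMeasurable)
    (by simpa using integrable_torus_of_continuous hL hf.continuous hfp)
    (by simpa using hp.continuous.aestronglyMeasurable)
    (ae_of_all _ fun x s _ => hC _) (integrable_const _) (ae_of_all _ fun x s _ => hderiv x s)).2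
  have hconst : (fun s : ℝ => ∫ x, f (x + s • e) ∂torusVolume d L) =
      fun _ => ∫ x, f x ∂torusVolume d L :=
    funext fun s => integral_torus_add hL _ hfp
  rw [hconst] at h
  simpa using h.unique (hasDerivAt_const (0 : ℝ) _)

theorem integral_mul_partialDeriv (hL : 0 < L) {f φ : Pt d → ℝ} (hf : ContDiff ℝ ∞ f)
    (hfp : IsTorusPeriodic L f) (hφ : ContDiff ℝ ∞ φ) (hφp : IsTorusPeriodic L φ) (i : Fin d) :
    ∫ x, f x * partialDeriv i φ x ∂torusVolume d L =
      -∫ x, partialDeriv i f x * φ x ∂torusVolume d L := by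
  have h := integral_partialDeriv_eq_zero hL (hf.mul hφ) (hfp.comp₂ hφp fun a b => a * b) i
  have h1 : ∀ x, partialDeriv i (fun x => f x * φ x) x =
      f x * partialDeriv i φ x + partialDeriv i f x * φ x := by
    intro x
    simp only [partialDeriv]
    rw [fderiv_fun_mul (hf.differentiable (by simp) x) (hφ.differentiable (by simp) x)]
    simp [mul_comm]
  simp only [h1] at h
  rw [integral_add] at h
  · linarith
  · exact integrable_torus_of_continuous hL (hf.continuous.mul (contDiff_partialDeriv hφ i).continuous)
      (hfp.comp₂ (hφp.partialDeriv i) fun a b => a * b)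
  · exact integrable_torus_of_continuous hL ((contDiff_partialDeriv hf i).continuous.mul hφ.continuous)
      ((hfp.partialDeriv i).comp₂ hφp fun a b => a * b)

theorem integral_mul_listDeriv (hL : 0 < L) {φ : Pt d → ℝ} (hφ : ContDiff ℝ ∞ φ)
    (hφp : IsTorusPeriodic L φ) (l : List (Fin d)) : ∀ {f : Pt d → ℝ}, ContDiff ℝ ∞ f →
    IsTorusPeriodic L f → ∫ x, f x * listDeriv l φ x ∂torusVolume d L =
      (-1) ^ l.length * ∫ x, listDeriv l f x * φ x ∂torusVolume d L := by
  induction l with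
  | nil => intro f hf hfp; simp [listDeriv]
  | cons i l ih =>
    intro f hf hfp
    have h1 := integral_mul_partialDeriv hL hf hfp (contDiff_listDeriv hφ l) (hφp.listDeriv l) i
    have h2 := ih (contDiff_partialDeriv hf i) (hfp.partialDeriv i)
    -- Integration by parts puts the outermost derivative of φ innermost on f, so the order has to
    -- be restored by symmetry.
    have h3 : listDeriv l (partialDeriv i f) = listDeriv (i :: l) f := by
      rw [listDeriv_perm (List.perm_append_singleton i l).symm hf]
      simp [listDeriv]
    change ∫ x, f x * partialDeriv i (listDeriv l φ) x ∂torusVolume d L = _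
    rw [h1, h2, h3, List.length_cons, pow_succ]
    ring

theorem integral_mul_multiDeriv (hL : 0 < L) {f φ : Pt d → ℝ} (hf : ContDiff ℝ ∞ f)
    (hfp : IsTorusPeriodic L f) (hφ : ContDiff ℝ ∞ φ) (hφp : IsTorusPeriodic L φ)
    (α : Fin d → ℕ) : ∫ x, f x * multiDeriv α φ x ∂torusVolume d L =
      (-1) ^ (∑ i, α i) * ∫ x, multiDeriv α f x * φ x ∂torusVolume d L := by
  rw [multiDeriv_eq_listDeriv, multiDeriv_eq_listDeriv, integral_mul_listDeriv hL hφ hφp _ hf hfp,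
    length_multiIndexList]

/-! ### Derivatives of averages -/

theorem partialDeriv_average (ρ : Measure (Pt d)) [IsProbabilityMeasure ρ] (hL : 0 < L)
    {f : Pt d → ℝ} (hf : ContDiff ℝ ∞ f) (hfp : IsTorusPeriodic L f) (i : Fin d) :
    partialDeriv i (average ρ f) = average ρ (partialDeriv i f) := by
  ext x
  simp only [partialDeriv]
  rw [fderiv_average hL hf hfp]
  exact ContinuousLinearMap.integral_apply (integrable_sub_of_continuous hL
    (hf.continuous_fderiv (by simp)) hfp.fderiv x) _

theorem multiDeriv_average (ρ : Measure (Pt d)) [IsProbabilityMeasure ρ] (hL : 0 < L)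
    {f : Pt d → ℝ} (hf : ContDiff ℝ ∞ f) (hfp : IsTorusPeriodic L f) (α : Fin d → ℕ) :
    multiDeriv α (average ρ f) = average ρ (multiDeriv α f) := by
  simp only [multiDeriv_eq_listDeriv]
  induction multiIndexList α with
  | nil => rfl
  | cons i l ih =>
    change partialDeriv i (listDeriv l (average ρ f)) = average ρ (partialDeriv i (listDeriv l f))
    rw [ih, partialDeriv_average ρ hL (contDiff_listDeriv hf l) (hfp.listDeriv l)]

/-- Mollification commutes with weak derivatives. -/
theorem IsWeakDeriv.multiDeriv_average_ae {ρ : Measure (Pt d)} [IsProbabilityMeasure ρ]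
    (hL : 0 < L) (hρ : ∀ u : Pt d → ℝ, MemTorusL1 L u → ContDiff ℝ ∞ (average ρ u))
    {α : Fin d → ℕ} {u g : Pt d → ℝ} (h : IsWeakDeriv L α u g) :
    multiDeriv α (average ρ u) =ᵐ[torusVolume d L] average ρ g := by
  obtain ⟨hu, hg, hug⟩ := h
  have := isProbabilityMeasure_map_neg (ρ := ρ)
  have hw := hρ u hu
  have hwp := hu.1.average ρ
  have hG := hρ g hg
  have hGp := hg.1.average ρ
  have hD := contDiff_multiDeriv hw α
  have hDp := hwp.multiDeriv α
  -- Shift the average onto the test function, where it commutes with D^α, apply the definition of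
  -- the weak derivative, and shift it back.
  have key : ∀ φ : Pt d → ℝ, ContDiff ℝ ∞ φ → IsTorusPeriodic L φ →
      ∫ x, multiDeriv α (average ρ u) x * φ x ∂torusVolume d L =
        ∫ x, average ρ g x * φ x ∂torusVolume d L := by
    intro φ hφ hφp
    have h1 := integral_mul_multiDeriv hL hw hwp hφ hφp α
    rw [integral_average_mul hL hu (contDiff_multiDeriv hφ α).continuous (hφp.multiDeriv α),
      ← multiDeriv_average _ hL hφ hφp, hug _ (contDiff_average hL hφ hφp) (hφp.average _),
      ← integral_average_mul hL hg hφ.continuous hφp] at h1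
    exact (mul_left_cancel₀ (pow_ne_zero _ (by norm_num)) h1).symm
  -- Both sides are smooth, so their difference is itself an admissible test function; its square
  -- has integral zero.
  have hφ := hD.sub hG
  have hφp : IsTorusPeriodic L (multiDeriv α (average ρ u) - average ρ g) :=
    hDp.comp₂ hGp fun a b => a - b
  have h2 := key _ hφ hφp
  have hi1 := integrable_torus_of_continuous hL (hD.continuous.mul hφ.continuous)
    (hDp.comp₂ hφp fun a b => a * b)
  have hi2 := integrable_torus_of_continuous hL (hG.continuous.mul hφ.continuous)
    (hGp.comp₂ hφp fun a b => a * b)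
  have h3 : ∫ x, (multiDeriv α (average ρ u) x - average ρ g x) ^ 2 ∂torusVolume d L = 0 := by
    have h4 := integral_sub hi1 hi2
    simp only [Pi.mul_apply] at h2 h4
    rw [h2, sub_self] at h4
    rw [← h4]
    refine integral_congr_ae (ae_of_all _ fun x => ?_)
    simp only
    ring
  have h5 := (integral_eq_zero_iff_of_nonneg (fun x => sq_nonneg _)
    (integrable_torus_of_continuous hL ((hD.continuous.sub hG.continuous).pow 2)
      (hφp.comp fun a => a ^ 2))).1 h3
  filter_upwards [h5] with x hx
  have hx : (multiDeriv α (average ρ u) x - average ρ g x) ^ 2 = 0 := hx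
  exact sub_eq_zero.1 (pow_eq_zero_iff (two_ne_zero) |>.1 hx)

theorem eLpNorm_multiDeriv_average_le {ρ : Measure (Pt d)} [IsProbabilityMeasure ρ]
    (hL : 0 < L) (hρ : ∀ u : Pt d → ℝ, MemTorusL1 L u → ContDiff ℝ ∞ (average ρ u))
    (α : Fin d → ℕ) (u : Pt d → ℝ) {q : ℝ≥0∞} (hq : 1 ≤ q) :
    eLpNorm (multiDeriv α (average ρ u)) q (torusVolume d L) ≤ weakDerivNorm L α q u := by
  refine le_iInf₂ fun g hg => ?_
  rw [eLpNorm_congr_ae (hg.multiDeriv_average_ae hL hρ)]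
  exact eLpNorm_average_le hL hg.2.1.1 hg.2.1.2.1 hq

theorem weakDerivNorm_le_sobolevNorm {α : Fin d → ℕ} {j : ℕ} (hα : ∑ i, α i ≤ j) {q : ℝ≥0∞}
    (hq : 1 ≤ q) (u : Pt d → ℝ) : weakDerivNorm L α q u ≤ sobolevNorm L j q u := by
  rw [sobolevNorm]
  split_ifs with h
  · subst h
    exact Finset.le_sup (f := fun α => weakDerivNorm L α ⊤ u) (mem_multiIndices.2 hα)
  · have hq0 : 0 < q.toReal := ENNReal.toReal_pos (zero_lt_one.trans_le hq).ne' h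
    calc weakDerivNorm L α q u = (weakDerivNorm L α q u ^ q.toReal) ^ (1 / q.toReal) := by
          rw [← ENNReal.rpow_mul, mul_one_div_cancel hq0.ne', ENNReal.rpow_one]
      _ ≤ _ := by
        refine ENNReal.rpow_le_rpow ?_ (by positivity)
        exact Finset.single_le_sum (f := fun α => weakDerivNorm L α q u ^ q.toReal)
          (fun _ _ => zero_le) (mem_multiIndices.2 hα)

/-- The number of iterated partial derivatives of order at most `j`. -/
def partialCount (d j : ℕ) : ℕ := ∑ i ∈ Finset.range (j + 1), d ^ i

/-- Mollification does not increase the Sobolev norms, up to a constant. -/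
theorem eLpNorm_derivSum_average_le_sobolevNorm {ρ : Measure (Pt d)} [IsProbabilityMeasure ρ]
    (hL : 0 < L) (hρ : ∀ u : Pt d → ℝ, MemTorusL1 L u → ContDiff ℝ ∞ (average ρ u))
    {u : Pt d → ℝ} (hu : MemTorusL1 L u) (j : ℕ) {q : ℝ≥0∞} (hq : 1 ≤ q) :
    eLpNorm (derivSum j (average ρ u)) q (torusVolume d L) ≤
      partialCount d j * sobolevNorm L j q u := by
  have hw := hρ u hu
  have h1 : ∀ x, ‖derivSum j (average ρ u) x‖ ≤ (∑ i ∈ Finset.range (j + 1),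
      ∑ s : Fin i → Fin d, fun x => |listDeriv (List.ofFn s) (average ρ u) x|) x := by
    intro x
    rw [Real.norm_of_nonneg (derivSum_nonneg _ _ _)]
    simp only [Finset.sum_apply]
    exact Finset.sum_le_sum fun i _ => norm_iteratedFDeriv_le_sum hw i x
  have hc : ∀ l, AEStronglyMeasurable (fun x => |listDeriv l (average ρ u) x|)
      (torusVolume d L) := fun l => (contDiff_listDeriv hw l).continuous.abs.aestronglyMeasurable
  refine (eLpNorm_mono_real h1).trans ?_
  refine (eLpNorm_sum_le (fun i _ => Finset.aestronglyMeasurable_sum _ fun s _ => hc _) hq).trans ?_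
  rw [partialCount, Nat.cast_sum, Finset.sum_mul]
  refine Finset.sum_le_sum fun i hi => ?_
  refine (eLpNorm_sum_le (fun s _ => hc _) hq).trans ?_
  calc ∑ s : Fin i → Fin d, eLpNorm (fun x => |listDeriv (List.ofFn s) (average ρ u) x|) q
        (torusVolume d L) ≤ ∑ s : Fin i → Fin d, sobolevNorm L j q u := by
        refine Finset.sum_le_sum fun s _ => ?_
        have h2 := eLpNorm_norm (listDeriv (List.ofFn s) (average ρ u)) (p := q)
          (μ := torusVolume d L)
        simp only [Real.norm_eq_abs] at h2
        rw [h2, ← multiDeriv_count _ hw]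
        refine (eLpNorm_multiDeriv_average_le hL hρ _ u hq).trans
          (weakDerivNorm_le_sobolevNorm ?_ hq u)
        rw [sum_count_eq_length, List.length_ofFn]
        simpa [Nat.lt_succ_iff] using hi
    _ = _ := by simp

end

end RandomSplitting

namespace RandomSplitting

open Filter Topology

/-! ### Mollifiers -/

section

variable {d : ℕ} {L : ℝ}

/-- Translate the cell so that its centre lies at x: the result is a fundamental domain and a
neighbourhood of x. -/
theorem MemTorusL1.locallyIntegrable (hL : 0 < L) {u : Pt d → ℝ} (hu : MemTorusL1 L u) :
    LocallyIntegrable u volume := by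
  intro x
  set c : Pt d := WithLp.toLp 2 fun _ => L / 2 with hc
  have hY := isTorusMap_add_const (d := d) L (c - x)
  have hD := isAddFundamentalDomain_cell (d := d) hL
  have hq := measurePreserving_add_right (volume : Measure (Pt d)) (c - x)
  have hD' : IsAddFundamentalDomain (torusLattice d hL) ((fun z => z + (c - x)) ⁻¹' cell d L)
      (volume : Measure (Pt d)) :=
    hD.preimage_of_equiv hq.quasiMeasurePreserving (e := id) Function.bijective_id
      fun g z => hY.vadd hL g z
  refine ⟨(fun z => z + (c - x)) ⁻¹' cell d L, ?_,
    (hD.integrableOn_iff hD' fun g z => hu.1.vadd hL g z).1 hu.2⟩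
  have hcell : cell d L ∈ 𝓝 c := by
    have hopen : IsOpen {z : Pt d | ∀ i, z i ∈ Ioo 0 L} := by
      simp only [ofPred_forall]
      exact isOpen_iInter_of_finite fun i => isOpen_Ioo.preimage (by fun_prop)
    refine mem_of_superset (hopen.mem_nhds fun i => ?_) fun z hz i => Ioo_subset_Ico_self (hz i)
    simp only [hc, mem_Ioo]
    constructor <;> linarith
  have hcont : Continuous fun z : Pt d => z + (c - x) := by fun_prop
  exact hcont.continuousAt.preimage_mem_nhds (by simpa using hcell)

/-- Normalized bump functions with shrinking support; convergence almost everywhere is Lebesgue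
differentiation, which requires a bounded ratio of outer to inner radius, here 2. -/
theorem exists_mollifier_ae (d : ℕ) {L : ℝ} (hL : 0 < L) : ∃ ρ : ℕ → Measure (Pt d),
    (∀ n, IsProbabilityMeasure (ρ n)) ∧
    (∀ n u, MemTorusL1 L u → ContDiff ℝ ∞ (average (ρ n) u)) ∧
    ∀ u, MemTorusL1 L u →
      ∀ᵐ x ∂torusVolume d L, Tendsto (fun n => average (ρ n) u x) atTop (𝓝 (u x)) := by
  let φ : ℕ → ContDiffBump (0 : Pt d) := fun n =>
    ⟨1 / ((n : ℝ) + 1), 2 * (1 / ((n : ℝ) + 1)), by positivity,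
      by have : 0 < 1 / ((n : ℝ) + 1) := by positivity
         linarith⟩
  have hconv : ∀ n (u : Pt d → ℝ),
      average (volume.withDensity fun y => ENNReal.ofReal ((φ n).normed volume y)) u =
        convolution ((φ n).normed volume) u (ContinuousLinearMap.lsmul ℝ ℝ) volume := by
    intro n u
    ext x
    simp only [average, convolution_def]
    rw [integral_withDensity_eq_integral_toReal_smul
      (φ n).continuous_normed.measurable.ennreal_ofReal
      (ae_of_all _ fun _ => ENNReal.ofReal_lt_top)]
    refine integral_congr_ae (ae_of_all _ fun y => ?_)
    simp only [ENNReal.toReal_ofReal ((φ n).nonneg_normed y), ContinuousLinearMap.lsmul_apply]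
  refine ⟨fun n => volume.withDensity fun y => ENNReal.ofReal ((φ n).normed volume y),
    fun n => ⟨?_⟩, fun n u hu => ?_, fun u hu => ?_⟩
  · rw [withDensity_apply _ MeasurableSet.univ, Measure.restrict_univ,
      ← ofReal_integral_eq_lintegral_ofReal (φ n).integrable_normed
        (ae_of_all _ (φ n).nonneg_normed), (φ n).integral_normed, ENNReal.ofReal_one]
  · rw [hconv]
    exact (φ n).hasCompactSupport_normed.contDiff_convolution_left _ (φ n).contDiff_normed
      (hu.locallyIntegrable hL)
  · simp only [hconv]
    refine (torusVolume_absolutelyContinuous d L).ae_le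
      (ContDiffBump.ae_convolution_tendsto_right_of_locallyIntegrable (K := 2) ?_ ?_
        (hu.locallyIntegrable hL))
    · have h := (tendsto_one_div_add_atTop_nhds_zero_nat (𝕜 := ℝ)).const_mul 2
      rwa [mul_zero] at h
    · exact Eventually.of_forall fun n => le_rfl

theorem tendsto_eLpNorm_one_sub {μ : Measure (Pt d)} {F : ℕ → Pt d → ℝ} {f bound : Pt d → ℝ}
    (hF : ∀ n, AEStronglyMeasurable (F n) μ) (hb : Integrable bound μ)
    (hFb : ∀ n, ∀ᵐ x ∂μ, ‖F n x‖ ≤ bound x)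
    (hlim : ∀ᵐ x ∂μ, Tendsto (fun n => F n x) atTop (𝓝 (f x))) :
    Tendsto (fun n => eLpNorm (fun x => F n x - f x) 1 μ) atTop (𝓝 0) := by
  have h := tendsto_lintegral_norm_of_dominated_convergence hF hb.2 hFb hlim
  simpa only [eLpNorm_one_eq_lintegral_enorm, ofReal_norm] using h

/-- Truncation of a real number to the interval `[-R, R]`. -/
def clamp (R z : ℝ) : ℝ := max (-R) (min z R)

theorem abs_clamp_le {R : ℝ} (hR : 0 ≤ R) (z : ℝ) : |clamp R z| ≤ R :=
  abs_le.2 ⟨le_max_left _ _, max_le (by linarith) (min_le_right _ _)⟩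

theorem abs_clamp_le_abs {R : ℝ} (hR : 0 ≤ R) (z : ℝ) : |clamp R z| ≤ |z| := by
  refine abs_le.2 ⟨?_, max_le (by linarith [abs_nonneg z]) ((min_le_left _ _).trans (le_abs_self z))⟩
  refine le_max_of_le_right (le_min (neg_abs_le z) (by linarith [abs_nonneg z]))

theorem clamp_eq_self {R z : ℝ} (h : |z| ≤ R) : clamp R z = z := by
  obtain ⟨h1, h2⟩ := abs_le.1 h
  rw [clamp, min_eq_left h2, max_eq_right h1]

theorem continuous_clamp (R : ℝ) : Continuous (clamp R) := by
  unfold clamp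
  fun_prop

/-- There are arbitrarily good smooth mollifications in `L¹(𝕋^d)`. -/
theorem exists_mollifier (hL : 0 < L) {u : Pt d → ℝ} (hu : MemTorusL1 L u) {δ : ℝ≥0∞}
    (hδ : δ ≠ 0) : ∃ ρ : Measure (Pt d), IsProbabilityMeasure ρ ∧
      (∀ u : Pt d → ℝ, MemTorusL1 L u → ContDiff ℝ ∞ (average ρ u)) ∧
      eLpNorm (fun x => average ρ u x - u x) 1 (torusVolume d L) ≤ δ := by
  have := isFiniteMeasure_torusVolume (d := d) hL
  obtain ⟨ρ, hρ, hsm, hae⟩ := exists_mollifier_ae d hL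
  have hδ3 : 0 < δ / 3 := ENNReal.div_pos hδ (by simp)
  have hcm : ∀ R : ℕ, AEStronglyMeasurable (fun x => clamp R (u x)) (torusVolume d L) :=
    fun R => (continuous_clamp R).comp_aestronglyMeasurable hu.2.1
  -- Almost everywhere convergence of mollifications gives `L¹` convergence only under domination.
  -- Truncation at R supplies it, and the truncation error is not increased by averaging; three
  -- errors of δ / 3 result.
  have hclamp : Tendsto (fun R : ℕ => eLpNorm (fun x => clamp R (u x) - u x) 1 (torusVolume d L))
      atTop (𝓝 0) := by
    refine tendsto_eLpNorm_one_sub hcm hu.2.norm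
      (fun R => ae_of_all _ fun x => abs_clamp_le_abs (Nat.cast_nonneg R) _)
      (ae_of_all _ fun x => ?_)
    refine tendsto_const_nhds.congr' ?_
    filter_upwards [eventually_ge_atTop ⌈|u x|⌉₊] with R hR
    exact (clamp_eq_self ((Nat.le_ceil _).trans (by exact_mod_cast hR))).symm
  obtain ⟨R, hR⟩ := (hclamp.eventually (ge_mem_nhds hδ3)).exists
  set uR : Pt d → ℝ := fun x => clamp R (u x) with huR
  have huRL : MemTorusL1 L uR := ⟨hu.1.comp (clamp R), hu.2.mono (hcm R)
    (ae_of_all _ fun x => abs_clamp_le_abs (Nat.cast_nonneg R) _)⟩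
  have hconv : Tendsto (fun n => eLpNorm (fun x => average (ρ n) uR x - uR x) 1
      (torusVolume d L)) atTop (𝓝 0) := by
    refine tendsto_eLpNorm_one_sub (bound := fun _ => R)
      (fun n => (hsm n uR huRL).continuous.aestronglyMeasurable) (integrable_const _)
      (fun n => ae_of_all _ fun x => ?_) (hae uR huRL)
    have := hρ n
    have h := norm_integral_le_of_norm_le_const (μ := ρ n) (f := fun y => uR (x - y)) (C := R)
      (ae_of_all _ fun y => abs_clamp_le (Nat.cast_nonneg R) _)
    rwa [probReal_univ, mul_one] at h
  obtain ⟨n, hn⟩ := (hconv.eventually (ge_mem_nhds hδ3)).exists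
  have := hρ n
  refine ⟨ρ n, hρ n, hsm n, ?_⟩
  have h1 := eLpNorm_average_sub_le (ρ := ρ n) hL hu huRL
  have h2 : (fun x => average (ρ n) u x - u x) =
      (fun x => average (ρ n) u x - average (ρ n) uR x) +
        ((fun x => average (ρ n) uR x - uR x) + fun x => uR x - u x) := by
    ext x
    simp only [Pi.add_apply]
    ring
  have hA := (hu.average (ρ n) hL).2.1
  have hAR := (huRL.average (ρ n) hL).2.1
  rw [h2]
  refine (eLpNorm_add_le (hA.sub hAR) ((hAR.sub huRL.2.1).add (huRL.2.1.sub hu.2.1)) le_rfl).trans ?_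
  refine (add_le_add_right (eLpNorm_add_le (hAR.sub huRL.2.1) (huRL.2.1.sub hu.2.1) le_rfl) _).trans ?_
  have h3 : eLpNorm (fun x => u x - uR x) 1 (torusVolume d L) =
      eLpNorm (fun x => uR x - u x) 1 (torusVolume d L) := eLpNorm_sub_comm u uR 1 _
  calc _ ≤ δ / 3 + (δ / 3 + δ / 3) := add_le_add ((h1.trans_eq h3).trans hR) (add_le_add hn hR)
    _ = δ := by rw [← add_assoc, ENNReal.add_thirds]

end

/-! ### Nested convex sets in Hilbert spaces -/

/-- A substitute for weak compactness. The elements of minimal norm have increasing bounded norms,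
and the parallelogram law makes them a Cauchy sequence. -/
theorem exists_mem_of_antitone_convex {H : Type*} [NormedAddCommGroup H] [InnerProductSpace ℝ H]
    [CompleteSpace H] {C : ℕ → Set H} (hanti : Antitone C) (hne : ∀ n, (C n).Nonempty)
    (hcl : ∀ n, IsClosed (C n)) (hcv : ∀ n, Convex ℝ (C n)) {R : ℝ}
    (hR : ∀ n, ∀ x ∈ C n, ‖x‖ ≤ R) : ∃ x, ∀ n, x ∈ C n := by
  have hmin : ∀ n, ∃ x ∈ C n, ∀ y ∈ C n, ‖x‖ ≤ ‖y‖ := by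
    intro n
    obtain ⟨x, hx, hxm⟩ := exists_norm_eq_iInf_of_complete_convex (hne n) (hcl n).isComplete
      (hcv n) 0
    refine ⟨x, hx, fun y hy => ?_⟩
    rw [zero_sub, norm_neg] at hxm
    rw [hxm]
    refine (ciInf_le ⟨0, by rintro _ ⟨w, rfl⟩; positivity⟩ (⟨y, hy⟩ : C n)).trans_eq ?_
    simp
  choose x hx hxm using hmin
  have hmono : Monotone fun n => ‖x n‖ ^ 2 := fun n m hnm => by
    have := hxm n (x m) (hanti hnm (hx m))
    simp only
    gcongr
  have hbdd : BddAbove (range fun n => ‖x n‖ ^ 2) := by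
    refine ⟨R ^ 2, ?_⟩
    rintro _ ⟨n, rfl⟩
    have := hR n _ (hx n)
    simp only
    gcongr
  have hlim := tendsto_atTop_ciSup hmono hbdd
  set l := ⨆ n, ‖x n‖ ^ 2
  have hdist : ∀ n m, n ≤ m → dist (x n) (x m) ^ 2 ≤ 2 * (l - ‖x n‖ ^ 2) := by
    intro n m hnm
    -- By convexity the midpoint lies in `C n`, so its norm is at least the minimum.
    have h1 : (1 / 2 : ℝ) • x n + (1 / 2 : ℝ) • x m ∈ C n :=
      hcv n (hx n) (hanti hnm (hx m)) (by norm_num) (by norm_num) (by norm_num)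
    have h2 := hxm n _ h1
    rw [← smul_add, norm_smul, Real.norm_of_nonneg (by norm_num)] at h2
    have h3 := parallelogram_law_with_norm ℝ (x n) (x m)
    have h4 : ‖x m‖ ^ 2 ≤ l := le_ciSup hbdd m
    rw [dist_eq_norm]
    nlinarith [norm_nonneg (x n), norm_nonneg (x n + x m)]
  have hcauchy : CauchySeq x := by
    refine cauchySeq_of_le_tendsto_0 (fun N => Real.sqrt (2 * (l - ‖x N‖ ^ 2))) ?_ ?_
    · have key : ∀ n m N, N ≤ n → n ≤ m →
          dist (x n) (x m) ≤ Real.sqrt (2 * (l - ‖x N‖ ^ 2)) := by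
        intro n m N hn hnm
        refine Real.le_sqrt_of_sq_le ((hdist n m hnm).trans ?_)
        have := hmono hn
        simp only at this
        linarith
      intro n m N hn hm
      rcases le_total n m with h | h
      · exact key n m N hn h
      · rw [dist_comm]
        exact key m n N hm h
    · have h1 : Tendsto (fun N => 2 * (l - ‖x N‖ ^ 2)) atTop (𝓝 (2 * (l - l))) :=
        (tendsto_const_nhds.sub hlim).const_mul 2
      simpa using h1.sqrt
  obtain ⟨a, ha⟩ := cauchySeq_tendsto_of_complete hcauchy
  refine ⟨a, fun n => (hcl n).mem_of_tendsto ha ?_⟩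
  filter_upwards [eventually_ge_atTop n] with m hm
  exact hanti hm (hx m)

/-! ### Lower semicontinuity of the Sobolev norms -/

section

variable {d : ℕ} {L : ℝ}

theorem convex_eLpNorm_le {μ : Measure (Pt d)} {p : ℝ≥0∞} (hp : 1 ≤ p) (B : ℝ≥0∞) :
    Convex ℝ {h : Lp ℝ 2 μ | eLpNorm h p μ ≤ B} := by
  intro f hf g hg a b ha hb hab
  have h1 : eLpNorm (a • f + b • g : Lp ℝ 2 μ) p μ =
      eLpNorm (a • (f : Pt d → ℝ) + b • (g : Pt d → ℝ)) p μ := by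
    refine eLpNorm_congr_ae ((Lp.coeFn_add _ _).trans ?_)
    filter_upwards [Lp.coeFn_smul a f, Lp.coeFn_smul b g] with x h1 h2
    simp only [Pi.add_apply, h1, h2]
  change eLpNorm (a • f + b • g : Lp ℝ 2 μ) p μ ≤ B
  rw [h1]
  refine (eLpNorm_add_le ((Lp.aestronglyMeasurable f).const_smul a)
    ((Lp.aestronglyMeasurable g).const_smul b) hp).trans ?_
  rw [eLpNorm_const_smul, eLpNorm_const_smul, Real.enorm_eq_ofReal ha, Real.enorm_eq_ofReal hb]
  calc _ ≤ ENNReal.ofReal a * B + ENNReal.ofReal b * B := by gcongr <;> assumption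
    _ = B := by rw [← add_mul, ← ENNReal.ofReal_add ha hb, hab, ENNReal.ofReal_one, one_mul]

/-- An `L²` convergent sequence has an almost everywhere convergent subsequence, to which Fatou
applies. -/
theorem isClosed_eLpNorm_le {μ : Measure (Pt d)} (p B : ℝ≥0∞) :
    IsClosed {h : Lp ℝ 2 μ | eLpNorm h p μ ≤ B} := by
  refine IsSeqClosed.isClosed fun f g hf hfg => ?_
  obtain ⟨ns, -, hns⟩ := (tendstoInMeasure_of_tendsto_Lp hfg).exists_seq_tendsto_ae
  refine (Lp.eLpNorm_lim_le_liminf_eLpNorm (fun n => Lp.aestronglyMeasurable (f (ns n))) _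
    hns).trans ?_
  exact liminf_le_of_le (by isBoundedDefault) fun b hb => by
    obtain ⟨n, hn⟩ := hb.exists
    exact hn.trans (hf _)

/-- On a finite measure space `L^p` embeds into `L²` for p ≥ 2; this places the limit argument in a
Hilbert space. -/
theorem norm_le_of_eLpNorm_le {μ : Measure (Pt d)} [IsFiniteMeasure μ] {p B : ℝ≥0∞} (hp : 2 ≤ p)
    (hB : B ≠ ⊤) : ∃ R : ℝ, ∀ h : Lp ℝ 2 μ, eLpNorm h p μ ≤ B → ‖h‖ ≤ R := by
  refine ⟨(B * μ univ ^ (1 / (2 : ℝ≥0∞).toReal - 1 / p.toReal)).toReal, fun h hh => ?_⟩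
  rw [Lp.norm_def]
  refine ENNReal.toReal_mono (ENNReal.mul_ne_top hB ?_)
    ((eLpNorm_le_eLpNorm_mul_rpow_measure_univ hp (Lp.aestronglyMeasurable h)).trans (by gcongr))
  refine ENNReal.rpow_ne_top_of_nonneg ?_ (measure_ne_top _ _)
  rcases eq_or_ne p ⊤ with rfl | hpt
  · simp
  · rw [sub_nonneg]
    exact one_div_le_one_div_of_le (by simp) (ENNReal.toReal_mono hpt hp)

theorem memLp_torus_of_continuous (hL : 0 < L) {f : Pt d → ℝ} (hf : Continuous f)
    (hfp : IsTorusPeriodic L f) (p : ℝ≥0∞) : MemLp f p (torusVolume d L) := by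
  have := isFiniteMeasure_torusVolume (d := d) hL
  obtain ⟨C, hC⟩ := hfp.exists_bound hL hf
  exact MemLp.of_bound hf.aestronglyMeasurable C (ae_of_all _ hC)

theorem abs_integral_mul_sub_le {u w ψ : Pt d → ℝ} (hu : MemTorusL1 L u)
    (hw : MemTorusL1 L w) (hψ : Continuous ψ) {C δ : ℝ} (hC : ∀ x, |ψ x| ≤ C) (hδ : 0 ≤ δ)
    (hwu : eLpNorm (fun x => w x - u x) 1 (torusVolume d L) ≤ ENNReal.ofReal δ) :
    |∫ x, w x * ψ x ∂torusVolume d L - ∫ x, u x * ψ x ∂torusVolume d L| ≤ C * δ := by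
  have hC0 : 0 ≤ C := (abs_nonneg _).trans (hC 0)
  have hi : ∀ {f : Pt d → ℝ}, Integrable f (torusVolume d L) →
      Integrable (fun x => f x * ψ x) (torusVolume d L) := fun hf =>
    hf.mul_bdd (c := C) hψ.aestronglyMeasurable (ae_of_all _ hC)
  rw [← integral_sub (hi hw.2) (hi hu.2), ← Real.norm_eq_abs]
  have hn : ∫ x, ‖w x - u x‖ ∂torusVolume d L ≤ δ := by
    rw [integral_norm_eq_lintegral_enorm (f := fun x => w x - u x) (hw.2.sub hu.2).1]
    refine ENNReal.toReal_le_of_le_ofReal hδ ?_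
    rwa [eLpNorm_one_eq_lintegral_enorm] at hwu
  calc ‖∫ x, (w x * ψ x - u x * ψ x) ∂torusVolume d L‖
      ≤ ∫ x, C * ‖w x - u x‖ ∂torusVolume d L := by
        refine norm_integral_le_of_norm_le ((hw.2.sub hu.2).norm.const_mul C)
          (ae_of_all _ fun x => ?_)
        rw [← sub_mul, norm_mul, mul_comm]
        gcongr
        exact hC x
    _ ≤ C * δ := by
        rw [integral_const_mul]
        gcongr

/-- Lower semicontinuity: if `u` is an `L¹` limit of smooth functions with `‖D^α w‖_p ≤ B`, then
`‖D^α u‖_p ≤ B`. -/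
theorem weakDerivNorm_le_of_approx (hL : 0 < L) {u : Pt d → ℝ} (hu : MemTorusL1 L u)
    {α : Fin d → ℕ} {p B : ℝ≥0∞} (hp : 2 ≤ p) (hB : B ≠ ⊤)
    (happ : ∀ δ : ℝ, 0 < δ → ∃ w : Pt d → ℝ, ContDiff ℝ ∞ w ∧ IsTorusPeriodic L w ∧
      eLpNorm (fun x => w x - u x) 1 (torusVolume d L) ≤ ENNReal.ofReal δ ∧
      eLpNorm (multiDeriv α w) p (torusVolume d L) ≤ B) :
    weakDerivNorm L α p u ≤ B := by
  have := isFiniteMeasure_torusVolume (d := d) hL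
  let ℓ : {φ : Pt d → ℝ // ContDiff ℝ ∞ φ ∧ IsTorusPeriodic L φ} → Lp ℝ 2 (torusVolume d L) :=
    fun φ => (memLp_torus_of_continuous hL φ.2.1.continuous φ.2.2 2).toLp φ.1
  have hℓ : ∀ φ (h : Lp ℝ 2 (torusVolume d L)), innerSL ℝ (ℓ φ) h =
      ∫ x, h x * φ.1 x ∂torusVolume d L := by
    intro φ h
    rw [innerSL_apply_apply, L2.inner_def]
    refine integral_congr_ae ?_
    filter_upwards [MemLp.coeFn_toLp (memLp_torus_of_continuous hL φ.2.1.continuous φ.2.2 2)]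
      with x hx
    simp only [ℓ, hx]
    simp
  -- Candidates for D^α u that satisfy the norm bound and the weak identity up to C / (n + 1), where
  -- C bounds D^α φ. These sets are closed, convex and decreasing, and contain D^α w for w close
  -- enough to u. A common point satisfies the identity exactly.
  let S : ℕ → Set (Lp ℝ 2 (torusVolume d L)) := fun n =>
    {h | eLpNorm h p (torusVolume d L) ≤ B} ∩ ⋂ φ, ⋂ (C : ℝ) (_ : ∀ x, |multiDeriv α φ.1 x| ≤ C),
      innerSL ℝ (ℓ φ) ⁻¹' Metric.closedBall
        ((-1) ^ (∑ i, α i) * ∫ x, u x * multiDeriv α φ.1 x ∂torusVolume d L) (C * (1 / ((n : ℝ) + 1)))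
  have hmemS : ∀ n h, h ∈ S n ↔ eLpNorm h p (torusVolume d L) ≤ B ∧
      ∀ (φ : {φ : Pt d → ℝ // ContDiff ℝ ∞ φ ∧ IsTorusPeriodic L φ}) (C : ℝ),
        (∀ x, |multiDeriv α φ.1 x| ≤ C) → dist (∫ x, h x * φ.1 x ∂torusVolume d L)
        ((-1) ^ (∑ i, α i) * ∫ x, u x * multiDeriv α φ.1 x ∂torusVolume d L) ≤
          C * (1 / ((n : ℝ) + 1)) := by
    intro n h
    simp only [S, mem_inter_iff, mem_ofPred_eq, mem_iInter, mem_preimage, Metric.mem_closedBall, hℓ]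
  obtain ⟨R, hR⟩ := norm_le_of_eLpNorm_le (μ := torusVolume d L) hp hB
  have hex : ∃ g, ∀ n, g ∈ S n := by
    refine exists_mem_of_antitone_convex (C := S) (R := R) ?_ ?_ ?_ ?_ ?_
    · intro n m hnm h hh
      rw [hmemS] at hh ⊢
      refine ⟨hh.1, fun φ C hC => (hh.2 φ C hC).trans ?_⟩
      have hC0 : 0 ≤ C := (abs_nonneg _).trans (hC 0)
      gcongr
    · intro n
      obtain ⟨w, hw, hwp, hwu, hwB⟩ := happ (1 / ((n : ℝ) + 1)) (by positivity)
      have hm := memLp_torus_of_continuous hL (contDiff_multiDeriv hw α).continuous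
        (hwp.multiDeriv α) 2
      refine ⟨hm.toLp _, (hmemS _ _).2 ⟨?_, fun φ C hC => ?_⟩⟩
      · rwa [eLpNorm_congr_ae hm.coeFn_toLp]
      · have h1 : ∫ x, hm.toLp _ x * φ.1 x ∂torusVolume d L =
            ∫ x, multiDeriv α w x * φ.1 x ∂torusVolume d L :=
          integral_congr_ae (by filter_upwards [hm.coeFn_toLp] with x hx; rw [hx])
        have h2 := integral_mul_multiDeriv hL hw hwp φ.2.1 φ.2.2 α
        have h3 : ∫ x, multiDeriv α w x * φ.1 x ∂torusVolume d L =
            (-1) ^ (∑ i, α i) * ∫ x, w x * multiDeriv α φ.1 x ∂torusVolume d L := by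
          rw [h2, ← mul_assoc, ← mul_pow]
          simp
        rw [h1, h3, Real.dist_eq, ← mul_sub, abs_mul, abs_pow, abs_neg, abs_one, one_pow, one_mul]
        exact abs_integral_mul_sub_le hu (memTorusL1_of_continuous hL hw.continuous hwp)
          (contDiff_multiDeriv φ.2.1 α).continuous hC (by positivity) hwu
    · intro n
      refine (isClosed_eLpNorm_le p B).inter (isClosed_iInter fun φ => isClosed_iInter fun C =>
        isClosed_iInter fun _ => Metric.isClosed_closedBall.preimage (innerSL ℝ (ℓ φ)).continuous)
    · intro n
      refine (convex_eLpNorm_le (le_trans (by norm_num) hp) B).inter (convex_iInter fun φ =>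
        convex_iInter fun C => convex_iInter fun _ => ?_)
      exact (convex_closedBall _ _).linear_preimage (innerSL ℝ (ℓ φ)).toLinearMap
    · intro n h hh
      exact hR h ((hmemS n h).1 hh).1
  obtain ⟨g, hg⟩ := hex
  simp only [hmemS] at hg
  obtain ⟨g', hg'p, hg'⟩ := exists_periodic_congr (d := d) hL (g : Pt d → ℝ)
  have hgg : g' =ᵐ[torusVolume d L] g :=
    ae_restrict_of_forall_mem (measurableSet_cell hL) hg'
  have hgi : Integrable g (torusVolume d L) := (Lp.memLp g).integrable (by norm_num)
  refine (iInf₂_le g' ⟨hu, ⟨hg'p, hgi.congr hgg.symm⟩, fun φ hφ hφp => ?_⟩).trans ?_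
  · rw [eLpNorm_congr_ae hgg]
    exact (hg 0).1
  · obtain ⟨C, hC⟩ := (hφp.multiDeriv α).exists_bound hL (contDiff_multiDeriv hφ α).continuous
    have h1 : dist (∫ x, g x * φ x ∂torusVolume d L)
        ((-1) ^ (∑ i, α i) * ∫ x, u x * multiDeriv α φ x ∂torusVolume d L) ≤ 0 := by
      have hlim := (tendsto_one_div_add_atTop_nhds_zero_nat (𝕜 := ℝ)).const_mul (C : ℝ)
      rw [mul_zero] at hlim
      exact ge_of_tendsto' hlim fun n => (hg n).2 ⟨φ, hφ, hφp⟩ C hC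
    have h2 : ∫ x, g' x * φ x ∂torusVolume d L = ∫ x, g x * φ x ∂torusVolume d L :=
      integral_congr_ae (by filter_upwards [hgg] with x hx; rw [hx])
    rw [h2, dist_le_zero.1 h1, ← mul_assoc, ← mul_pow]
    simp

end

end RandomSplitting

namespace RandomSplitting

open Filter Topology

/-! ### Smooth approximations with controlled Sobolev norms -/

section

variable {d : ℕ} {L : ℝ}

/-- Smooth functions on the torus whose derivatives up to order `j ≤ k` are bounded in `L^(P j)` by
`exp (c j * t) * b j`. -/
def SmoothBounded (L : ℝ) (k : ℕ) (P : ℕ → ℝ≥0∞) (c : ℕ → ℝ) (b : ℕ → ℝ≥0∞) (t : ℝ)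
    (w : Pt d → ℝ) : Prop :=
  ContDiff ℝ ∞ w ∧ IsTorusPeriodic L w ∧ ∀ j ≤ k,
    eLpNorm (derivSum j w) (P j) (torusVolume d L) ≤ ENNReal.ofReal (Real.exp (c j * t)) * b j

/-- The `L¹` closure of the set of functions with the bounds `SmoothBounded`. -/
def Approximable (L : ℝ) (k : ℕ) (P : ℕ → ℝ≥0∞) (c : ℕ → ℝ) (b : ℕ → ℝ≥0∞) (t : ℝ)
    (u : Pt d → ℝ) : Prop :=
  MemTorusL1 L u ∧ ∀ δ : ℝ, 0 < δ → ∃ w, SmoothBounded L k P c b t w ∧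
    eLpNorm (fun x => w x - u x) 1 (torusVolume d L) ≤ ENNReal.ofReal δ

variable {k : ℕ} {P : ℕ → ℝ≥0∞} {c : ℕ → ℝ} {b : ℕ → ℝ≥0∞} {t t' : ℝ}

/-- Reduces the analysis of `S` to smooth functions. The Lipschitz constant of `S` affects only how
accurately u has to be approximated, not the bounds carried by the class. -/
theorem Approximable.map (hL : 0 < L) {S : (Pt d → ℝ) → Pt d → ℝ} (hS : IsLipschitzTorusL1 L S)
    (h : ∀ w, SmoothBounded L k P c b t w → ∀ δ : ℝ, 0 < δ → ∃ w', SmoothBounded L k P c b t' w' ∧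
      eLpNorm (fun x => w' x - S w x) 1 (torusVolume d L) ≤ ENNReal.ofReal δ)
    {u : Pt d → ℝ} (hu : Approximable L k P c b t u) : Approximable L k P c b t' (S u) := by
  obtain ⟨hS1, C, hC⟩ := hS
  refine ⟨hS1 u hu.1, fun δ hδ => ?_⟩
  have hC0 : (0 : ℝ) ≤ C := C.coe_nonneg
  -- After amplification by C this error is still at most δ / 2; adding 1 covers C = 0.
  obtain ⟨w, hw, hwu⟩ := hu.2 (δ / (2 * (C + 1))) (by positivity)
  obtain ⟨w', hw', hww⟩ := h w hw (δ / 2) (by positivity)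
  have hwL := memTorusL1_of_continuous hL hw.1.continuous hw.2.1
  have hwL' := memTorusL1_of_continuous hL hw'.1.continuous hw'.2.1
  refine ⟨w', hw', ?_⟩
  have h1 : (fun x => w' x - S u x) = (fun x => w' x - S w x) + fun x => S w x - S u x := by
    ext x
    simp
  have h2 : eLpNorm (fun x => S w x - S u x) 1 (torusVolume d L) ≤ ENNReal.ofReal (δ / 2) := by
    calc _ ≤ C * ENNReal.ofReal (δ / (2 * (C + 1))) := (hC w u hwL hu.1).trans (by gcongr)
      _ = ENNReal.ofReal (C * (δ / (2 * (C + 1)))) := by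
        rw [ENNReal.ofReal_mul hC0, ENNReal.ofReal_coe_nnreal]
      _ ≤ _ := by
        refine ENNReal.ofReal_le_ofReal ?_
        rw [← mul_div_assoc, div_le_div_iff₀ (by positivity) (by positivity)]
        nlinarith
  rw [h1]
  refine (eLpNorm_add_le (hwL'.2.sub (hS1 w hwL).2).1 ((hS1 w hwL).2.sub (hS1 u hu.1).2).1
    le_rfl).trans ((add_le_add hww h2).trans_eq ?_)
  rw [← ENNReal.ofReal_add (by positivity) (by positivity), add_halves]

theorem SmoothBounded.mono (hc : ∀ j, 0 ≤ c j) (htt : t ≤ t') {w : Pt d → ℝ}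
    (hw : SmoothBounded L k P c b t w) : SmoothBounded L k P c b t' w := by
  refine ⟨hw.1, hw.2.1, fun j hj => (hw.2.2 j hj).trans ?_⟩
  have := hc j
  gcongr

theorem SmoothBounded.average (hL : 0 < L) (hP : ∀ j, 1 ≤ P j) (ρ : Measure (Pt d))
    [IsProbabilityMeasure ρ] {w : Pt d → ℝ} (hw : SmoothBounded L k P c b t w) :
    SmoothBounded L k P c b t (average ρ w) :=
  ⟨contDiff_average hL hw.1 hw.2.1, hw.2.1.average ρ, fun j hj =>
    (eLpNorm_derivSum_average_le hL hw.1 hw.2.1 j (hP j)).trans (hw.2.2 j hj)⟩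

theorem exp_mul_bound_le {a c t h : ℝ} (hac : a ≤ c) (h0 : 0 ≤ h) {x y b : ℝ≥0∞}
    (hx : x ≤ ENNReal.ofReal (Real.exp (a * h)) * y)
    (hy : y ≤ ENNReal.ofReal (Real.exp (c * t)) * b) :
    x ≤ ENNReal.ofReal (Real.exp (c * (t + h))) * b := by
  calc x ≤ ENNReal.ofReal (Real.exp (c * h)) * (ENNReal.ofReal (Real.exp (c * t)) * b) :=
        hx.trans (by gcongr)
    _ = _ := by
      rw [← mul_assoc, ← ENNReal.ofReal_mul (Real.exp_pos _).le, ← Real.exp_add]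
      congr 3
      ring

theorem exists_nat_step {τ η C δ : ℝ} (hη : 0 < η) (hδ : 0 < δ) :
    ∃ m : ℕ, 0 < m ∧ τ / m ≤ η ∧ C / m ≤ δ := by
  have h1 := (tendsto_const_div_atTop_nhds_zero_nat τ).eventually (ge_mem_nhds hη)
  have h2 := (tendsto_const_div_atTop_nhds_zero_nat C).eventually (ge_mem_nhds hδ)
  obtain ⟨m, ⟨h1, h2⟩, h3⟩ := ((h1.and h2).and (eventually_gt_atTop 0)).exists
  exact ⟨m, h3, h1, h2⟩

theorem eLpNorm_one_le_of_bound (hL : 0 < L) {f : Pt d → ℝ} {C : ℝ}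
    (hf : ∀ x, |f x| ≤ C) :
    eLpNorm f 1 (torusVolume d L) ≤ ENNReal.ofReal ((torusVolume d L).real univ * C) := by
  have := isFiniteMeasure_torusVolume (d := d) hL
  refine (eLpNorm_le_of_ae_bound (ae_of_all _ hf)).trans_eq ?_
  rw [ENNReal.ofReal_mul measureReal_nonneg, ofReal_measureReal]
  simp

/-! ### The three semigroups preserve the approximation class -/

theorem Approximable.heatSemigroup (hL : 0 < L) (hP : ∀ j, 1 ≤ P j) (hc : ∀ j, 0 ≤ c j)
    {ν τ : ℝ} (hν : 0 < ν) (hτ : 0 < τ) {u : Pt d → ℝ} (hu : Approximable L k P c b t u) :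
    Approximable L k P c b (t + τ) (heatSemigroup ν τ u) := by
  obtain ⟨ρ, hρ, hS⟩ := exists_heatSemigroup_eq_average d hν hτ
  rw [hS]
  refine hu.map hL (isLipschitzTorusL1_average hL ρ) fun w hw δ hδ =>
    ⟨_, (hw.average hL hP ρ).mono hc (by linarith), ?_⟩
  simp

theorem SmoothBounded.advectionStep_iterate {v : Pt d → Pt d} (hv : ContDiff ℝ ∞ v)
    (hvp : IsTorusPeriodic L v) {a : ℕ → ℝ} (hac : ∀ j, a j ≤ c j) {h : ℝ} (h0 : 0 ≤ h)
    (hstep : ∀ j, ∀ w : Pt d → ℝ, ContDiff ℝ ∞ w → IsTorusPeriodic L w → ∀ q : ℝ≥0∞, 1 ≤ q →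
        eLpNorm (derivSum j fun x => w (advectionStep v h x)) q (torusVolume d L) ≤
          ENNReal.ofReal (Real.exp (a j * h)) * eLpNorm (derivSum j w) q (torusVolume d L))
    (hP : ∀ j, 1 ≤ P j) {w : Pt d → ℝ} (hw : SmoothBounded L k P c b t w) (n : ℕ) :
    SmoothBounded L k P c b (t + n * h) (fun x => w ((advectionStep v h)^[n] x)) := by
  induction n with
  | zero => simpa using hw
  | succ n ih =>
    simp only [Function.iterate_succ_apply]
    refine ⟨ih.1.comp (contDiff_advectionStep hv h),
      ih.2.1.comp_torusMap (isTorusMap_advectionStep hvp h), fun j hj => ?_⟩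
    have h1 := exp_mul_bound_le (hac j) h0 (hstep j _ ih.1 ih.2.1 (P j) (hP j)) (ih.2.2 j hj)
    rwa [show t + n * h + h = t + ((n + 1 : ℕ) : ℝ) * h by push_cast; ring] at h1

/-- The number m of Euler steps depends on w and δ, but the accumulated factor exp (c_j τ) does not.
-/
theorem Approximable.advectionSemigroup (hL : 0 < L) {v : Pt d → Pt d} (hv : ContDiff ℝ ∞ v)
    (hvp : IsTorusPeriodic L v) {a : ℕ → ℝ} (hac : ∀ j, a j ≤ c j) {h₀ : ℝ} (hh₀ : 0 < h₀)
    (hstep : ∀ j, ∀ h, 0 ≤ h → h ≤ h₀ → ∀ w : Pt d → ℝ, ContDiff ℝ ∞ w → IsTorusPeriodic L w →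
      ∀ q : ℝ≥0∞, 1 ≤ q →
        eLpNorm (derivSum j fun x => w (advectionStep v h x)) q (torusVolume d L) ≤
          ENNReal.ofReal (Real.exp (a j * h)) * eLpNorm (derivSum j w) q (torusVolume d L))
    (hP : ∀ j, 1 ≤ P j) {τ : ℝ} (hτ : 0 < τ) {u : Pt d → ℝ} (hu : Approximable L k P c b t u) :
    Approximable L k P c b (t + τ) (advectionSemigroup v τ u) := by
  refine hu.map hL (isLipschitzTorusL1_advectionSemigroup hL hv hvp hτ.le) fun w hw δ hδ => ?_
  obtain ⟨C, hC0, hC⟩ := exists_advectionStep_iterate_sub_le hL hv hvp hw.1 hw.2.1 hτ.le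
  obtain ⟨m, hm, hmh, hmδ⟩ := exists_nat_step (τ := τ)
    (C := (torusVolume d L).real univ * C) hh₀ hδ
  have hm' : (0 : ℝ) < m := by exact_mod_cast hm
  have h0 : 0 ≤ τ / m := by positivity
  have hw' := hw.advectionStep_iterate hv hvp hac h0 (fun j => hstep j _ h0 hmh) hP m
  rw [mul_div_cancel₀ _ hm'.ne'] at hw'
  refine ⟨_, hw', (eLpNorm_one_le_of_bound hL (hC m hm)).trans ?_⟩
  rw [← mul_div_assoc]
  exact ENNReal.ofReal_le_ofReal hmδ

/-- For t ≤ Θ, the bound of order j in the class is at most A = exp (c_j Θ) β in `L^∞`, and `hcs`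
says that c_{j+1} dominates the reaction rate for this A. Only orders j < k are used as lower
orders, and exactly these are measured in `L^∞`. -/
theorem SmoothBounded.reactionStep (hPk : ∀ j < k, P j = ⊤) {β : ℝ≥0} (hb : ∀ j < k, b j = β)
    {Θ : ℝ} (hc : ∀ j, 0 ≤ c j) (hc0 : 1 ≤ c 0)
    (hcs : ∀ j, 1 + (j + 2) * 4 ^ (j + 1) * (Real.exp (c j * Θ) * β) ^ 2 ≤ c (j + 1))
    {h : ℝ} (h0 : 0 ≤ h) (ht : t ≤ Θ) {w : Pt d → ℝ} (hwh : ∀ x, h * w x ^ 2 ≤ 1)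
    (hw : SmoothBounded L k P c b t w) :
    SmoothBounded L k P c b (t + h) (fun x => reactionStep h (w x)) := by
  refine ⟨contDiff_reactionStep_comp hw.1 h, hw.2.1.comp _, fun j hj => ?_⟩
  rcases j with - | j
  · refine exp_mul_bound_le hc0 h0 ?_ (hw.2.2 0 hj)
    rw [one_mul]
    exact eLpNorm_derivSum_zero_reactionStep_le h0 hwh _
  · refine exp_mul_bound_le (hcs j) h0 ?_ (hw.2.2 _ hj)
    refine eLpNorm_derivSum_succ_reactionStep_le hw.1 h0 j (by positivity) ?_ _
    have h1 := hw.2.2 j (by omega)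
    rw [hPk j (by omega), hb j (by omega)] at h1
    refine h1.trans ?_
    rw [ENNReal.ofReal_mul (Real.exp_pos _).le, ENNReal.ofReal_coe_nnreal]
    have := hc j
    gcongr

theorem Approximable.reactionSemigroup (hL : 0 < L) (hPk : ∀ j < k, P j = ⊤) {β : ℝ≥0}
    (hb : ∀ j < k, b j = β) {Θ : ℝ} (hc : ∀ j, 0 ≤ c j) (hc0 : 1 ≤ c 0)
    (hcs : ∀ j, 1 + (j + 2) * 4 ^ (j + 1) * (Real.exp (c j * Θ) * β) ^ 2 ≤ c (j + 1))
    {τ : ℝ} (hτ : 0 < τ) (ht : t + τ ≤ Θ) {u : Pt d → ℝ} (hu : Approximable L k P c b t u) :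
    Approximable L k P c b (t + τ) (reactionSemigroup τ u) := by
  refine hu.map hL (isLipschitzTorusL1_reactionSemigroup L hτ.le) fun w hw δ hδ => ?_
  obtain ⟨R₀, hR₀⟩ := hw.2.1.exists_bound hL hw.1.continuous
  -- R depends on w and restricts only the Euler step; R ≥ 1 makes [-R, R] invariant.
  set R : ℝ := R₀ + 1 with hRdef
  have hR : 1 ≤ R := by linarith [R₀.coe_nonneg]
  have hwR : ∀ x, |w x| ≤ R := fun x => (hR₀ x).trans (by linarith)
  obtain ⟨C, hC0, hC⟩ := exists_reactionStep_iterate_sub_le hR hwR hτ.le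
  obtain ⟨m, hm, hmh, hmδ⟩ := exists_nat_step (τ := τ) (η := 1 / (3 * R ^ 2))
    (C := (torusVolume d L).real univ * C) (by positivity) hδ
  have hm' : (0 : ℝ) < m := by exact_mod_cast hm
  have h0 : 0 ≤ τ / m := by positivity
  have hmR : 3 * (τ / m) * R ^ 2 ≤ 1 := by
    rw [le_div_iff₀ (by positivity)] at hmh
    linarith
  have key : ∀ n ≤ m, (∀ x, |(RandomSplitting.reactionStep (τ / m))^[n] (w x)| ≤ R) ∧
      SmoothBounded L k P c b (t + n * (τ / m))
        (fun x => (RandomSplitting.reactionStep (τ / m))^[n] (w x)) := by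
    intro n
    induction n with
    | zero => exact fun _ => ⟨hwR, by simpa using hw⟩
    | succ n ih =>
      intro hn
      obtain ⟨ih1, ih2⟩ := ih (by omega)
      simp only [Function.iterate_succ_apply']
      refine ⟨fun x => abs_reactionStep_le_of_le hR h0 hmR (ih1 x), ?_⟩
      have hnm : (n : ℝ) * (τ / m) ≤ τ := by
        rw [← mul_div_assoc, div_le_iff₀ hm', mul_comm]
        gcongr
        exact_mod_cast (by omega : n ≤ m)
      have h1 := ih2.reactionStep hPk hb hc hc0 hcs h0 (by linarith) fun x => by
        have h2 : ((RandomSplitting.reactionStep (τ / m))^[n] (w x)) ^ 2 ≤ R ^ 2 :=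
          sq_le_sq' (abs_le.1 (ih1 x)).1 (abs_le.1 (ih1 x)).2
        nlinarith [mul_le_mul_of_nonneg_left h2 h0]
      rwa [show t + n * (τ / m) + τ / m = t + ((n + 1 : ℕ) : ℝ) * (τ / m) by push_cast; ring] at h1
  have hw' := (key m le_rfl).2
  rw [mul_div_cancel₀ _ hm'.ne'] at hw'
  refine ⟨_, hw', (eLpNorm_one_le_of_bound hL (hC m hm hmR)).trans ?_⟩
  rw [← mul_div_assoc]
  exact ENNReal.ofReal_le_ofReal hmδ

/-! ### Growth rates and iteration of the splitting method -/

/-- The growth rates of the Sobolev norms: the rate of order `j + 1` depends on the bound for the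
`L^∞` norms of the derivatives up to order `j` on the time interval `[0, Θ]`. -/
noncomputable def growthRate (a : ℕ → ℝ) (Θ β : ℝ) : ℕ → ℝ
  | 0 => a 0 + 1
  | j + 1 => a (j + 1) + (1 + (j + 2) * 4 ^ (j + 1) * (Real.exp (growthRate a Θ β j * Θ) * β) ^ 2)

theorem le_growthRate (a : ℕ → ℝ) (Θ β : ℝ) (j : ℕ) : a j ≤ growthRate a Θ β j := by
  rcases j with - | j
  · simp [growthRate]
  · rw [growthRate]
    have : 0 ≤ ((j : ℝ) + 2) * 4 ^ (j + 1) * (Real.exp (growthRate a Θ β j * Θ) * β) ^ 2 := by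
      positivity
    linarith

/-- Uniform control of the splitting method: there are growth rates, depending only on the `L^∞`
bound `β` for the derivatives of order less than `k`, such that every stage of the splitting method
stays in the approximation class. -/
theorem exists_rates_approximable (hL : 0 < L) {ν : ℝ} (hν : 0 < ν) {v : Pt d → Pt d}
    (hv : ContDiff ℝ ∞ v) (hvp : IsTorusPeriodic L v) (T : ℝ) (β : ℝ≥0) :
    ∃ c : ℕ → ℝ, (∀ j, 0 ≤ c j) ∧ ∀ (k : ℕ) (P : ℕ → ℝ≥0∞) (b : ℕ → ℝ≥0∞), (∀ j, 1 ≤ P j) →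
      (∀ j < k, P j = ⊤) → (∀ j < k, b j = β) → ∀ u₀ : Pt d → ℝ, Approximable L k P c b 0 u₀ →
      ∀ τ : ℝ, 0 < τ → ∀ ξ : ℕ → Equiv.Perm (Fin 3), ∀ n : ℕ, ((n : ℝ) + 1) * τ ≤ T →
      ∀ i : Fin 4, ∃ t ≤ 3 * T,
        Approximable L k P c b t (stage ν v τ (ξ n) (numericalSolution ν v τ ξ u₀ n) i) := by
  obtain ⟨h₀, hh₀, ha⟩ := exists_eLpNorm_derivSum_comp_advectionStep_le hL hv hvp
  choose a ha0 hstep using ha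
  -- Each of the three stages advances the time of the class by τ, hence the horizon 3T.
  set c := growthRate a (3 * T) β with hcdef
  have hac : ∀ j, a j ≤ c j := le_growthRate a (3 * T) β
  have hc : ∀ j, 0 ≤ c j := fun j => (ha0 j).trans (hac j)
  have hc0 : 1 ≤ c 0 := by
    have := ha0 0
    simp only [hcdef, growthRate]
    linarith
  have hcs : ∀ j, 1 + (j + 2) * 4 ^ (j + 1) * (Real.exp (c j * (3 * T)) * β) ^ 2 ≤ c (j + 1) := by
    intro j
    have := ha0 (j + 1)
    simp only [hcdef]
    rw [growthRate]
    linarith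
  refine ⟨c, hc, fun k P b hP hPk hb u₀ hu₀ τ hτ ξ => ?_⟩
  have hsemi : ∀ (i : Fin 3) (t : ℝ) (u : Pt d → ℝ), t + τ ≤ 3 * T →
      Approximable L k P c b t u → Approximable L k P c b (t + τ) (semigroup ν v i τ u) := by
    intro i t u ht hu
    fin_cases i
    · exact hu.advectionSemigroup hL hv hvp hac hh₀ hstep hP hτ
    · exact hu.heatSemigroup hL hP hc hν hτ
    · exact hu.reactionSemigroup hL hPk hb hc hc0 hcs hτ ht
  have hstage : ∀ (σ : Equiv.Perm (Fin 3)) (t : ℝ) (u : Pt d → ℝ), t + 3 * τ ≤ 3 * T →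
      Approximable L k P c b t u → ∀ i : Fin 4,
        Approximable L k P c b (t + (i : ℕ) * τ) (stage ν v τ σ u i) := by
    intro σ t u ht hu i
    have h1 := hsemi (σ 0) t u (by linarith) hu
    have h2 := hsemi (σ 1) _ _ (by linarith) h1
    have h3 := hsemi (σ 2) _ _ (by linarith) h2
    fin_cases i
    · simpa [stage] using hu
    · simpa [stage] using h1
    · rw [show t + τ + τ = t + 2 * τ by ring] at h2
      simpa [stage] using h2
    · rw [show t + τ + τ + τ = t + 3 * τ by ring] at h3
      simpa [stage] using h3
  have hnum : ∀ n : ℕ, n * τ ≤ T →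
      Approximable L k P c b (3 * n * τ) (numericalSolution ν v τ ξ u₀ n) := by
    intro n
    induction n with
    | zero => intro _; simpa [numericalSolution] using hu₀
    | succ n ih =>
      intro hn
      push_cast at hn ⊢
      have h1 := hstage (ξ n) _ _ (by linarith) (ih (by linarith)) 3
      rw [show 3 * (n : ℝ) * τ + ((3 : Fin 4) : ℕ) * τ = 3 * ((n : ℝ) + 1) * τ by
        simp; ring] at h1
      exact h1
  intro n hn i
  refine ⟨_, ?_, hstage (ξ n) _ _ (by linarith) (hnum n (by linarith)) i⟩
  have hi : ((i : ℕ) : ℝ) ≤ 3 := by exact_mod_cast (by omega : (i : ℕ) ≤ 3)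
  nlinarith

/-! ### Initial data and conclusion -/

theorem sobolevNorm_le_of_weakDerivNorm_le {p B : ℝ≥0∞} (hp : 1 ≤ p) {u : Pt d → ℝ}
    (h : ∀ α : Fin d → ℕ, ∑ i, α i ≤ k → weakDerivNorm L α p u ≤ B) :
    sobolevNorm L k p u ≤ (multiIndices d k).card * B := by
  have hN : (1 : ℝ≥0∞) ≤ (multiIndices d k).card := by
    have : 0 ∈ multiIndices d k := mem_multiIndices.2 (by simp)
    exact_mod_cast Finset.card_pos.2 ⟨0, this⟩
  rw [sobolevNorm]
  split_ifs with hpt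
  · subst hpt
    exact (Finset.sup_le fun α hα => h α (mem_multiIndices.1 hα)).trans (le_mul_of_one_le_left' hN)
  · have hp0 : 0 < p.toReal := ENNReal.toReal_pos (zero_lt_one.trans_le hp).ne' hpt
    have hp1 : 1 ≤ p.toReal := by
      rw [← ENNReal.toReal_one]
      exact ENNReal.toReal_mono hpt hp
    calc _ ≤ (∑ α ∈ multiIndices d k, B ^ p.toReal) ^ (1 / p.toReal) := by
          gcongr with α hα
          exact h α (mem_multiIndices.1 hα)
      _ = ((multiIndices d k).card : ℝ≥0∞) ^ (1 / p.toReal) * B := by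
          rw [Finset.sum_const, nsmul_eq_mul, ENNReal.mul_rpow_of_nonneg _ _ (by positivity),
            ← ENNReal.rpow_mul, mul_one_div_cancel hp0.ne', ENNReal.rpow_one]
      _ ≤ _ := by
          gcongr
          calc _ ≤ ((multiIndices d k).card : ℝ≥0∞) ^ (1 : ℝ) :=
                ENNReal.rpow_le_rpow_of_exponent_le hN (by rwa [div_le_one hp0])
            _ = _ := ENNReal.rpow_one _

/-- Only the bound of order k is needed, since `derivSum k` dominates every D^α with |α| ≤ k. -/
theorem Approximable.sobolevNorm_le (hL : 0 < L) (hc : ∀ j, 0 ≤ c j) {p : ℝ≥0∞} (hp : 2 ≤ p)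
    (hPp : P k = p) (hb : b k ≠ ⊤) {Θ : ℝ} (ht : t ≤ Θ) {u : Pt d → ℝ}
    (hu : Approximable L k P c b t u) : sobolevNorm L k p u ≤
      (multiIndices d k).card * (ENNReal.ofReal (Real.exp (c k * Θ)) * b k) := by
  refine sobolevNorm_le_of_weakDerivNorm_le (le_trans (by norm_num) hp) fun α hα =>
    weakDerivNorm_le_of_approx hL hu.1 hp (ENNReal.mul_ne_top ENNReal.ofReal_ne_top hb)
      fun δ hδ => ?_
  obtain ⟨w, hw, hwu⟩ := hu.2 δ hδ
  refine ⟨w, hw.1, hw.2.1, hwu, ?_⟩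
  have h1 := (hw.mono hc ht).2.2 k le_rfl
  rw [hPp] at h1
  refine (eLpNorm_mono_real fun x => ?_).trans h1
  exact abs_multiDeriv_le_derivSum hw.1 hα x

theorem memTorusL1_of_sobolevNorm_lt_top {p : ℝ≥0∞} (hp : 1 ≤ p) {u : Pt d → ℝ}
    (h : sobolevNorm L k p u < ⊤) : MemTorusL1 L u := by
  have h1 : weakDerivNorm L (0 : Fin d → ℕ) p u < ⊤ :=
    (weakDerivNorm_le_sobolevNorm (by simp) hp u).trans_lt h
  obtain ⟨g, hg⟩ := iInf_lt_iff.1 h1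
  obtain ⟨hg, -⟩ := iInf_lt_iff.1 hg
  exact hg.1

/-- Initial data in a Sobolev space are approximable by mollification. -/
theorem approximable_of_sobolevNorm (hL : 0 < L) (hP : ∀ j, 1 ≤ P j) {u : Pt d → ℝ}
    (hu : MemTorusL1 L u) (hb : ∀ j ≤ k, ∃ i, j ≤ i ∧
      partialCount d i * sobolevNorm L i (P j) u ≤ b j) :
    Approximable L k P c b 0 u := by
  refine ⟨hu, fun δ hδ => ?_⟩
  obtain ⟨ρ, hρ, hsm, hδ'⟩ := exists_mollifier hL hu (δ := ENNReal.ofReal δ) (by simpa using hδ)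
  refine ⟨average ρ u, ⟨hsm u hu, hu.1.average ρ, fun j hj => ?_⟩, hδ'⟩
  obtain ⟨i, hji, hi⟩ := hb j hj
  rw [mul_zero, Real.exp_zero, ENNReal.ofReal_one, one_mul]
  refine le_trans (eLpNorm_mono_real fun x => ?_)
    ((eLpNorm_derivSum_average_le_sobolevNorm hL hsm hu i (hP j)).trans hi)
  rw [Real.norm_of_nonneg (derivSum_nonneg _ _ _)]
  exact derivSum_mono hji _ _

/-- On the torus the `W^{k,p}` norms are bounded uniformly in `p` for a function in `W^{k,∞}`. -/
theorem exists_sobolevNorm_le (hL : 0 < L) {u : Pt d → ℝ} (h : sobolevNorm L k ⊤ u < ⊤) :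
    ∃ B : ℝ≥0∞, B ≠ ⊤ ∧ ∀ p : ℝ≥0∞, 1 ≤ p → sobolevNorm L k p u ≤ B := by
  have := isFiniteMeasure_torusVolume (d := d) hL
  set V := torusVolume d L univ with hV
  -- The summand 1 next to the norm leaves room to pick a representative near the infimum; 1 + V
  -- dominates V^{1/p} for all p ≥ 1.
  refine ⟨(multiIndices d k).card * ((1 + V) * (sobolevNorm L k ⊤ u + 1)), ?_, fun p hp =>
    sobolevNorm_le_of_weakDerivNorm_le hp fun α hα => ?_⟩
  · have hVt : V ≠ ⊤ := measure_ne_top _ _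
    finiteness
  · have h1 : weakDerivNorm L α ⊤ u < sobolevNorm L k ⊤ u + 1 :=
      (weakDerivNorm_le_sobolevNorm hα le_top u).trans_lt
        (ENNReal.lt_add_right h.ne one_ne_zero)
    obtain ⟨g, hg⟩ := iInf_lt_iff.1 h1
    obtain ⟨hg, hgB⟩ := iInf_lt_iff.1 hg
    refine (iInf₂_le g hg).trans ?_
    refine (eLpNorm_le_eLpNorm_mul_rpow_measure_univ le_top hg.2.1.2.1).trans ?_
    rw [mul_comm]
    refine mul_le_mul' ?_ hgB.le
    simp only [ENNReal.toReal_top, div_zero, sub_zero]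
    have he : 1 / p.toReal ≤ 1 := by
      rcases eq_or_ne p ⊤ with rfl | hpt
      · simp
      · have : 1 ≤ p.toReal := by
          rw [← ENNReal.toReal_one]
          exact ENNReal.toReal_mono hpt hp
        rw [div_le_one (by linarith)]
        exact this
    calc V ^ (1 / p.toReal) ≤ (1 + V) ^ (1 / p.toReal) :=
          ENNReal.rpow_le_rpow le_add_self (by positivity)
      _ ≤ (1 + V) ^ (1 : ℝ) := ENNReal.rpow_le_rpow_of_exponent_le le_self_add he
      _ = 1 + V := ENNReal.rpow_one _

end

end RandomSplitting

/-! ### Choice of the constants and proof of the theorem -/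

theorem theorem3p2 (d : ℕ) (hd : 2 ≤ d) (L ν T : ℝ) (hL : 0 < L) (hν : 0 < ν) (hT : 0 < T)
    (v : EuclideanSpace ℝ (Fin d) → EuclideanSpace ℝ (Fin d))
    (hv_smooth : ContDiff ℝ ∞ v) (hv_per : RandomSplitting.IsTorusPeriodic L v)
    (hv_div : ∀ x, RandomSplitting.divergence v x = 0)
    (k : ℕ) (u₀ : EuclideanSpace ℝ (Fin d) → ℝ) (hu₀ : RandomSplitting.IsTorusPeriodic L u₀) :
    ∃ M : ℝ≥0∞ → ℝ≥0,
      (∀ p : ℝ≥0∞, 2 ≤ p → RandomSplitting.sobolevNorm L k p u₀ < ⊤ →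
        (1 ≤ k → RandomSplitting.sobolevNorm L (k - 1) ⊤ u₀ < ⊤) →
        ∀ τ : ℝ, 0 < τ → ∀ ξ : ℕ → Equiv.Perm (Fin 3), ∀ n : ℕ, ((n : ℝ) + 1) * τ ≤ T →
          RandomSplitting.sobolevNorm L k p (RandomSplitting.stage ν v τ (ξ n)
              (RandomSplitting.numericalSolution ν v τ ξ u₀ n) 1) +
            RandomSplitting.sobolevNorm L k p (RandomSplitting.stage ν v τ (ξ n)
              (RandomSplitting.numericalSolution ν v τ ξ u₀ n) 2) +
            RandomSplitting.sobolevNorm L k p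
              (RandomSplitting.numericalSolution ν v τ ξ u₀ (n + 1)) ≤ (M p : ℝ≥0∞)) ∧
      (RandomSplitting.sobolevNorm L k ⊤ u₀ < ⊤ →
        ∃ B : ℝ≥0, ∀ p : ℝ≥0∞, 2 ≤ p → M p ≤ B) := by
  open RandomSplitting in
  -- For k = 0 the truncated subtraction gives order 0, but then no j < k exists and the value of β
  -- is immaterial. For k ≥ 1 part 1 assumes the norm finite, so `toNNReal` loses nothing.
  set β : ℝ≥0 := (partialCount d (k - 1) * sobolevNorm L (k - 1) ⊤ u₀).toNNReal with hβ
  obtain ⟨c, hc, happ⟩ := exists_rates_approximable hL hν hv_smooth hv_per T β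
  set D : ℝ≥0∞ := (multiIndices d k).card * ENNReal.ofReal (Real.exp (c k * (3 * T))) *
    partialCount d k with hD
  have hDt : D ≠ ⊤ := by finiteness
  -- Three stages, each bounded by D times the initial norm, with D independent of p. An infinite
  -- initial norm gives the value 0, for which part 1 claims nothing.
  refine ⟨fun p => (3 * (D * sobolevNorm L k p u₀)).toNNReal, ?_, fun htop => ?_⟩
  · intro p hp hk hk1 τ hτ ξ n hn
    have hp1 : 1 ≤ p := le_trans (by norm_num) hp
    set P : ℕ → ℝ≥0∞ := fun j => if j < k then ⊤ else p with hPdef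
    set b : ℕ → ℝ≥0∞ := fun j => if j < k then (β : ℝ≥0∞) else
      partialCount d k * sobolevNorm L k p u₀ with hbdef
    have hP : ∀ j, 1 ≤ P j := by
      intro j
      simp only [hPdef]
      split_ifs
      exacts [le_top, hp1]
    have hPk : ∀ j < k, P j = ⊤ := fun j hj => by simp only [hPdef, if_pos hj]
    have hbk : ∀ j < k, b j = β := fun j hj => by simp only [hbdef, if_pos hj]
    have hPp : P k = p := by simp [hPdef]
    have hbp : b k = partialCount d k * sobolevNorm L k p u₀ := by simp [hbdef]
    have hbt : b k ≠ ⊤ := by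
      rw [hbp]
      exact ENNReal.mul_ne_top (ENNReal.natCast_ne_top _) hk.ne
    have hu : Approximable L k P c b 0 u₀ := by
      refine approximable_of_sobolevNorm hL hP (memTorusL1_of_sobolevNorm_lt_top hp1 hk)
        fun j hj => ?_
      -- All orders below k are bounded by the single W^{k-1,∞} norm, the top order by the W^{k,p}
      -- norm.
      rcases hj.lt_or_eq with hj | rfl
      · refine ⟨k - 1, by omega, ?_⟩
        rw [hPk j hj, hbk j hj, hβ, ENNReal.coe_toNNReal]
        exact ENNReal.mul_ne_top (ENNReal.natCast_ne_top _) (hk1 (by omega)).ne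
      · exact ⟨j, le_rfl, by rw [hPp, hbp]⟩
    have hst : ∀ i : Fin 4, sobolevNorm L k p
        (stage ν v τ (ξ n) (numericalSolution ν v τ ξ u₀ n) i) ≤ D * sobolevNorm L k p u₀ := by
      intro i
      obtain ⟨t, ht, hi⟩ := happ k P b hP hPk hbk u₀ hu τ hτ ξ n hn i
      refine (hi.sobolevNorm_le hL hc hp hPp hbt ht).trans_eq ?_
      rw [hbp, hD]
      ring
    rw [ENNReal.coe_toNNReal (ENNReal.mul_ne_top (by norm_num) (ENNReal.mul_ne_top hDt hk.ne))]
    refine (add_le_add (add_le_add (hst 1) (hst 2)) (hst 3)).trans_eq ?_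
    ring
  · obtain ⟨B, hB, hBp⟩ := exists_sobolevNorm_le hL htop
    refine ⟨(3 * (D * B)).toNNReal, fun p hp => ?_⟩
    refine ENNReal.toNNReal_mono (ENNReal.mul_ne_top (by norm_num) (ENNReal.mul_ne_top hDt hB)) ?_
    gcongr
    exact hBp p (le_trans (by norm_num) hp)
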